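/- **Setting.** Let $n\ge 1$ and let $M$ be a smooth $(2n+1)$-manifold with a nondegenerate integrable CR structure $T^{1,0}\subset\mathbb C TM$ and a pseudohermitian form $\theta$ (a nowhere vanishing real one-form annihilating $T^{1,0}$), with $d\theta=i h_{\alpha\bar\beta}\theta^\alpha\wedge\theta^{\bar\beta}$ and characteristic field $T$ ($\theta(T)=1$, $T\lrcorner d\theta=0$). Assume that $\theta$ is *flat*: locally equivalent to the Heisenberg group $\mathbb C^n\times\mathbb R$ with $\theta_0=dt+\frac i2\sum_\alpha\varepsilon_\alpha(z^\alpha d\bar z^\alpha-\bar z^\alpha dz^\alpha)$, $\varepsilon_\alpha=\pm1$, and $T^{1,0}=\bigcap_\alpha\ker d\bar z^\alpha\cap\ker\theta_0$. Fix a complex line bundle $\mathcal E(1,0)$ that is a $-1/(n+2)$ power of the canonical bundle, and put $\mathcal E(w,w')=\mathcal E(1,0)^w\otimes\overline{\mathcal E(1,0)}{}^{w'}$ for $w,w'\in\mathbb C$, $w-w'\in\mathbb Z$. Let $\nabla$ be the Tanaka–Webster connection and the connections it induces, and let $A_{\alpha\beta}$ and $R_{\alpha\bar\beta}$ be its torsion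 and Webster–Ricci tensor. Let $t\in\mathcal E(1,1)$ be the density that corresponds to $\theta$ (so $t=|\zeta|^{-2/(n+2)}$ for a volume normalized section $\zeta$ of the canonical bundle). Greek indices are raised and lowered with $\boldsymbol h_{\alpha\bar\beta}=t\,h_{\alpha\bar\beta}$, and the index $0$ refers to $\boldsymbol\theta=t\,\theta$. Set $P_{\alpha\bar\beta}=\frac1{n+2}\big(R_{\alpha\bar\beta}-\frac{1}{2(n+1)}R_\gamma{}^\gamma\boldsymbol h_{\alpha\bar\beta}\big)$, $P=P_\alpha{}^\alpha$, $T_\alpha=\frac1{n+2}(\nabla_\alpha P-i\nabla^\beta A_{\alpha\beta})$ and $S=-\frac1n(\nabla^\alpha T_\alpha+\nabla^{\bar\alpha}T_{\bar\alpha}+P_{\alpha\bar\beta}P^{\alpha\bar\beta}-A_{\alpha\beta}A^{\alpha\beta})$. The tractor bundle is $\mathcal E_A=\mathcal E(1,0)\oplus\mathcal E_\alpha(1,0)\oplus\mathcal E(0,-1)$ in the realization given by $\theta$, with elements $(\sigma,\tau_\alpha,\rho)$, Hermitian metric $h_{A\bar B}$ given by $2\operatorname{Re}(\sigma\bar\rho)+\boldsymbol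 h^{\alpha\bar\beta}\tau_\alpha\overline{\tau_\beta}$, and connection $$\nabla_\beta(\sigma,\tau_\alpha,\rho)=(\nabla_\beta\sigma-\tau_\beta,\ \nabla_\beta\tau_\alpha+iA_{\alpha\beta}\sigma,\ \nabla_\beta\rho-P_\beta{}^\alpha\tau_\alpha+T_\beta\sigma),$$ $$\nabla_{\bar\beta}(\sigma,\tau_\alpha,\rho)=(\nabla_{\bar\beta}\sigma,\ \nabla_{\bar\beta}\tau_\alpha+\boldsymbol h_{\alpha\bar\beta}\rho+P_{\alpha\bar\beta}\sigma,\ \nabla_{\bar\beta}\rho+iA_{\bar\beta}{}^\alpha\tau_\alpha-T_{\bar\beta}\sigma),$$ $$\nabla_0(\sigma,\tau_\alpha,\rho)=(\nabla_0\sigma+\tfrac{i}{n+2}P\sigma-i\rho,\ \nabla_0\tau_\alpha-iP_\alpha{}^\beta\tau_\beta+\tfrac i{n+2}P\tau_\alpha+2iT_\alpha\sigma,\ \nabla_0\rho+\tfrac i{n+2}P\rho+2iT^\alpha\tau_\alpha+iS\sigma).$$ Let $\mathcal E^*(w,w')$ be any tensor product of $\mathcal E(w,w')$ with copies of $\mathcal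 E_A$, its conjugate $\mathcal E_{\bar A}$, and their duals. Let $Z_A=(0,0,1)\in\mathcal E_A(0,1)$, acting by multiplication, with conjugate $Z_{\bar A}$. On $\mathcal E^*(w,w')$ define, with the coupled connection, $$\Box f=\nabla^\alpha\nabla_\alpha f+iw\nabla_0f+w\big(1+\tfrac{w'-w}{n+2}\big)Pf,\qquad \overline{\Box}f=\nabla_\alpha\nabla^\alpha f-iw'\nabla_0f+w'\big(1-\tfrac{w'-w}{n+2}\big)Pf,$$ both with values in $\mathcal E^*(w-1,w'-1)$, and $$D_Af=\big(w(n+w+w')f,\ (n+w+w')\nabla_\alpha f,\ -\Box f\big)\in\mathcal E_A\otimes\mathcal E^*(w-1,w'),$$ $$D_{\bar A}f=\big(w'(n+w+w')f,\ (n+w+w')\nabla_{\bar\alpha} f,\ -\overline\Box f\big)\in\mathcal E_{\bar A}\otimes\mathcal E^*(w,w'-1).$$ Tractor indices are raised with the inverse of $h_{A\bar B}$, so $D^B=h^{B\bar A}D_{\bar A}$ and $D^{\bar B}=h^{A\bar B}D_A$. $\Box^k$ and $\overline\Box{}^k$ denote $k$-fold compositions, in which each factor acts with the current weights. **Proposition.**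 Let $(w,w')$ satisfy $n+w+w'+1=k\in\{1,2,\dots\}$ and let $k_1,k_2\ge0$ be integers with $k_1+k_2=k-1$. Then, as operators on $\mathcal E^*(w,w')$, $$\Box\,\underbrace{D_B\cdots D_I}_{k_1}\,\underbrace{D_{\bar J}\cdots D_{\bar Q}}_{k_2}=(-1)^{k-1}Z_B\cdots Z_I\,Z_{\bar J}\cdots Z_{\bar Q}\,\Box^k ,$$ $$D^{\bar Q}\cdots D^{\bar J}D^I\cdots D^B\,\Box\,\underbrace{D_B\cdots D_I}_{k_1}\,\underbrace{D_{\bar J}\cdots D_{\bar Q}}_{k_2}=(-1)^{k-1}(k-1)!\prod_{i=0}^{k_1-1}(w-i)\prod_{j=0}^{k_2-1}(w'-j)\;\Box^k ,$$ $$\Box^k=\overline\Box{}^k .$$ Empty products are $1$. -/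

import Mathlib

open scoped Manifold ContDiff TensorProduct

noncomputable section

namespace CRTractor

/-! ## Complexified tangent vectors -/

section Complexification

variable {V W : Type*} [AddCommGroup V] [Module ℝ V] [AddCommGroup W] [Module ℝ W]

/-- Real part of an element of `ℂ ⊗ V`. -/
def cRe : ℂ ⊗[ℝ] V →ₗ[ℝ] V :=
  (TensorProduct.lid ℝ V).toLinearMap ∘ₗ LinearMap.rTensor V Complex.reLm

/-- Imaginary part of an element of `ℂ ⊗ V`. -/
def cIm : ℂ ⊗[ℝ] V →ₗ[ℝ] V :=
  (TensorProduct.lid ℝ V).toLinearMap ∘ₗ LinearMap.rTensor V Complex.imLm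

/-- The element `u + i v` of `ℂ ⊗ V`. -/
def cMk (u v : V) : ℂ ⊗[ℝ] V := (1 : ℂ) ⊗ₜ[ℝ] u + Complex.I ⊗ₜ[ℝ] v

/-- Complex conjugation on `ℂ ⊗ V`. -/
def cConj (v : ℂ ⊗[ℝ] V) : ℂ ⊗[ℝ] V := cMk (cRe v) (-cIm v)

/-- Complex-linear extension of a real-linear form `φ : V → ℂ`, evaluated on `ℂ ⊗ V`. -/
def cEval (φ : V → ℂ) (v : ℂ ⊗[ℝ] V) : ℂ := φ (cRe v) + Complex.I * φ (cIm v)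

end Complexification

/-! ## Vector fields on a smooth manifold of dimension `2n+1` -/

section VectorFields

variable {n : ℕ} {M : Type*} [TopologicalSpace M]
  [ChartedSpace (EuclideanSpace ℝ (Fin (2 * n + 1))) M]
  [IsManifold (𝓡 (2 * n + 1)) ∞ M]

/-- The real tangent space. -/
abbrev TS (n : ℕ) {M : Type*} [TopologicalSpace M]
    [ChartedSpace (EuclideanSpace ℝ (Fin (2 * n + 1))) M] (x : M) : Type :=
  TangentSpace (𝓡 (2 * n + 1)) x

/-- The complexified tangent space. -/
abbrev CT (n : ℕ) {M : Type*} [TopologicalSpace M]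
    [ChartedSpace (EuclideanSpace ℝ (Fin (2 * n + 1))) M] (x : M) : Type :=
  ℂ ⊗[ℝ] TangentSpace (𝓡 (2 * n + 1)) x

/-- The real vector field `X` is smooth on `U`. -/
def SmoothVF (X : (x : M) → TS n x) (U : Set M) : Prop :=
  ContMDiffOn (𝓡 (2 * n + 1)) (𝓡 (2 * n + 1)).tangent ∞
    (fun x => (⟨x, X x⟩ : TangentBundle (𝓡 (2 * n + 1)) M)) U

/-- The complex vector field `Z` is smooth on `U`. -/
def SmoothCVF (Z : (x : M) → CT n x) (U : Set M) : Prop :=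
  SmoothVF (fun x => cRe (Z x)) U ∧ SmoothVF (fun x => cIm (Z x)) U

/-- A complex-valued function is smooth on `U`. -/
def SmoothFn (n : ℕ) {M : Type*} [TopologicalSpace M]
    [ChartedSpace (EuclideanSpace ℝ (Fin (2 * n + 1))) M]
    [IsManifold (𝓡 (2 * n + 1)) ∞ M] (f : M → ℂ) (U : Set M) : Prop :=
  ContMDiffOn (𝓡 (2 * n + 1)) 𝓘(ℝ, ℂ) ∞ f U

/-- The derivative `Zf` of a complex function along a complex vector field. -/
def dir (Z : (x : M) → CT n x) (f : M → ℂ) (x : M) : ℂ :=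
  cEval (fun v : TS n x => (mfderiv (𝓡 (2 * n + 1)) 𝓘(ℝ, ℂ) f x v : ℂ)) (Z x)

/-- The derivative of a real function along a real vector field. -/
def rdir (X : (x : M) → TS n x) (f : M → ℝ) (x : M) : ℝ :=
  mfderiv (𝓡 (2 * n + 1)) 𝓘(ℝ, ℝ) f x (X x)

/-- Lie bracket of real vector fields. -/
def bracket (X Y : (x : M) → TS n x) : (x : M) → TS n x :=
  VectorField.mlieBracket (𝓡 (2 * n + 1)) X Y

/-- Lie bracket of complex vector fields (complex-bilinear extension). -/
def cBracket (Z W : (x : M) → CT n x) : (x : M) → CT n x := fun x =>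
  cMk (bracket (fun y => cRe (Z y)) (fun y => cRe (W y)) x
      - bracket (fun y => cIm (Z y)) (fun y => cIm (W y)) x)
    (bracket (fun y => cRe (Z y)) (fun y => cIm (W y)) x
      + bracket (fun y => cIm (Z y)) (fun y => cRe (W y)) x)

/-- Exterior derivative of a real one-form, evaluated on vector fields:
`dθ(X,Y) = X(θ(Y)) - Y(θ(X)) - θ([X,Y])`. -/
def dForm (θ : (x : M) → TS n x →L[ℝ] ℝ) (X Y : (x : M) → TS n x) (x : M) : ℝ :=
  rdir X (fun y => θ y (Y y)) x - rdir Y (fun y => θ y (X y)) x - θ x (bracket X Y x)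

/-- Complex-linear extension of a real one-form. -/
def cForm (θ : (x : M) → TS n x →L[ℝ] ℝ) (x : M) (v : CT n x) : ℂ :=
  cEval (fun u => ((θ x u : ℝ) : ℂ)) v

/-- `Z₁,…,Zₙ` is a smooth frame over `U` of the distribution `D` of complex subspaces. -/
def IsFrame (D : (x : M) → Submodule ℂ (CT n x)) (Z : Fin n → (x : M) → CT n x)
    (U : Set M) : Prop :=
  (∀ α, SmoothCVF (Z α) U) ∧
    ∀ x ∈ U, LinearIndependent ℂ (fun α => Z α x) ∧
      Submodule.span ℂ (Set.range fun α => Z α x) = D x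

/-- Matrix `h_{α β̄} = i θ([Z_α, Z_β̄])` of the Levi form of `θ` in a frame of `T^{1,0}`.
Since `θ` kills `Z_α` and `Z_β̄` this is `-i (Zθ(W̄) - W̄θ(Z) - θ([Z,W̄]))`, that is
`dθ = i h_{α β̄} θ^α ∧ θ^β̄`. -/
def levi (θ : (x : M) → TS n x →L[ℝ] ℝ) (Z : Fin n → (x : M) → CT n x) (x : M) :
    Matrix (Fin n) (Fin n) ℂ :=
  Matrix.of fun α β => Complex.I * cForm θ x (cBracket (Z α) (fun y => cConj (Z β y)) x)

end VectorFields

/-! ## Pseudohermitian structures -/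

/-- A nondegenerate CR structure on a `(2n+1)`-manifold with a choice of pseudohermitian
form `θ`. -/
structure PseudoHermitian (n : ℕ) (M : Type*) [TopologicalSpace M]
    [ChartedSpace (EuclideanSpace ℝ (Fin (2 * n + 1))) M]
    [IsManifold (𝓡 (2 * n + 1)) ∞ M] where
  /-- the bundle `T^{1,0}` -/
  T10 : (x : M) → Submodule ℂ (CT n x)
  /-- it is a smooth complex subbundle of rank `n` -/
  exists_frame : ∀ x : M, ∃ U : Set M, IsOpen U ∧ x ∈ U ∧ ∃ Z, IsFrame T10 Z U
  /-- `T^{1,0} ∩ T^{0,1} = 0` -/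
  disjoint_conj : ∀ x, ∀ v ∈ T10 x, cConj v ∈ T10 x → v = 0
  /-- `[T^{1,0}, T^{1,0}] ⊆ T^{1,0}` -/
  integrable : ∀ U : Set M, IsOpen U → ∀ Z W : (x : M) → CT n x,
    SmoothCVF Z U → SmoothCVF W U → (∀ x ∈ U, Z x ∈ T10 x) → (∀ x ∈ U, W x ∈ T10 x) →
      ∀ x ∈ U, cBracket Z W x ∈ T10 x
  /-- the real one-form `θ` -/
  θ : (x : M) → TS n x →L[ℝ] ℝ
  θ_smooth : ∀ U : Set M, IsOpen U → ∀ X : (x : M) → TS n x, SmoothVF X U →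
    ContMDiffOn (𝓡 (2 * n + 1)) 𝓘(ℝ, ℝ) ∞ (fun x => θ x (X x)) U
  θ_ne_zero : ∀ x, θ x ≠ 0
  /-- `θ` is a section of the annihilator of `H = Re T^{1,0}` -/
  θ_T10 : ∀ x, ∀ v ∈ T10 x, θ x (cRe v) = 0
  /-- the Levi form is nondegenerate -/
  nondegenerate : ∀ U : Set M, IsOpen U → ∀ Z, IsFrame T10 Z U →
    ∀ x ∈ U, (levi θ Z x).det ≠ 0

section Pseudo

variable {n : ℕ} {M : Type*} [TopologicalSpace M]
  [ChartedSpace (EuclideanSpace ℝ (Fin (2 * n + 1))) M]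
  [IsManifold (𝓡 (2 * n + 1)) ∞ M]

/-- `v` satisfies `θ(v) = 1` and `v ⌟ dθ = 0`. -/
def IsReebAt (θ : (x : M) → TS n x →L[ℝ] ℝ) (x : M) (v : TS n x) : Prop :=
  θ x v = 1 ∧ ∀ U : Set M, IsOpen U → x ∈ U → ∀ X Y : (x : M) → TS n x,
    SmoothVF X U → SmoothVF Y U → X x = v → dForm θ X Y x = 0

/-- The vector field `T` with `θ(T) = 1` and `T ⌟ dθ = 0`
(it exists and is unique because the Levi form is nondegenerate). -/
def PseudoHermitian.reeb (S : PseudoHermitian n M) (x : M) : TS n x :=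
  Classical.epsilon (IsReebAt S.θ x)

end Pseudo

/-! ## Flatness: local equivalence with the Heisenberg group -/

/-- The underlying manifold `ℂⁿ × ℝ` of the Heisenberg group, with coordinates `(z, t)`. -/
abbrev Heis (n : ℕ) : Type := (Fin n → ℂ) × ℝ

/-- Diagonal entries of the standard Hermitian form of signature `(p, n-p)`. -/
def heisSign (p : ℕ) {n : ℕ} (α : Fin n) : ℝ := if (α : ℕ) < p then 1 else -1

/-- The standard form
`θ = dt + (i/2) ∑ ε_α (z^α dz̄^α - z̄^α dz^α) = dt + ∑ ε_α Im (z̄^α dz^α)`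
of signature `(p, n-p)`; here `dθ = i ∑ ε_α dz^α ∧ dz̄^α`. -/
def heisForm (p : ℕ) {n : ℕ} (q v : Heis n) : ℝ :=
  v.2 + ∑ α, heisSign p α * (star (q.1 α) * v.1 α).im

/-- `T^{1,0}` of the Heisenberg group: the common kernel of `θ` and all `dz̄^α`. It is
spanned by `∂/∂z^α + (i/2) ε_α z̄^α ∂/∂t`. -/
def heisT10 (p : ℕ) {n : ℕ} (q : Heis n) (v : ℂ ⊗[ℝ] Heis n) : Prop :=
  cEval (fun u : Heis n => ((heisForm p q u : ℝ) : ℂ)) v = 0 ∧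
    ∀ α, cEval (fun u : Heis n => star (u.1 α)) v = 0

section Flat

variable {n : ℕ} {M : Type*} [TopologicalSpace M]
  [ChartedSpace (EuclideanSpace ℝ (Fin (2 * n + 1))) M]
  [IsManifold (𝓡 (2 * n + 1)) ∞ M]

/-- The pseudohermitian structure is locally equivalent to the Heisenberg group with its
standard pseudohermitian structure (of some signature): near every point there is a
diffeomorphism onto an open subset of the Heisenberg group that matches `θ` and `T^{1,0}`. -/
def PseudoHermitian.IsFlat (S : PseudoHermitian n M) : Prop :=
  ∀ x : M, ∃ p : ℕ, ∃ Φ : OpenPartialHomeomorph M (Heis n), x ∈ Φ.source ∧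
    ContMDiffOn (𝓡 (2 * n + 1)) 𝓘(ℝ, Heis n) ∞ Φ Φ.source ∧
    ContMDiffOn 𝓘(ℝ, Heis n) (𝓡 (2 * n + 1)) ∞ Φ.symm Φ.target ∧
    ∀ y ∈ Φ.source,
      (∀ v : TS n y,
        S.θ y v = heisForm p (Φ y) (mfderiv (𝓡 (2 * n + 1)) 𝓘(ℝ, Heis n) Φ y v : Heis n)) ∧
      ∀ v : CT n y, v ∈ S.T10 y ↔
        heisT10 p (Φ y)
          (cMk (mfderiv (𝓡 (2 * n + 1)) 𝓘(ℝ, Heis n) Φ y (cRe v) : Heis n)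
            (mfderiv (𝓡 (2 * n + 1)) 𝓘(ℝ, Heis n) Φ y (cIm v) : Heis n))

end Flat

/-! ## Admissible coframes and the Tanaka–Webster connection -/

/-- An admissible coframe `θ^α` over `U` together with the dual frame `Z_α` of `T^{1,0}`,
normalized by `|det h_{α β̄}| = 1`. The normalization says that
`ζ = θ ∧ θ¹ ∧ ⋯ ∧ θⁿ` is volume normalized with respect to `θ`, so that for a section `s` of
`E(1,0)` with `s^{-(n+2)} = ζ` the scale `t ∈ E(1,1)` of `θ` is `s s̄`, and the weighted
form `t θ`, the weighted Levi form `t h` and its inverse have in the trivializations by powers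
of `s` and `s̄` the same components as `θ`, `h` and `h⁻¹`. -/
structure AdmissibleCoframe {n : ℕ} {M : Type*} [TopologicalSpace M]
    [ChartedSpace (EuclideanSpace ℝ (Fin (2 * n + 1))) M]
  [IsManifold (𝓡 (2 * n + 1)) ∞ M] (S : PseudoHermitian n M)
    (U : Set M) where
  Z : Fin n → (x : M) → CT n x
  th : Fin n → (x : M) → CT n x →ₗ[ℂ] ℂ
  isFrame : IsFrame S.T10 Z U
  th_Z : ∀ x ∈ U, ∀ α β, th α x (Z β x) = if α = β then 1 else 0
  th_conj : ∀ x ∈ U, ∀ α β, th α x (cConj (Z β x)) = 0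
  th_reeb : ∀ x ∈ U, ∀ α, th α x (cMk (S.reeb x) 0) = 0
  normalized : ∀ x ∈ U, ‖(levi S.θ Z x).det‖ = 1

/-- Labels of the frame `Z_α`, `Z_ᾱ`, `T` of the complexified tangent bundle. -/
inductive Dir (n : ℕ) : Type
  | lo : Fin n → Dir n
  | bar : Fin n → Dir n
  | zero : Dir n

/-- Complex conjugation on frame labels. -/
def Dir.conj {n : ℕ} : Dir n → Dir n
  | .lo α => .bar α
  | .bar α => .lo α
  | .zero => .zero

/-- The three slots of a tractor: `σ` (top), `τ_α` (middle), `ρ` (bottom). -/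
inductive TIdx (n : ℕ) : Type
  | top : TIdx n
  | mid : Fin n → TIdx n
  | bot : TIdx n

/-- Sum over a tractor index. -/
def tSum {n : ℕ} (F : TIdx n → ℂ) : ℂ := F .top + ∑ α, F (.mid α) + F .bot

/-- The kinds of tractor indices: `E_A`, `E_Ā`, `E^A`, `E^Ā`. -/
inductive Slot : Type
  | lo : Slot
  | loBar : Slot
  | up : Slot
  | upBar : Slot

/-- Multi-indices for a list of tractor indices. -/
@[reducible] def MI (n : ℕ) : List Slot → Type
  | [] => Unit
  | _ :: L => TIdx n × MI n L

/-- The matrices `Γ κ` acting on all indices of a tensor as a derivation: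
`∑_j ∑_B (Γ κ_j)_{A_j}{}^B f_{A_1 ⋯ B ⋯ A_r}`. -/
def derAct {n : ℕ} (Γ : Slot → TIdx n → TIdx n → ℂ) :
    (L : List Slot) → (MI n L → ℂ) → MI n L → ℂ
  | [], _, _ => 0
  | κ :: L, f, (A, I) =>
      tSum (fun B => Γ κ A B * f (B, I)) + derAct Γ L (fun J => f (A, J)) I

/-- The matrices `G κ` acting on all indices of a tensor. -/
def tensAct {n : ℕ} (G : Slot → TIdx n → TIdx n → ℂ) :
    (L : List Slot) → (MI n L → ℂ) → MI n L → ℂ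
  | [], f, I => f I
  | κ :: L, f, (A, I) => tSum fun B => G κ A B * tensAct G L (fun J => f (B, J)) I

namespace AdmissibleCoframe

variable {n : ℕ} {M : Type*} [TopologicalSpace M]
  [ChartedSpace (EuclideanSpace ℝ (Fin (2 * n + 1))) M]
  [IsManifold (𝓡 (2 * n + 1)) ∞ M] {S : PseudoHermitian n M} {U : Set M}
  (F : AdmissibleCoframe S U)

/-- The frame `Z_α`, `Z_ᾱ`, `T`. -/
def vec : Dir n → (x : M) → CT n x
  | .lo α => F.Z α
  | .bar α => fun x => cConj (F.Z α x)
  | .zero => fun x => cMk (S.reeb x) 0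

/-- The dual coframe `θ^α`, `θ^ᾱ`, `θ`. -/
def covec : Dir n → (x : M) → CT n x → ℂ
  | .lo α => fun x v => F.th α x v
  | .bar α => fun x v => star (F.th α x (cConj v))
  | .zero => fun x v => cForm S.θ x v

/-- `h α β = h_{α β̄}`. -/
def h (α β : Fin n) (x : M) : ℂ := levi S.θ F.Z x α β

/-- `hinv α β = h^{α β̄}`, where `h^{α β̄} h_{γ β̄} = δ^α_γ`. -/
def hinv (α β : Fin n) (x : M) : ℂ := (levi S.θ F.Z x)⁻¹ β α

/-- `om a β α = ω_β{}^α(E_a)`, the connection forms on the frame. They are the solution of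
`dθ^α = θ^β ∧ ω_β{}^α + A^α{}_β̄ θ ∧ θ^β̄` and
`dh_{β μ̄} = h_{α μ̄} ω_β{}^α + h_{β ν̄} conj (ω_μ{}^ν)`. -/
def om : Dir n → Fin n → Fin n → M → ℂ
  | .bar γ, β, α => fun x => F.th α x (cBracket (F.vec (.bar γ)) (F.Z β) x)
  | .zero, β, α => fun x => F.th α x (cBracket (F.vec .zero) (F.Z β) x)
  | .lo γ, β, α => fun x => ∑ μ, F.hinv α μ x *
      (dir (F.Z γ) (F.h β μ) x
        - ∑ ν, F.h β ν x * star (F.th ν x (cBracket (F.vec (.bar γ)) (F.Z μ) x)))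

/-- `A^α{}_β̄`. -/
def Amix (α β : Fin n) (x : M) : ℂ :=
  -F.th α x (cBracket (F.vec .zero) (F.vec (.bar β)) x)

/-- Torsion `A_{ᾱ β̄}`. -/
def Abar (α β : Fin n) (x : M) : ℂ := ∑ γ, F.h γ α x * F.Amix γ β x

/-- Torsion `A_{α β}`. -/
def A (α β : Fin n) (x : M) : ℂ := star (F.Abar α β x)

/-- The trace `ω_γ{}^γ(E_a)`. -/
def omTr (a : Dir n) (x : M) : ℂ := ∑ γ, F.om a γ γ x

/-- The one-form `ω_γ{}^γ` on an arbitrary complex vector. -/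
def omTrForm (x : M) (v : CT n x) : ℂ :=
  ∑ α, F.covec (.lo α) x v * F.omTr (.lo α) x
    + ∑ α, F.covec (.bar α) x v * F.omTr (.bar α) x
    + F.covec .zero x v * F.omTr .zero x

/-- Connection coefficient of `E(w,w')` in the trivialization by `s^w s̄^w'`,
where `s^{-(n+2)} = θ ∧ θ¹ ∧ ⋯ ∧ θⁿ`, whence `∇s = (n+2)⁻¹ ω_γ{}^γ ⊗ s`. -/
def wt (w w' : ℂ) (a : Dir n) (x : M) : ℂ :=
  (w * F.omTr a x + w' * star (F.omTr a.conj x)) / (n + 2)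

/-- Webster–Ricci tensor `R_{α β̄} = dω_γ{}^γ(Z_α, Z_β̄)`. -/
def Ric (α β : Fin n) (x : M) : ℂ :=
  dir (F.vec (.lo α)) (F.omTr (.bar β)) x - dir (F.vec (.bar β)) (F.omTr (.lo α)) x
    - F.omTrForm x (cBracket (F.vec (.lo α)) (F.vec (.bar β)) x)

/-- Webster scalar curvature. -/
def Scal (x : M) : ℂ := ∑ α, ∑ β, F.hinv α β x * F.Ric α β x

/-- `P_{α β̄}`. -/
def P (α β : Fin n) (x : M) : ℂ :=
  1 / (n + 2) * (F.Ric α β x - 1 / (2 * (n + 1)) * F.Scal x * F.h α β x)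

/-- The trace `P = P_α{}^α`. -/
def trP (x : M) : ℂ := ∑ α, ∑ β, F.hinv α β x * F.P α β x

/-- `P_β{}^α`. -/
def Pmix (β α : Fin n) (x : M) : ℂ := ∑ γ, F.hinv α γ x * F.P β γ x

/-- `A_β̄{}^α`. -/
def AbarUp (β α : Fin n) (x : M) : ℂ := ∑ γ, F.hinv α γ x * F.Abar β γ x

/-- `∇_γ̄ A_{α β}` (weight `(0,0)`). -/
def dA (γ α β : Fin n) (x : M) : ℂ :=
  dir (F.vec (.bar γ)) (F.A α β) x
    - ∑ μ, (F.om (.bar γ) α μ x * F.A μ β x + F.om (.bar γ) β μ x * F.A α μ x)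

/-- `T_α = (n+2)⁻¹ (∇_α P - i ∇^β A_{α β})`, where `P` has weight `(-1,-1)`. -/
def Tlo (α : Fin n) (x : M) : ℂ :=
  1 / (n + 2) * (dir (F.vec (.lo α)) F.trP x + F.wt (-1) (-1) (.lo α) x * F.trP x
    - Complex.I * ∑ β, ∑ γ, F.hinv β γ x * F.dA γ α β x)

/-- `T_ᾱ`. -/
def Tbar (α : Fin n) (x : M) : ℂ := star (F.Tlo α x)

/-- `T^α`. -/
def Tup (α : Fin n) (x : M) : ℂ := ∑ β, F.hinv α β x * F.Tbar β x

/-- `∇^α T_α`, where `T_α` has weight `(-1,-1)`. -/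
def divT (x : M) : ℂ :=
  ∑ α, ∑ β, F.hinv α β x * (dir (F.vec (.bar β)) (F.Tlo α) x
    + F.wt (-1) (-1) (.bar β) x * F.Tlo α x - ∑ μ, F.om (.bar β) α μ x * F.Tlo μ x)

/-- `S = -(1/n) (∇^α T_α + ∇^ᾱ T_ᾱ + P_{α β̄} P^{α β̄} - A_{α β} A^{α β})`. -/
def Sc (x : M) : ℂ :=
  -(1 / (n : ℂ)) * (F.divT x + star (F.divT x)
    + ∑ α, ∑ β, ∑ γ, ∑ δ, F.hinv α δ x * F.hinv γ β x * F.P α β x * F.P γ δ x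
    - ∑ α, ∑ β, ∑ γ, ∑ δ, F.hinv α γ x * F.hinv β δ x * F.A α β x * F.Abar γ δ x)

/-! ### The tractor connection -/

/-- The part of the connection on `E_A = E(1,0) ⊕ E_α(1,0) ⊕ E(0,-1)` that is not induced by
the pseudohermitian connection: `trAlg a A B` is the coefficient of the component `B` of `v`
in the component `A` of `∇_a v`. -/
def trAlg : Dir n → TIdx n → TIdx n → M → ℂ
  | .lo β, .top, .mid α => fun _ => if α = β then -1 else 0
  | .lo β, .mid α, .top => fun x => Complex.I * F.A α β x
  | .lo β, .bot, .mid α => fun x => -F.Pmix β α x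
  | .lo β, .bot, .top => fun x => F.Tlo β x
  | .bar β, .mid α, .bot => fun x => F.h α β x
  | .bar β, .mid α, .top => fun x => F.P α β x
  | .bar β, .bot, .mid α => fun x => Complex.I * F.AbarUp β α x
  | .bar β, .bot, .top => fun x => -F.Tbar β x
  | .zero, .top, .top => fun x => Complex.I / (n + 2) * F.trP x
  | .zero, .top, .bot => fun _ => -Complex.I
  | .zero, .mid α, .mid β => fun x =>
      -Complex.I * F.Pmix α β x + if α = β then Complex.I / (n + 2) * F.trP x else 0
  | .zero, .mid α, .top => fun x => 2 * Complex.I * F.Tlo α x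
  | .zero, .bot, .bot => fun x => Complex.I / (n + 2) * F.trP x
  | .zero, .bot, .mid α => fun x => 2 * Complex.I * F.Tup α x
  | .zero, .bot, .top => fun x => Complex.I * F.Sc x
  | _, _, _ => fun _ => 0

/-- The part of the connection on `E_A` that is induced by the pseudohermitian connection. -/
def trPsh (a : Dir n) : TIdx n → TIdx n → M → ℂ
  | .top, .top => fun x => F.wt 1 0 a x
  | .mid α, .mid β => fun x => (if α = β then F.wt 1 0 a x else 0) - F.om a α β x
  | .bot, .bot => fun x => F.wt 0 (-1) a x
  | _, _ => fun _ => 0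

/-- Connection matrix of the tractor connection on `E_A`. -/
def trConn (a : Dir n) (A B : TIdx n) (x : M) : ℂ := F.trAlg a A B x + F.trPsh a A B x

/-- Connection matrices on `E_A`, its conjugate, its dual and the conjugate of its dual. -/
def conn (a : Dir n) (x : M) : Slot → TIdx n → TIdx n → ℂ
  | .lo, A, B => F.trConn a A B x
  | .loBar, A, B => star (F.trConn a.conj A B x)
  | .up, A, B => -F.trConn a B A x
  | .upBar, A, B => -star (F.trConn a.conj B A x)

/-- `∇_a f` for a section `f` of `E^*(w,w')` with tractor indices `L`, in components. -/
def cov (L : List Slot) (w w' : ℂ) (a : Dir n) (f : MI n L → M → ℂ) : MI n L → M → ℂ :=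
  fun I x => dir (F.vec a) (f I) x + F.wt w w' a x * f I x
    + derAct (F.conn a x) L (fun J => f J x) I

/-- `∇^α ∇_α f`. -/
def subLap (L : List Slot) (w w' : ℂ) (f : MI n L → M → ℂ) : MI n L → M → ℂ :=
  fun I x => ∑ α, ∑ β, F.hinv α β x *
    (F.cov L w w' (.bar β) (F.cov L w w' (.lo α) f) I x
      - ∑ μ, F.om (.bar β) α μ x * F.cov L w w' (.lo μ) f I x)

/-- `∇_α ∇^α f`. -/
def subLapBar (L : List Slot) (w w' : ℂ) (f : MI n L → M → ℂ) : MI n L → M → ℂ :=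
  fun I x => ∑ α, ∑ β, F.hinv α β x *
    (F.cov L w w' (.lo α) (F.cov L w w' (.bar β) f) I x
      - ∑ μ, star (F.om (.bar α) β μ x) * F.cov L w w' (.bar μ) f I x)

/-- `□ : E^*(w,w') → E^*(w-1,w'-1)`. -/
def box (L : List Slot) (w w' : ℂ) (f : MI n L → M → ℂ) : MI n L → M → ℂ :=
  fun I x => F.subLap L w w' f I x + Complex.I * w * F.cov L w w' .zero f I x
    + w * (1 + (w' - w) / (n + 2)) * F.trP x * f I x

/-- `□̄ : E^*(w,w') → E^*(w-1,w'-1)`. -/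
def boxBar (L : List Slot) (w w' : ℂ) (f : MI n L → M → ℂ) : MI n L → M → ℂ :=
  fun I x => F.subLapBar L w w' f I x - Complex.I * w' * F.cov L w w' .zero f I x
    + w' * (1 - (w' - w) / (n + 2)) * F.trP x * f I x

/-- The tractor `D` operator `D_A : E^*(w,w') → E_A ⊗ E^*(w-1,w')`. -/
def D (L : List Slot) (w w' : ℂ) (f : MI n L → M → ℂ) : MI n (.lo :: L) → M → ℂ
  | (.top, I) => fun x => w * (n + w + w') * f I x
  | (.mid α, I) => fun x => (n + w + w') * F.cov L w w' (.lo α) f I x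
  | (.bot, I) => fun x => -F.box L w w' f I x

/-- The conjugate operator `D_Ā : E^*(w,w') → E_Ā ⊗ E^*(w,w'-1)`. -/
def DBar (L : List Slot) (w w' : ℂ) (f : MI n L → M → ℂ) : MI n (.loBar :: L) → M → ℂ
  | (.top, I) => fun x => w' * (n + w + w') * f I x
  | (.mid α, I) => fun x => (n + w + w') * F.cov L w w' (.bar α) f I x
  | (.bot, I) => fun x => -F.boxBar L w w' f I x

/-- `□^k` on `E^*(w,w')`; each factor lowers both weights by one. -/
def boxPow (L : List Slot) : ℕ → ℂ → ℂ → (MI n L → M → ℂ) → MI n L → M → ℂ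
  | 0, _, _, f => f
  | k + 1, w, w', f => boxPow L k (w - 1) (w' - 1) (F.box L w w' f)

/-- `□̄^k` on `E^*(w,w')`. -/
def boxBarPow (L : List Slot) : ℕ → ℂ → ℂ → (MI n L → M → ℂ) → MI n L → M → ℂ
  | 0, _, _, f => f
  | k + 1, w, w', f => boxBarPow L k (w - 1) (w' - 1) (F.boxBar L w w' f)

end AdmissibleCoframe

/-- `k` further indices of kind `κ` in front of `L`. -/
@[reducible] def rep (κ : Slot) : ℕ → List Slot → List Slot
  | 0, L => L
  | k + 1, L => κ :: rep κ k L

/-- Multiplication by `Z_A` or `Z_Ā` (both have components `σ = τ = 0`, `ρ = 1`). -/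
def mulZ {n : ℕ} {M : Type*} (κ : Slot) (L : List Slot) (f : MI n L → M → ℂ) :
    MI n (κ :: L) → M → ℂ
  | (.bot, I) => f I
  | (.top, _) => fun _ => 0
  | (.mid _, _) => fun _ => 0

/-- Multiplication by a `k`-fold product `Z ⋯ Z`. -/
def mulZPow {n : ℕ} {M : Type*} (κ : Slot) (L : List Slot) :
    (k : ℕ) → (MI n L → M → ℂ) → MI n (rep κ k L) → M → ℂ
  | 0, f => f
  | k + 1, f => mulZ κ (rep κ k L) (mulZPow κ L k f)

namespace AdmissibleCoframe

variable {n : ℕ} {M : Type*} [TopologicalSpace M]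
  [ChartedSpace (EuclideanSpace ℝ (Fin (2 * n + 1))) M]
  [IsManifold (𝓡 (2 * n + 1)) ∞ M] {S : PseudoHermitian n M} {U : Set M}
  (F : AdmissibleCoframe S U)

/-- `D_B ⋯ D_I` (`k` factors) on `E^*(w,w')`. -/
def DPow (L : List Slot) (w w' : ℂ) :
    (k : ℕ) → (MI n L → M → ℂ) → MI n (rep .lo k L) → M → ℂ
  | 0, f => f
  | k + 1, f => F.D (rep .lo k L) (w - k) w' (DPow L w w' k f)

/-- `D_J̄ ⋯ D_Q̄` (`k` factors) on `E^*(w,w')`. -/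
def DBarPow (L : List Slot) (w w' : ℂ) :
    (k : ℕ) → (MI n L → M → ℂ) → MI n (rep .loBar k L) → M → ℂ
  | 0, f => f
  | k + 1, f => F.DBar (rep .loBar k L) w (w' - k) (DBarPow L w w' k f)

/-- Inverse tractor metric `h^{A B̄}`, with first argument `A` and second argument `B̄`. -/
def trInv : TIdx n → TIdx n → M → ℂ
  | .top, .bot => fun _ => 1
  | .bot, .top => fun _ => 1
  | .mid α, .mid β => F.hinv α β
  | _, _ => fun _ => 0

/-- `D^B F_B = h^{B Ā} D_Ā F_B` for a section `F_B` of weight `(w,w')`;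
the result has weight `(w,w'-1)`. -/
def divD (L : List Slot) (w w' : ℂ) (f : MI n (.lo :: L) → M → ℂ) : MI n L → M → ℂ :=
  fun I x => tSum fun B => tSum fun A =>
    F.trInv B A x * F.DBar (.lo :: L) w w' f (A, B, I) x

/-- `D^B̄ F_B̄ = h^{A B̄} D_A F_B̄` for a section `F_B̄` of weight `(w,w')`;
the result has weight `(w-1,w')`. -/
def divDBar (L : List Slot) (w w' : ℂ) (f : MI n (.loBar :: L) → M → ℂ) : MI n L → M → ℂ :=
  fun I x => tSum fun A => tSum fun B =>
    F.trInv A B x * F.D (.loBar :: L) w w' f (A, B, I) x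

/-- `D^I ⋯ D^B F_{B ⋯ I}` (`k` factors) for `F` of weight `(w,w')`; the first index is
contracted first. -/
def divDPow (L : List Slot) :
    (k : ℕ) → ℂ → ℂ → (MI n (rep .lo k L) → M → ℂ) → MI n L → M → ℂ
  | 0, _, _, f => f
  | k + 1, w, w', f => divDPow L k w (w' - 1) (F.divD (rep .lo k L) w w' f)

/-- `D^Q̄ ⋯ D^J̄ F_{J̄ ⋯ Q̄}` (`k` factors) for `F` of weight `(w,w')`. -/
def divDBarPow (L : List Slot) :
    (k : ℕ) → ℂ → ℂ → (MI n (rep .loBar k L) → M → ℂ) → MI n L → M → ℂ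
  | 0, _, _, f => f
  | k + 1, w, w', f => divDBarPow L k (w - 1) w' (F.divDBar (rep .loBar k L) w w' f)

/-- `□ D_B ⋯ D_I D_J̄ ⋯ D_Q̄` with `k₁` unbarred and `k₂` barred factors, on `E^*(w,w')`. -/
def boxDD (L : List Slot) (w w' : ℂ) (k₁ k₂ : ℕ) (f : MI n L → M → ℂ) :
    MI n (rep .lo k₁ (rep .loBar k₂ L)) → M → ℂ :=
  F.box (rep .lo k₁ (rep .loBar k₂ L)) (w - k₁) (w' - k₂)
    (F.DPow (rep .loBar k₂ L) w (w' - k₂) k₁ (F.DBarPow L w w' k₂ f))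

/-- `D^Q̄ ⋯ D^J̄ D^I ⋯ D^B □ D_B ⋯ D_I D_J̄ ⋯ D_Q̄` on `E^*(w,w')`. -/
def fullOp (L : List Slot) (w w' : ℂ) (k₁ k₂ : ℕ) (f : MI n L → M → ℂ) : MI n L → M → ℂ :=
  F.divDBarPow L k₂ (w - k₁ - 1) (w' - k₂ - 1 - k₁)
    (F.divDPow (rep .loBar k₂ L) k₁ (w - k₁ - 1) (w' - k₂ - 1) (F.boxDD L w w' k₁ k₂ f))

end AdmissibleCoframe

/-! ## Density bundles and sections of weighted tractor bundles -/

/-- `λ^w λ̄^w'`, which does not depend on the branch of the logarithm if `w - w' ∈ ℤ`. -/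
def lamPow (w w' l : ℂ) : ℂ := Complex.exp (w * Complex.log l + w' * star (Complex.log l))

/-- A bundle `E(1,0)` that is a `-1/(n+2)` power of the canonical bundle, presented by local
trivializations: an open cover `U i` with admissible coframes, for which `E(1,0)` has a local
section `s_i` with `s_i^{-(n+2)} = θ ∧ θ_i¹ ∧ ⋯ ∧ θ_iⁿ`, and the transition functions
`s_j = lam i j • s_i`. If `Z^j_α = g_α{}^β Z^i_β` then
`θ ∧ θ_i¹ ∧ ⋯ = (det g) θ ∧ θ_j¹ ∧ ⋯`, so that `(lam i j)^{n+2} = det g`. -/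
structure DensityBundle {n : ℕ} {M : Type*} [TopologicalSpace M]
    [ChartedSpace (EuclideanSpace ℝ (Fin (2 * n + 1))) M]
  [IsManifold (𝓡 (2 * n + 1)) ∞ M] (S : PseudoHermitian n M)
    (ι : Type*) where
  U : ι → Set M
  isOpen : ∀ i, IsOpen (U i)
  cover : ∀ x, ∃ i, x ∈ U i
  frame : (i : ι) → AdmissibleCoframe S (U i)
  lam : ι → ι → M → ℂ
  smooth_lam : ∀ i j, SmoothFn n (lam i j) (U i ∩ U j)
  lam_pow : ∀ i j, ∀ x ∈ U i ∩ U j,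
    lam i j x ^ (n + 2) =
      (Matrix.of fun α β : Fin n => (frame i).th β x ((frame j).Z α x)).det
  cocycle : ∀ i j k, ∀ x ∈ U i ∩ U j ∩ U k, lam i j x * lam j k x = lam i k x

/-- The matrix by which the components of a section of `E_A` change when `s` is replaced by
`l s` and the frame `Z_α` by `g_α{}^β Z_β`. -/
def transLo {n : ℕ} (l : ℂ) (g : Matrix (Fin n) (Fin n) ℂ) : TIdx n → TIdx n → ℂ
  | .top, .top => l⁻¹
  | .mid α, .mid β => l⁻¹ * g α β
  | .bot, .bot => star l
  | _, _ => 0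

/-- The same for all kinds of tractor indices. -/
def transAll {n : ℕ} (l : ℂ) (g : Matrix (Fin n) (Fin n) ℂ) : Slot → TIdx n → TIdx n → ℂ
  | .lo, A, B => transLo l g A B
  | .loBar, A, B => star (transLo l g A B)
  | .up, A, B => transLo l⁻¹ g⁻¹.transpose A B
  | .upBar, A, B => star (transLo l⁻¹ g⁻¹.transpose A B)

/-- Smooth sections over `M` of the weighted tractor bundle `E^*(w,w')` with tractor indices
`L` (realized by `θ`): smooth components in each trivialization that match on overlaps. -/
structure TractorSection {n : ℕ} {M : Type*} [TopologicalSpace M]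
    [ChartedSpace (EuclideanSpace ℝ (Fin (2 * n + 1))) M]
    [IsManifold (𝓡 (2 * n + 1)) ∞ M] {S : PseudoHermitian n M}
    {ι : Type*} (E : DensityBundle S ι) (L : List Slot) (w w' : ℂ) where
  comp : ι → MI n L → M → ℂ
  smooth : ∀ i I, SmoothFn n (comp i I) (E.U i)
  compat : ∀ i j, ∀ x ∈ E.U i ∩ E.U j, ∀ I,
    comp j I x = lamPow (-w) (-w') (E.lam i j x) *
      tensAct
        (transAll (E.lam i j x)
          (Matrix.of fun α β : Fin n => (E.frame i).th β x ((E.frame j).Z α x)))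
        L (fun J => comp i J x) I

end CRTractor

end

set_option linter.unusedSectionVars false
set_option linter.unusedSimpArgs false

noncomputable section

namespace CRTractor

open VectorField Set Filter Topology

/-! ### Lie brackets as commutators of derivations -/

section General

/-! The assertions are pointwise identities between differential operators, so it suffices to prove
them near each point, in Heisenberg coordinates z, t. For an admissible frame put g_{αβ} = Z_α z^β.
Then the Levi form is h = g ε g*, the connection forms are (dg) g⁻¹, and the normalization |det h| =
1 makes det g unimodular. The torsion vanishes, and ω_γ{}^γ is the logarithmic differential of det
g, hence closed; so the Ricci tensor and P, T_α, S all vanish. Since det g is unimodular, the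
connection of E(w,w') depends only on w − w'.

Pass to the frame e_β = (g⁻¹)_β{}^α Z_α and apply g to the middle slots of the tractors. The tractor
connection then becomes the coordinate derivative plus constant matrices plus a scalar closed form.
Consequently the covariant derivatives X_a on any weighted tractor bundle represent the Heisenberg
algebra: [X_α, X_β̄] = −i ε_α δ_{αβ} X_0 with X_0 central (`HeisAlg.isHeis_cov`). The rest is
algebra in such representations.

Let Δ = ∑ ε_α X_ᾱ X_α and □_w = Δ + i w X_0. Three facts carry the proof. (a) All □_c commute, and
reordering Δ shows that the conjugate operator of weight w' is □_{−(n+w')}. If n + w + w' + 1 = k,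
then □^k and its conjugate are products of the same commuting factors in opposite orders
(`boxOpPow_swap`). (b) Let D_{m,w} v = (m w v, m X_α v, −□_w v). Since □_{w−1} X_α = X_α □_w, one
finds □_{w−1} D_{m,w} = D_{m−1,w−1} □_w (`boxOp_dOp`). The tractor D operator is the case m = n + w
+ w'. If m is a natural number, then after m steps D_{0,w−m} = −Z □_{w−m} is left, so that □^m D =
−Z □^{m+1} (`boxOpPow_dOp_self`). Iteration gives the first identity. The barred operators obey the
same rule for the conjugate of □, and (a) translates between the two kinds of powers. (c) For Z_B g
of weight (w,w') one has D^B (Z_B g) = (n+w')(n+w+w'+1) g (`divD_mulZ`), and likewise for the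
conjugate. Applied k − 1 times to the first identity, this yields the second, the factors assembling
to the factorial and the products of weights (`prod_weights`). -/

theorem two_le_infty : (2 : WithTop ℕ∞) ≤ ∞ := by
  exact WithTop.coe_le_coe.2 (le_top : (2 : ℕ∞) ≤ ⊤)
variable {E : Type*} [NormedAddCommGroup E] [NormedSpace ℝ E]
  {H : Type*} [TopologicalSpace H] {I : ModelWithCorners ℝ E H}
  {M : Type*} [TopologicalSpace M] [ChartedSpace H M] [IsManifold I ∞ M]
  {F : Type*} [NormedAddCommGroup F] [NormedSpace ℝ F]

/-- The derivative of a vector-valued function, with values in the vector space. -/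
def vderiv (I : ModelWithCorners ℝ E H) (f : M → F) (x : M) : TangentSpace I x →L[ℝ] F :=
  mfderiv I 𝓘(ℝ, F) f x

theorem contMDiffOn_vderiv {f : M → F} {V : Set M} (hV : IsOpen V)
    (hf : ContMDiffOn I 𝓘(ℝ, F) ∞ f V) {X : (x : M) → TangentSpace I x}
    (hX : ContMDiffOn I I.tangent ∞ (fun x => (⟨x, X x⟩ : TangentBundle I M)) V) :
    ContMDiffOn I 𝓘(ℝ, F) ∞ (fun x => vderiv I f x (X x)) V := by
  have : IsManifold I 1 M := IsManifold.of_le (n := ∞) (by simp)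
  have h1 := hf.contMDiffOn_tangentMapWithin (m := ∞) (by simp) hV.uniqueMDiffOn
  have h2 := h1.comp hX (fun x hx => hx)
  have h3 := (contMDiff_snd_tangentBundle_modelSpace F 𝓘(ℝ, F) (n := ∞)).comp_contMDiffOn h2
  refine h3.congr fun x hx => ?_
  have := mfderivWithin_of_isOpen (I := I) (I' := 𝓘(ℝ, F)) (f := f) hV hx
  change vderiv I f x (X x) = (mfderivWithin I 𝓘(ℝ, F) f V x) (X x)
  rw [this]; rfl


/-- The differential of the inverse chart is inverse to that of the chart, so pulling back by one is
pushing forward by the other. -/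
theorem mpullbackWithin_extChartAt_symm_apply (X : (x : M) → TangentSpace I x) {x y : M}
    (hs : y ∈ (extChartAt I x).source) :
    mpullbackWithin 𝓘(ℝ, E) I (extChartAt I x).symm X (range I) (extChartAt I x y) =
      mfderiv I 𝓘(ℝ, E) (extChartAt I x) y (X y) := by
  have i1 : IsManifold I 1 M := IsManifold.of_le (n := ∞) (by simp)
  have hX : X y = (mfderiv I 𝓘(ℝ, E) (extChartAt I x) y).inverse
      (mpullbackWithin 𝓘(ℝ, E) I (extChartAt I x).symm X (range I) (extChartAt I x y)) := by
    rw [mpullbackWithin_apply,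
      ← (isInvertible_mfderiv_extChartAt hs).inverse_comp_apply_of_right,
      mfderivWithin_extChartAt_symm_comp_mfderiv_extChartAt' hs, (extChartAt I x).left_inv hs]
    simp only [ContinuousLinearMap.inverse_id, ContinuousLinearMap.coe_id', id_eq]
  rw [hX]
  exact ((isInvertible_mfderiv_extChartAt hs).self_apply_inverse _).symm

variable [I.Boundaryless]

/-- This is the chain rule in a chart. It is needed on a neighbourhood and not only at `x`, because
the result is differentiated once more for the bracket. -/
theorem vderiv_eventuallyEq_fderiv {f : M → F} {x : M}
    (hf : ContMDiffAt I 𝓘(ℝ, F) 1 f x) (X : (x : M) → TangentSpace I x) :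
    ∀ᶠ y in 𝓝 x, vderiv I f y (X y) =
      fderiv ℝ (f ∘ (extChartAt I x).symm) (extChartAt I x y)
        (mpullbackWithin 𝓘(ℝ, E) I (extChartAt I x).symm X (range I) (extChartAt I x y)) := by
  have i1 : IsManifold I 1 M := IsManifold.of_le (n := ∞) (by simp)
  have ev := (contMDiffAt_iff_contMDiffAt_nhds (by simp)).1 hf
  filter_upwards [ev, extChartAt_source_mem_nhds (I := I) x] with y hy hs
  rw [mpullbackWithin_extChartAt_symm_apply X hs]
  set φ := extChartAt I x with hφ
  have hyt : φ y ∈ φ.target := φ.map_source hs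
  have hg : MDifferentiableAt 𝓘(ℝ, E) 𝓘(ℝ, F) (f ∘ φ.symm) (φ y) := by
    have hA : MDifferentiableAt I 𝓘(ℝ, F) f (φ.symm (φ y)) := by
      rw [φ.left_inv hs]; exact hy.mdifferentiableAt (by simp)
    refine hA.comp (φ y) ?_
    have := (contMDiffOn_extChartAt_symm (I := I) (n := 1) x).contMDiffAt
      ((isOpen_extChartAt_target (I := I) x).mem_nhds hyt)
    exact this.mdifferentiableAt (by simp)
  have hφ1 : MDifferentiableAt I 𝓘(ℝ, E) φ y := by
    refine mdifferentiableAt_extChartAt ?_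
    simpa [hφ] using hs
  have hcomp : mfderiv I 𝓘(ℝ, F) f y =
      (mfderiv 𝓘(ℝ, E) 𝓘(ℝ, F) (f ∘ φ.symm) (φ y)).comp (mfderiv I 𝓘(ℝ, E) φ y) := by
    rw [← mfderiv_comp y hg hφ1]
    refine Filter.EventuallyEq.mfderiv_eq ?_
    filter_upwards [(isOpen_extChartAt_source (I := I) x).mem_nhds hs] with z hz
    simp only [Function.comp]
    rw [φ.left_inv hz]
  change mfderiv I 𝓘(ℝ, F) f y (X y) = fderiv ℝ (f ∘ φ.symm) (φ y) _
  rw [hcomp, mfderiv_eq_fderiv]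
  rfl

/-- In a chart this becomes the corresponding identity in a vector space, where it expresses the
symmetry of the second derivative. -/
theorem vderiv_mlieBracket [CompleteSpace E] {f : M → F} {V : Set M} (hV : IsOpen V) {x : M}
    (hx : x ∈ V) {X Y : (x : M) → TangentSpace I x}
    (hf : ContMDiffOn I 𝓘(ℝ, F) ∞ f V)
    (hX : ContMDiffOn I I.tangent ∞ (fun x => (⟨x, X x⟩ : TangentBundle I M)) V)
    (hY : ContMDiffOn I I.tangent ∞ (fun x => (⟨x, Y x⟩ : TangentBundle I M)) V) :
    vderiv I f x (mlieBracket I X Y x) =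
      vderiv I (fun y => vderiv I f y (Y y)) x (X x) -
      vderiv I (fun y => vderiv I f y (X y)) x (Y x) := by
  have i1 : IsManifold I 1 M := IsManifold.of_le (n := ∞) (by simp)
  have i2 : IsManifold I 2 M := IsManifold.of_le (n := ∞) two_le_infty
  have hVx : V ∈ 𝓝 x := hV.mem_nhds hx
  have one : ∀ {h : M → F}, ContMDiffOn I 𝓘(ℝ, F) ∞ h V → ContMDiffAt I 𝓘(ℝ, F) 1 h x :=
    fun hh => (hh.contMDiffAt hVx).of_le (by simp)
  set φ := extChartAt I x with hφ
  set C : ((x : M) → TangentSpace I x) → E → E := fun X =>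
    (mpullbackWithin 𝓘(ℝ, E) I φ.symm X (range I)) with hC
  -- Without boundary the range of the model is everything, so derivatives and brackets within it
  -- are the ordinary ones.
  have hset : φ.symm ⁻¹' univ ∩ range I = univ := by simp [I.range_eq_univ]
  set g := f ∘ φ.symm with hg
  have hsymm : ContinuousAt φ.symm (φ x) := continuousAt_extChartAt_symm x
  have htarget : ∀ᶠ z in 𝓝 (φ x), z ∈ φ.target := extChartAt_target_mem_nhds x
  have second : ∀ X Y : (x : M) → TangentSpace I x, 
      ContMDiffOn I I.tangent ∞ (fun x => (⟨x, Y x⟩ : TangentBundle I M)) V →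
      vderiv I (fun y => vderiv I f y (Y y)) x (X x) =
        fderiv ℝ (fun z => fderiv ℝ g z (C Y z)) (φ x) (C X (φ x)) := by
    intro X Y hY
    rw [(vderiv_eventuallyEq_fderiv (one (contMDiffOn_vderiv hV hf hY)) X).self_of_nhds]
    congr 1
    refine Filter.EventuallyEq.fderiv_eq ?_
    have ev := vderiv_eventuallyEq_fderiv (one hf) Y
    have : Tendsto φ.symm (𝓝 (φ x)) (𝓝 x) := by
      simpa [ContinuousAt, hφ] using hsymm
    filter_upwards [this.eventually ev, htarget] with z hz hzt
    simp only [Function.comp]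
    rw [hz, ← hφ, φ.right_inv hzt]
  have hdiff : ∀ X : (x : M) → TangentSpace I x, 
      ContMDiffOn I I.tangent ∞ (fun x => (⟨x, X x⟩ : TangentBundle I M)) V →
      DifferentiableAt ℝ (C X) (φ x) := by
    intro X hX
    have h1 : MDifferentiableAt I I.tangent (fun x => (⟨x, X x⟩ : TangentBundle I M)) x :=
      (hX.contMDiffAt hVx).mdifferentiableAt (by simp)
    have : DifferentiableWithinAt ℝ (C X) (φ.symm ⁻¹' univ ∩ range I) (φ x) :=
      MDifferentiableWithinAt.differentiableWithinAt_mpullbackWithin_vectorField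
        h1.mdifferentiableWithinAt
    rwa [hset, differentiableWithinAt_univ] at this
  have hgs : ContDiffAt ℝ 2 g (φ x) := by
    have := ((hf.contMDiffAt hVx).of_le (m := 2) two_le_infty)
    have h2 := (contMDiffAt_iff.1 this).2
    rwa [I.range_eq_univ, contDiffWithinAt_univ] at h2
  rw [second X Y hY, second Y X hX, ← fderiv_apply_lieBracket hgs (by simp) (hdiff Y hY)
    (hdiff X hX), (vderiv_eventuallyEq_fderiv (one hf) _).self_of_nhds,
    mpullbackWithin_extChartAt_symm_apply _ (mem_extChartAt_source x)]
  congr 1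
  rw [← mlieBracketWithin_univ, mlieBracketWithin_apply]
  refine ((isInvertible_mfderiv_extChartAt (mem_extChartAt_source x)).self_apply_inverse _).trans ?_
  change lieBracketWithin ℝ (C X) (C Y) (φ.symm ⁻¹' univ ∩ range I) (φ x) = _
  rw [hset, lieBracketWithin_univ]
end General

/-! ### Real and imaginary parts in the complexification -/

section Complexification
variable {V : Type*} [AddCommGroup V] [Module ℝ V]

@[simp] theorem cRe_tmul (c : ℂ) (v : V) : cRe (c ⊗ₜ[ℝ] v) = c.re • v := by
  simp [cRe]

@[simp] theorem cIm_tmul (c : ℂ) (v : V) : cIm (c ⊗ₜ[ℝ] v) = c.im • v := by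
  simp [cIm]

@[simp] theorem cRe_cMk (u v : V) : cRe (cMk u v) = u := by simp [cMk]

@[simp] theorem cIm_cMk (u v : V) : cIm (cMk u v) = v := by simp [cMk]

theorem cMk_cRe_cIm (v : ℂ ⊗[ℝ] V) : cMk (cRe v) (cIm v) = v := by
  induction v using TensorProduct.induction_on with
  | zero => simp [cMk]
  | tmul c v =>
    simp only [cMk, cRe_tmul, cIm_tmul, TensorProduct.tmul_smul, TensorProduct.smul_tmul',
      ← TensorProduct.add_tmul]
    congr 1
    apply Complex.ext <;> simp
  | add a b ha hb =>
    rw [cMk] at *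
    rw [map_add, map_add, TensorProduct.tmul_add, TensorProduct.tmul_add]
    nth_rewrite 3 [← ha]
    nth_rewrite 3 [← hb]
    abel

theorem complexified_ext {v w : ℂ ⊗[ℝ] V} (h1 : cRe v = cRe w) (h2 : cIm v = cIm w) : v = w := by
  rw [← cMk_cRe_cIm v, ← cMk_cRe_cIm w, h1, h2]

theorem cRe_smul (c : ℂ) (v : ℂ ⊗[ℝ] V) : cRe (c • v) = c.re • cRe v - c.im • cIm v := by
  induction v using TensorProduct.induction_on with
  | zero => simp
  | tmul d v => simp [TensorProduct.smul_tmul', sub_smul, mul_smul]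
  | add a b ha hb => simp only [smul_add, map_add, ha, hb]; abel

theorem cIm_smul (c : ℂ) (v : ℂ ⊗[ℝ] V) : cIm (c • v) = c.re • cIm v + c.im • cRe v := by
  induction v using TensorProduct.induction_on with
  | zero => simp
  | tmul d v => simp [TensorProduct.smul_tmul', add_smul, mul_smul]
  | add a b ha hb => simp only [smul_add, map_add, ha, hb]; abel

@[simp] theorem cRe_cConj (v : ℂ ⊗[ℝ] V) : cRe (cConj v) = cRe v := by simp [cConj]

@[simp] theorem cIm_cConj (v : ℂ ⊗[ℝ] V) : cIm (cConj v) = -cIm v := by simp [cConj]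

@[simp] theorem cConj_cConj (v : ℂ ⊗[ℝ] V) : cConj (cConj v) = v :=
  complexified_ext (by simp) (by simp)

/-- The complex-linear extension of a real-linear form with complex values. -/
def cEvalL (φ : V →ₗ[ℝ] ℂ) : ℂ ⊗[ℝ] V →ₗ[ℂ] ℂ where
  toFun v := cEval φ v
  map_add' v w := by simp only [cEval, map_add]; ring
  map_smul' c v := by
    simp only [cEval, cRe_smul, cIm_smul, map_add, map_sub, map_smul, Complex.real_smul,
      smul_eq_mul, RingHom.id_apply]
    linear_combination (-(c.im : ℂ) * φ (cIm v)) * Complex.I_mul_I +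
      (φ (cRe v) + Complex.I * φ (cIm v)) * Complex.re_add_im c

theorem cEvalL_apply (φ : V →ₗ[ℝ] ℂ) (v : ℂ ⊗[ℝ] V) :
    cEvalL φ v = φ (cRe v) + Complex.I * φ (cIm v) := rfl

end Complexification

/-! ### Complex vector fields acting on smooth functions -/

section Dir
variable {n : ℕ} {M : Type*} [TopologicalSpace M]
  [ChartedSpace (EuclideanSpace ℝ (Fin (2 * n + 1))) M]
  [IsManifold (𝓡 (2 * n + 1)) ∞ M]

/-- The complex derivative of a function as a complex-linear form. -/
def dirAt (f : M → ℂ) (x : M) : CT n x →ₗ[ℂ] ℂ :=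
  cEvalL (vderiv (𝓡 (2 * n + 1)) f x : TS n x →ₗ[ℝ] ℂ)

theorem dir_eq (Z : (x : M) → CT n x) (f : M → ℂ) (x : M) : dir Z f x = dirAt f x (Z x) := rfl

theorem dir_eq_vderiv (Z : (x : M) → CT n x) (f : M → ℂ) (x : M) :
    dir Z f x = vderiv (𝓡 (2 * n + 1)) f x (cRe (Z x)) +
      Complex.I * vderiv (𝓡 (2 * n + 1)) f x (cIm (Z x)) := rfl

variable {U : Set M} {f g : M → ℂ} {Z W : (x : M) → CT n x} {x : M}

theorem SmoothFn.mono {V : Set M} (hf : SmoothFn n f U) (h : V ⊆ U) : SmoothFn n f V :=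
  ContMDiffOn.mono hf h

theorem SmoothFn.congr (hf : SmoothFn n f U) (h : EqOn g f U) : SmoothFn n g U :=
  ContMDiffOn.congr hf h

theorem SmoothFn.add (hf : SmoothFn n f U) (hg : SmoothFn n g U) :
    SmoothFn n (fun x => f x + g x) U := ContMDiffOn.add hf hg

theorem SmoothFn.mul (hf : SmoothFn n f U) (hg : SmoothFn n g U) :
    SmoothFn n (fun x => f x * g x) U :=
  (contDiff_mul (𝕜 := ℝ) (𝔸 := ℂ)).contMDiff.comp_contMDiffOn (ContMDiffOn.prodMk_space hf hg)

theorem smoothFn_const (c : ℂ) : SmoothFn n (fun _ : M => c) U := contMDiffOn_const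

theorem SmoothFn.postcomp (L : ℂ →L[ℝ] ℂ) (hf : SmoothFn n f U) :
    SmoothFn n (fun x => L (f x)) U := L.contMDiff.comp_contMDiffOn hf

theorem SmoothFn.star (hf : SmoothFn n f U) : SmoothFn n (fun x => star (f x)) U :=
  hf.postcomp (Complex.conjCLE : ℂ →L[ℝ] ℂ)

theorem SmoothFn.inv (hf : SmoothFn n f U) (h0 : ∀ x ∈ U, f x ≠ 0) :
    SmoothFn n (fun x => (f x)⁻¹) U := by
  intro x hx
  have h : ContDiffAt ℝ ∞ (fun z : ℂ => z⁻¹) (f x) := contDiffAt_inv ℝ (h0 x hx)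
  exact h.contMDiffAt.comp_contMDiffWithinAt x (hf x hx)

theorem SmoothFn.mdifferentiableAt (hU : IsOpen U) (hf : SmoothFn n f U) (hx : x ∈ U) :
    MDifferentiableAt (𝓡 (2 * n + 1)) 𝓘(ℝ, ℂ) f x :=
  (ContMDiffOn.contMDiffAt hf (hU.mem_nhds hx)).mdifferentiableAt (by simp)

theorem dirAt_congr (hU : IsOpen U) (h : EqOn f g U) (hx : x ∈ U) : dirAt f x = dirAt (n := n) g x := by
  have : vderiv (𝓡 (2 * n + 1)) f x = vderiv (𝓡 (2 * n + 1)) g x :=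
    Filter.EventuallyEq.mfderiv_eq (h.eventuallyEq_of_mem (hU.mem_nhds hx))
  rw [dirAt, this, dirAt]

theorem dirAt_const (c : ℂ) : dirAt (n := n) (fun _ : M => c) x = 0 := by
  have : vderiv (𝓡 (2 * n + 1)) (fun _ : M => c) x = 0 := mfderiv_const
  rw [dirAt, this]
  ext v; simp [cEvalL_apply]

theorem dirAt_add (hU : IsOpen U) (hf : SmoothFn n f U) (hg : SmoothFn n g U) (hx : x ∈ U) :
    dirAt (n := n) (fun y => f y + g y) x = dirAt f x + dirAt g x := by
  have : vderiv (𝓡 (2 * n + 1)) (fun y => f y + g y) x =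
      vderiv (𝓡 (2 * n + 1)) f x + vderiv (𝓡 (2 * n + 1)) g x :=
    mfderiv_add (hf.mdifferentiableAt hU hx) (hg.mdifferentiableAt hU hx)
  refine LinearMap.ext fun v => ?_
  simp only [dirAt, this, cEvalL_apply, LinearMap.add_apply, ContinuousLinearMap.coe_coe,
    add_apply]
  ring

theorem dirAt_mul (hU : IsOpen U) (hf : SmoothFn n f U) (hg : SmoothFn n g U) (hx : x ∈ U) :
    dirAt (n := n) (fun y => f y * g y) x = f x • dirAt g x + g x • dirAt f x := by
  have : vderiv (𝓡 (2 * n + 1)) (fun y => f y * g y) x =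
      f x • vderiv (𝓡 (2 * n + 1)) g x + g x • vderiv (𝓡 (2 * n + 1)) f x :=
    ((hf.mdifferentiableAt hU hx).hasMFDerivAt.mul (hg.mdifferentiableAt hU hx).hasMFDerivAt).mfderiv
  refine LinearMap.ext fun v => ?_
  simp only [dirAt, this, cEvalL_apply, LinearMap.add_apply, LinearMap.smul_apply,
    ContinuousLinearMap.coe_coe, add_apply, smul_apply,
    smul_eq_mul]
  ring

theorem vderiv_postcomp {F G : Type*} [NormedAddCommGroup F] [NormedSpace ℝ F]
    [NormedAddCommGroup G] [NormedSpace ℝ G] (L : F →L[ℝ] G) {f : M → F}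
    (hf : MDifferentiableAt (𝓡 (2 * n + 1)) 𝓘(ℝ, F) f x) (v : TS n x) :
    vderiv (𝓡 (2 * n + 1)) (fun y => L (f y)) x v = L (vderiv (𝓡 (2 * n + 1)) f x v) := by
  have := mfderiv_comp x (L.mdifferentiableAt (x := f x)) hf
  rw [ContinuousLinearMap.mfderiv_eq] at this
  exact congrArg (fun T : TS n x →L[ℝ] G => T v) this

theorem dirAt_star (hU : IsOpen U) (hf : SmoothFn n f U) (hx : x ∈ U) (v : CT n x) :
    dirAt (fun y => star (f y)) x v = star (dirAt f x (cConj v)) := by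
  have := vderiv_postcomp (n := n) (Complex.conjCLE : ℂ →L[ℝ] ℂ) (hf.mdifferentiableAt hU hx)
  simp only [dirAt, cEvalL_apply, cRe_cConj, cIm_cConj, ContinuousLinearMap.coe_coe]
  have h : ∀ u : TS n x, vderiv (𝓡 (2 * n + 1)) (fun y => star (f y)) x u =
    star (vderiv (𝓡 (2 * n + 1)) f x u) := this
  rw [h, h]
  simp

theorem SmoothFn.dir (hU : IsOpen U) (hf : SmoothFn n f U) (hZ : SmoothCVF Z U) :
    SmoothFn n (dir Z f) U :=
  SmoothFn.add (contMDiffOn_vderiv hU hf hZ.1)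
    ((smoothFn_const _).mul (contMDiffOn_vderiv hU hf hZ.2))

/-- Both sides are complex-bilinear extensions of the real case; the minus sign in the real part of
`cBracket` is `I * I = -1`. -/
theorem dir_cBracket (hU : IsOpen U) (hx : x ∈ U) (hf : SmoothFn n f U) (hZ : SmoothCVF Z U)
    (hW : SmoothCVF W U) :
    dir (cBracket Z W) f x = dir Z (dir W f) x - dir W (dir Z f) x := by
  have key : ∀ X Y : (x : M) → TS n x, SmoothVF X U → SmoothVF Y U →
      vderiv (𝓡 (2 * n + 1)) f x (bracket X Y x) =
      vderiv (𝓡 (2 * n + 1)) (fun y => vderiv (𝓡 (2 * n + 1)) f y (Y y)) x (X x) -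
      vderiv (𝓡 (2 * n + 1)) (fun y => vderiv (𝓡 (2 * n + 1)) f y (X y)) x (Y x) :=
    fun X Y hX hY => vderiv_mlieBracket hU hx hf hX hY
  -- The inner derivative is itself complex-valued and has to be split before it is differentiated
  -- along a real vector.
  have split : ∀ W : (x : M) → CT n x, SmoothCVF W U → ∀ v : TS n x,
      vderiv (𝓡 (2 * n + 1)) (CRTractor.dir W f) x v =
      vderiv (𝓡 (2 * n + 1)) (fun y => vderiv (𝓡 (2 * n + 1)) f y (cRe (W y))) x v +
      Complex.I * vderiv (𝓡 (2 * n + 1)) (fun y => vderiv (𝓡 (2 * n + 1)) f y (cIm (W y))) x v := by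
    intro W hW v
    have h1 : SmoothFn n (fun y => vderiv (𝓡 (2 * n + 1)) f y (cRe (W y))) U :=
      contMDiffOn_vderiv hU hf hW.1
    have h2 : SmoothFn n (fun y => vderiv (𝓡 (2 * n + 1)) f y (cIm (W y))) U :=
      contMDiffOn_vderiv hU hf hW.2
    have := dirAt_add hU h1 ((smoothFn_const Complex.I).mul h2) hx
    rw [dirAt_mul hU (smoothFn_const Complex.I) h2 hx, dirAt_const] at this
    have := congrArg (fun T : CT n x →ₗ[ℂ] ℂ => T (cMk v 0)) this
    have e : CRTractor.dir W f = fun y => vderiv (𝓡 (2 * n + 1)) f y (cRe (W y)) +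
      Complex.I * vderiv (𝓡 (2 * n + 1)) f y (cIm (W y)) := rfl
    rw [e]
    simpa [dirAt, cEvalL_apply] using this
  rw [dir_eq_vderiv (cBracket Z W), dir_eq_vderiv Z, dir_eq_vderiv W]
  simp only [split W hW, split Z hZ, cBracket, cRe_cMk, cIm_cMk, map_add, map_sub,
    key _ _ hZ.1 hW.1, key _ _ hZ.2 hW.2, key _ _ hZ.1 hW.2, key _ _ hZ.2 hW.1]
  linear_combination (vderiv (𝓡 (2 * n + 1)) (fun y => vderiv (𝓡 (2 * n + 1)) f y (cIm (Z y))) x (cIm (W x))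
    - vderiv (𝓡 (2 * n + 1)) (fun y => vderiv (𝓡 (2 * n + 1)) f y (cIm (W y))) x (cIm (Z x))) * Complex.I_mul_I

theorem SmoothCVF.conj (hZ : SmoothCVF Z U) : SmoothCVF (fun y => cConj (Z y)) U := by
  refine ⟨?_, ?_⟩
  · simpa using hZ.1
  · simp only [cIm_cConj]
    exact ContMDiffOn.neg_section hZ.2

theorem SmoothCVF.add (hZ : SmoothCVF Z U) (hW : SmoothCVF W U) :
    SmoothCVF (fun y => Z y + W y) U := by
  refine ⟨?_, ?_⟩
  · simp only [map_add]
    exact ContMDiffOn.add_section hZ.1 hW.1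
  · simp only [map_add]
    exact ContMDiffOn.add_section hZ.2 hW.2

theorem SmoothCVF.smul (hf : SmoothFn n f U) (hZ : SmoothCVF Z U) :
    SmoothCVF (fun y => f y • Z y) U := by
  have h1 : ContMDiffOn (𝓡 (2 * n + 1)) 𝓘(ℝ, ℝ) ∞ (fun x => (f x).re) U :=
    Complex.reCLM.contMDiff.comp_contMDiffOn hf
  have h2 : ContMDiffOn (𝓡 (2 * n + 1)) 𝓘(ℝ, ℝ) ∞ (fun x => (f x).im) U :=
    Complex.imCLM.contMDiff.comp_contMDiffOn hf
  refine ⟨?_, ?_⟩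
  · simp only [cRe_smul]
    exact ContMDiffOn.sub_section (ContMDiffOn.smul_section h1 hZ.1)
      (ContMDiffOn.smul_section h2 hZ.2)
  · simp only [cIm_smul]
    exact ContMDiffOn.add_section (ContMDiffOn.smul_section h1 hZ.2)
      (ContMDiffOn.smul_section h2 hZ.1)

theorem smoothVF_zero : SmoothVF (fun y : M => (0 : TS n y)) U := 
  (Bundle.contMDiff_zeroSection ℝ (TangentSpace (𝓡 (2 * n + 1)) : M → Type _)).contMDiffOn

theorem smoothCVF_zero : SmoothCVF (fun y : M => (0 : CT n y)) U := by
  refine ⟨?_, ?_⟩ <;> simp only [map_zero] <;> exact smoothVF_zero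

theorem SmoothCVF.sum {ι : Type*} (s : Finset ι) {Z : ι → (x : M) → CT n x}
    (hZ : ∀ i ∈ s, SmoothCVF (Z i) U) : SmoothCVF (fun y => ∑ i ∈ s, Z i y) U := by
  classical
  induction s using Finset.induction_on with
  | empty => simpa using smoothCVF_zero
  | insert a s ha ih =>
    simp only [Finset.sum_insert ha]
    exact (hZ a (by simp)).add (ih fun i hi => hZ i (by simp [hi]))

theorem SmoothVF.toCVF {X : (x : M) → TS n x} (hX : SmoothVF X U) :
    SmoothCVF (fun y => cMk (X y) 0) U := by
  refine ⟨?_, ?_⟩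
  · simpa using hX
  · simpa using smoothVF_zero

end Dir

/-! ### Heisenberg coordinates on a flat manifold -/

section Flat
variable {n : ℕ} {M : Type*} [TopologicalSpace M]
  [ChartedSpace (EuclideanSpace ℝ (Fin (2 * n + 1))) M]
  [IsManifold (𝓡 (2 * n + 1)) ∞ M]

theorem cForm_eq_cEvalL (θ : (x : M) → TS n x →L[ℝ] ℝ) (x : M) (v : CT n x) :
    cForm θ x v = cEvalL (Complex.ofRealCLM.toLinearMap ∘ₗ (θ x : TS n x →ₗ[ℝ] ℝ)) v := rfl

/-- Coordinates `z`, `t` on `V` in which `θ` and `T^{1,0}` are those of the Heisenberg group,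
together with the coordinate field `∂/∂t`. -/
structure FlatChart (S : PseudoHermitian n M) (V : Set M) where
  ε : Fin n → ℝ
  ε_sq : ∀ α, ε α * ε α = 1
  z : Fin n → M → ℂ
  t : M → ℂ
  e₀ : (x : M) → TS n x
  isOpen : IsOpen V
  smooth_z : ∀ α, SmoothFn n (z α) V
  smooth_t : SmoothFn n t V
  smooth_e₀ : SmoothVF e₀ V
  form_eq : ∀ x ∈ V, ∀ v : CT n x, cForm S.θ x v = dirAt t x v +
    ∑ α, (ε α / (2 * Complex.I)) * (star (z α x) * dirAt (z α) x v
      - z α x * dirAt (fun y => star (z α y)) x v)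
  mem_T10 : ∀ x ∈ V, ∀ v : CT n x, v ∈ S.T10 x ↔
    cForm S.θ x v = 0 ∧ ∀ α, dirAt (fun y => star (z α y)) x v = 0
  ext_zero : ∀ x ∈ V, ∀ v : CT n x, cForm S.θ x v = 0 → (∀ α, dirAt (z α) x v = 0) →
    (∀ α, dirAt (fun y => star (z α y)) x v = 0) → v = 0
  z_e₀ : ∀ x ∈ V, ∀ α, vderiv (𝓡 (2 * n + 1)) (z α) x (e₀ x) = 0
  θ_e₀ : ∀ x ∈ V, S.θ x (e₀ x) = 1
  exists_extension : ∀ x ∈ V, ∀ v : TS n x, ∃ X, SmoothVF X V ∧ X x = v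
  exists_field : ∀ x ∈ V, ∀ c : Fin n → ℂ, ∃ X, SmoothVF X V ∧
    ∀ α, vderiv (𝓡 (2 * n + 1)) (z α) x (X x) = c α

theorem heisT10_cMk (p : ℕ) (q a b : Heis n) : heisT10 p q (cMk a b) ↔
    (heisForm p q a : ℂ) + Complex.I * (heisForm p q b : ℂ) = 0 ∧
      ∀ α, star (a.1 α) + Complex.I * star (b.1 α) = 0 := by
  simp only [heisT10, cEval, cRe_cMk, cIm_cMk]

/-- The coordinates of the Heisenberg group are pulled back by the local equivalence, and its
constant vector fields are pushed forward by the inverse. The latter provide `e₀` = ∂/∂t and enough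
smooth fields to extend a given vector or to prescribe the derivatives of z at a point. -/
theorem PseudoHermitian.IsFlat.exists_flatChart {S : PseudoHermitian n M} (hS : S.IsFlat) (x : M) :
    ∃ V, x ∈ V ∧ Nonempty (FlatChart S V) := by
  obtain ⟨p, Φ, hx, h1, h2, h3⟩ := hS x
  have i1 : IsManifold (𝓡 (2 * n + 1)) 1 M := IsManifold.of_le (n := ∞) (by simp)
  have hd : ∀ y ∈ Φ.source, MDifferentiableAt (𝓡 (2 * n + 1)) 𝓘(ℝ, Heis n) Φ y := fun y hy =>
    (h1.contMDiffAt (Φ.open_source.mem_nhds hy)).mdifferentiableAt (by simp)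
  have hd' : ∀ q ∈ Φ.target, MDifferentiableAt 𝓘(ℝ, Heis n) (𝓡 (2 * n + 1)) Φ.symm q :=
    fun q hq => (h2.contMDiffAt (Φ.open_target.mem_nhds hq)).mdifferentiableAt (by simp)
  set prz : Fin n → Heis n →L[ℝ] ℂ := fun α =>
    (ContinuousLinearMap.proj (R := ℝ) (φ := fun _ : Fin n => ℂ) α).comp
      (ContinuousLinearMap.fst ℝ (Fin n → ℂ) ℝ) with hprz
  set prt : Heis n →L[ℝ] ℂ := Complex.ofRealCLM.comp (ContinuousLinearMap.snd ℝ (Fin n → ℂ) ℝ)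
    with hprt
  set z : Fin n → M → ℂ := fun α y => prz α (Φ y) with hz
  set t : M → ℂ := fun y => prt (Φ y) with ht
  have sz : ∀ α, SmoothFn n (z α) Φ.source := fun α => (prz α).contMDiff.comp_contMDiffOn h1
  have st : SmoothFn n t Φ.source := prt.contMDiff.comp_contMDiffOn h1
  have dz : ∀ y ∈ Φ.source, ∀ α, ∀ v : TS n y, vderiv (𝓡 (2 * n + 1)) (z α) y v =
      (vderiv (𝓡 (2 * n + 1)) Φ y v).1 α := fun y hy α v => vderiv_postcomp (prz α) (hd y hy) v
  have dt : ∀ y ∈ Φ.source, ∀ v : TS n y, vderiv (𝓡 (2 * n + 1)) t y v =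
      (((vderiv (𝓡 (2 * n + 1)) Φ y v).2 : ℝ) : ℂ) := fun y hy v => vderiv_postcomp prt (hd y hy) v
  have dzb : ∀ y ∈ Φ.source, ∀ α, ∀ v : TS n y,
      vderiv (𝓡 (2 * n + 1)) (fun y => star (z α y)) y v =
      star ((vderiv (𝓡 (2 * n + 1)) Φ y v).1 α) := by
    intro y hy α v
    rw [← dz y hy α v]
    exact vderiv_postcomp (Complex.conjCLE : ℂ →L[ℝ] ℂ) ((sz α).mdifferentiableAt Φ.open_source hy) v
  set e : Heis n → (x : M) → TS n x := fun c y =>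
    mfderiv 𝓘(ℝ, Heis n) (𝓡 (2 * n + 1)) Φ.symm (Φ y) (c : Heis n) with he
  have left_inv : ∀ y ∈ Φ.source, ∀ v : TS n y, vderiv (𝓡 (2 * n + 1)) Φ y v = 0 → v = 0 := by
    intro y hy v hv
    have hc := mfderiv_comp y (hd' (Φ y) (Φ.map_source hy)) (hd y hy)
    have hid : mfderiv (𝓡 (2 * n + 1)) (𝓡 (2 * n + 1)) (Φ.symm ∘ Φ) y =
        ContinuousLinearMap.id ℝ _ := by
      rw [← mfderiv_id]
      refine Filter.EventuallyEq.mfderiv_eq ?_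
      filter_upwards [Φ.open_source.mem_nhds hy] with q hq
      exact Φ.left_inv hq
    have e1 := congrArg (fun T : TS n y →L[ℝ] TS n y => T v) (hid.symm.trans hc)
    have e2 : v = mfderiv 𝓘(ℝ, Heis n) (𝓡 (2 * n + 1)) Φ.symm (Φ y)
      (vderiv (𝓡 (2 * n + 1)) Φ y v) := e1
    rw [hv] at e2
    exact e2.trans (map_zero _)
  have right_inv : ∀ c, ∀ y ∈ Φ.source, vderiv (𝓡 (2 * n + 1)) Φ y (e c y) = c := by
    intro c y hy
    have hy' := Φ.map_source hy
    have hd2 : MDifferentiableAt (𝓡 (2 * n + 1)) 𝓘(ℝ, Heis n) Φ (Φ.symm (Φ y)) := by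
      rw [Φ.left_inv hy]; exact hd y hy
    have hc := mfderiv_comp (Φ y) hd2 (hd' (Φ y) hy')
    have hid : mfderiv 𝓘(ℝ, Heis n) 𝓘(ℝ, Heis n) (Φ ∘ Φ.symm) (Φ y) =
        ContinuousLinearMap.id ℝ _ := by
      rw [← mfderiv_id]
      refine Filter.EventuallyEq.mfderiv_eq ?_
      filter_upwards [Φ.open_target.mem_nhds hy'] with q hq
      exact Φ.right_inv hq
    have e1 := congrArg (fun T : Heis n →L[ℝ] Heis n => T c) (hid.symm.trans hc)
    have e2 : c = vderiv (𝓡 (2 * n + 1)) Φ (Φ.symm (Φ y))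
      (mfderiv 𝓘(ℝ, Heis n) (𝓡 (2 * n + 1)) Φ.symm (Φ y) (c : Heis n)) := e1
    nth_rewrite 2 [e2]
    -- The points `Φ.symm (Φ y)` and `y` are only propositionally equal; with a free base point the
    -- equality can be substituted.
    have gen : ∀ y' : M, y' = y → ∀ v : TS n y, vderiv (𝓡 (2 * n + 1)) Φ y v =
        vderiv (𝓡 (2 * n + 1)) Φ y' (v : EuclideanSpace ℝ (Fin (2 * n + 1))) := by
      rintro y' rfl v; rfl
    exact gen _ (Φ.left_inv hy) _
  have hθ : ∀ y ∈ Φ.source, ∀ v : TS n y, ((S.θ y v : ℝ) : ℂ) = vderiv (𝓡 (2 * n + 1)) t y v +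
      ∑ α, ((heisSign p α : ℝ) / (2 * Complex.I)) *
        (star (z α y) * vderiv (𝓡 (2 * n + 1)) (z α) y v
        - z α y * vderiv (𝓡 (2 * n + 1)) (fun y => star (z α y)) y v) := by
    intro y hy v
    have e : S.θ y v = heisForm p (Φ y) (vderiv (𝓡 (2 * n + 1)) Φ y v) := (h3 y hy).1 v
    rw [e, heisForm, dt y hy]
    push_cast
    congr 1
    refine Finset.sum_congr rfl fun α _ => ?_
    -- Here Im(z̄ dz) is rewritten as (z̄ dz − z dz̄)/(2i).
    rw [dz y hy, dzb y hy, mul_comm ((heisSign p α : ℝ) : ℂ), Complex.im_eq_sub_conj]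
    have e : z α y = (Φ y).1 α := rfl
    rw [e]
    simp only [Complex.star_def, map_mul, Complex.conj_conj]
    ring
  have hform : ∀ y ∈ Φ.source, ∀ v : CT n y, cForm S.θ y v = dirAt t y v +
      ∑ α, ((heisSign p α : ℝ) / (2 * Complex.I)) * (star (z α y) * dirAt (z α) y v
        - z α y * dirAt (fun y => star (z α y)) y v) := by
    intro y hy v
    simp only [cForm, cEval, dirAt, cEvalL_apply, ContinuousLinearMap.coe_coe, hθ y hy]
    rw [mul_add, Finset.mul_sum, add_add_add_comm, ← Finset.sum_add_distrib]
    congr 1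
    refine Finset.sum_congr rfl fun α _ => ?_
    ring
  have hT : ∀ y ∈ Φ.source, ∀ v : CT n y, v ∈ S.T10 y ↔
      cForm S.θ y v = 0 ∧ ∀ α, dirAt (fun y => star (z α y)) y v = 0 := by
    intro y hy v
    refine ((h3 y hy).2 v).trans ((heisT10_cMk p _ _ _).trans ?_)
    have e1 : ∀ u : TS n y, S.θ y u = heisForm p (Φ y)
      (mfderiv (𝓡 (2 * n + 1)) 𝓘(ℝ, Heis n) Φ y u : Heis n) := (h3 y hy).1
    simp only [cForm, cEval, dirAt, cEvalL_apply, ContinuousLinearMap.coe_coe,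
      e1, dzb y hy]
    rfl
  have smooth_e : ∀ c, SmoothVF (e c) Φ.source := by
    intro c
    have hm := h2.contMDiffOn_tangentMapWithin (m := ∞) (by simp) Φ.open_target.uniqueMDiffOn
    have hs : ContMDiffOn (𝓡 (2 * n + 1)) 𝓘(ℝ, Heis n).tangent ∞
        (fun y => (⟨Φ y, (c : Heis n)⟩ : TangentBundle 𝓘(ℝ, Heis n) (Heis n))) Φ.source := by
      have : ContMDiff 𝓘(ℝ, Heis n) 𝓘(ℝ, Heis n).tangent ∞
          (fun q => (⟨q, (c : Heis n)⟩ : TangentBundle 𝓘(ℝ, Heis n) (Heis n))) := by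
        exact (contMDiff_vectorSpace_iff_contDiff (E := Heis n)
          (V := fun _ => (c : Heis n))).2 contDiff_const
      exact this.comp_contMDiffOn h1
    have := hm.comp hs (fun y hy => Φ.map_source hy)
    refine ContMDiffOn.congr this fun y hy => ?_
    have e := mfderivWithin_of_isOpen (I := 𝓘(ℝ, Heis n)) (I' := 𝓡 (2 * n + 1)) (f := Φ.symm)
      Φ.open_target (Φ.map_source hy)
    simp only [Function.comp, tangentMapWithin, he]
    rw [Φ.left_inv hy, e]
  refine ⟨Φ.source, hx, ⟨⟨heisSign p, ?_, z, t, e (0, 1), Φ.open_source, sz, st,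
    smooth_e _, hform, hT, ?_, ?_, ?_, ?_, ?_⟩⟩⟩
  · intro α
    rw [heisSign]; split_ifs <;> norm_num
  · intro y hy v h0 ha hb
    -- On u + iv the forms dz and dz̄ take the values a + ib and ā + ib̄. Adding the conjugate of
    -- the second to the first isolates a.
    have key : ∀ α, (vderiv (𝓡 (2 * n + 1)) Φ y (cRe v)).1 α = 0 ∧
        (vderiv (𝓡 (2 * n + 1)) Φ y (cIm v)).1 α = 0 := by
      intro α
      have ha := ha α
      have hb := hb α
      simp only [dirAt, cEvalL_apply, ContinuousLinearMap.coe_coe, dz y hy, dzb y hy] at ha hb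
      have hb' := congrArg star hb
      simp only [star_add, star_mul', star_zero, Complex.star_def, Complex.conj_I, Complex.conj_conj] at hb'
      have r1 : (vderiv (𝓡 (2 * n + 1)) Φ y (cRe v)).1 α = 0 := by
        linear_combination (ha + hb') / 2
      refine ⟨r1, ?_⟩
      rw [r1, zero_add] at ha
      exact (mul_eq_zero.1 ha).resolve_left Complex.I_ne_zero
    rw [cForm, cEval] at h0
    have hre := congrArg Complex.re h0
    have him := congrArg Complex.im h0
    simp at hre him
    have fin : ∀ u : TS n y, S.θ y u = 0 → (∀ α, (vderiv (𝓡 (2 * n + 1)) Φ y u).1 α = 0) →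
        u = 0 := by
      intro u hu hz0
      refine left_inv y hy u (Prod.ext (funext hz0) ?_)
      have e : S.θ y u = heisForm p (Φ y) (vderiv (𝓡 (2 * n + 1)) Φ y u) := (h3 y hy).1 u
      rw [hu, heisForm] at e
      simpa [hz0] using e.symm
    exact complexified_ext (by simpa using fin _ hre fun α => (key α).1)
      (by simpa using fin _ him fun α => (key α).2)
  · intro y hy α
    rw [dz y hy, right_inv _ y hy]; rfl
  · intro y hy
    have e' : S.θ y (e (0, 1) y) = heisForm p (Φ y) (vderiv (𝓡 (2 * n + 1)) Φ y (e (0, 1) y)) :=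
      (h3 y hy).1 _
    rw [e', right_inv _ y hy, heisForm]
    simp
  · intro y hy v
    refine ⟨e (vderiv (𝓡 (2 * n + 1)) Φ y v), smooth_e _, ?_⟩
    rw [← sub_eq_zero]
    refine left_inv y hy _ ?_
    rw [map_sub, right_inv _ y hy, sub_self]
  · intro y hy c
    refine ⟨e (c, 0), smooth_e _, fun α => ?_⟩
    rw [dz y hy, right_inv _ y hy]

/-- Restriction of a flat chart to a smaller open set. -/
def FlatChart.restrict {S : PseudoHermitian n M} {V W : Set M} (C : FlatChart S V) (hW : IsOpen W)
    (h : W ⊆ V) : FlatChart S W where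
  ε := C.ε
  ε_sq := C.ε_sq
  z := C.z
  t := C.t
  e₀ := C.e₀
  isOpen := hW
  smooth_z α := (C.smooth_z α).mono h
  smooth_t := C.smooth_t.mono h
  smooth_e₀ := ContMDiffOn.mono C.smooth_e₀ h
  form_eq x hx := C.form_eq x (h hx)
  mem_T10 x hx := C.mem_T10 x (h hx)
  ext_zero x hx := C.ext_zero x (h hx)
  z_e₀ x hx := C.z_e₀ x (h hx)
  θ_e₀ x hx := C.θ_e₀ x (h hx)
  exists_extension x hx v :=
    let ⟨X, hX, e⟩ := C.exists_extension x (h hx) v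
    ⟨X, ContMDiffOn.mono hX h, e⟩
  exists_field x hx c :=
    let ⟨X, hX, e⟩ := C.exists_field x (h hx) c
    ⟨X, ContMDiffOn.mono hX h, e⟩

end Flat

/-! ### The algebra of smooth functions and its derivations -/

section Ring
variable {n : ℕ} {M : Type*} [TopologicalSpace M]
  [ChartedSpace (EuclideanSpace ℝ (Fin (2 * n + 1))) M]
  [IsManifold (𝓡 (2 * n + 1)) ∞ M] {V : Set M}

/-- Extension by zero of a function on `V`. -/
def extZero (φ : V → ℂ) : M → ℂ := Function.extend Subtype.val φ 0

@[simp] theorem extZero_apply (φ : V → ℂ) (y : V) : extZero φ y = φ y :=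
  Subtype.val_injective.extend_apply _ _ _

theorem extZero_eqOn {φ : V → ℂ} {f : M → ℂ} (h : ∀ y : V, φ y = f y) : EqOn (extZero φ) f V :=
  fun y hy => (extZero_apply φ ⟨y, hy⟩).trans (h ⟨y, hy⟩)

/-- The algebra of smooth complex functions on `V`. -/
def smoothAlg (n : ℕ) {M : Type*} [TopologicalSpace M]
    [ChartedSpace (EuclideanSpace ℝ (Fin (2 * n + 1))) M]
    [IsManifold (𝓡 (2 * n + 1)) ∞ M] (V : Set M) : StarSubalgebra ℂ (V → ℂ) where
  carrier := {φ | SmoothFn n (extZero φ) V}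
  mul_mem' {a b} ha hb := (SmoothFn.mul ha hb).congr (extZero_eqOn fun y => by simp)
  add_mem' {a b} ha hb := (SmoothFn.add ha hb).congr (extZero_eqOn fun y => by simp)
  algebraMap_mem' c := (smoothFn_const c).congr (extZero_eqOn fun y => rfl)
  star_mem' {a} ha := (SmoothFn.star ha).congr (extZero_eqOn fun y => by simp)

/-- The restriction of a smooth function to `V`. -/
def toAlg (f : M → ℂ) (hf : SmoothFn n f V) : smoothAlg n V :=
  ⟨fun y => f y, hf.congr (extZero_eqOn fun _ => rfl)⟩

@[simp] theorem toAlg_apply (f : M → ℂ) (hf : SmoothFn n f V) (y : V) : (toAlg f hf).1 y = f y := rfl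

theorem smoothAlg_ext {a b : smoothAlg n V} (h : ∀ y : V, a.1 y = b.1 y) : a = b :=
  Subtype.ext (funext h)

/-- The derivation of the algebra of smooth functions given by a complex vector field. -/
def der (hV : IsOpen V) (Z : (x : M) → CT n x) (hZ : SmoothCVF Z V) :
    Derivation ℂ (smoothAlg n V) (smoothAlg n V) :=
  Derivation.mk'
    { toFun := fun φ => toAlg (dir Z (extZero φ.1)) (SmoothFn.dir hV φ.2 hZ)
      map_add' := fun a b => smoothAlg_ext fun y => by
        have e : dirAt (n := n) (extZero (a.1 + b.1)) y.1 =
            dirAt (fun y => extZero a.1 y + extZero b.1 y) y.1 :=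
          dirAt_congr hV (extZero_eqOn fun y => by simp) y.2
        have := dirAt_add hV a.2 b.2 y.2
        simp [dir_eq, e, this]
      map_smul' := fun c a => smoothAlg_ext fun y => by
        have e : dirAt (n := n) (extZero (c • a.1)) y.1 =
            dirAt (fun y => c * extZero a.1 y) y.1 :=
          dirAt_congr hV (extZero_eqOn fun y => by simp) y.2
        have := dirAt_mul hV (smoothFn_const c) a.2 y.2
        simp [dir_eq, e, this, dirAt_const] }
    fun a b => smoothAlg_ext fun y => by
      have e : dirAt (n := n) (extZero (a.1 * b.1)) y.1 =
          dirAt (fun y => extZero a.1 y * extZero b.1 y) y.1 :=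
        dirAt_congr hV (extZero_eqOn fun y => by simp) y.2
      have := dirAt_mul hV a.2 b.2 y.2
      simp [dir_eq, e, this]

theorem der_apply (hV : IsOpen V) {Z : (x : M) → CT n x} (hZ : SmoothCVF Z V) (a : smoothAlg n V)
    (y : V) : (der hV Z hZ a).1 y = dir Z (extZero a.1) y := rfl

theorem der_toAlg_apply (hV : IsOpen V) {Z : (x : M) → CT n x} (hZ : SmoothCVF Z V) {f : M → ℂ}
    (hf : SmoothFn n f V) (y : V) : (der hV Z hZ (toAlg f hf)).1 y = dir Z f y := by
  rw [der_apply, dir_eq, dir_eq,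
    dirAt_congr hV (extZero_eqOn (φ := (toAlg f hf).1) fun _ => rfl) y.2]

theorem der_apply_of_eq (hV : IsOpen V) {Z : (x : M) → CT n x} (hZ : SmoothCVF Z V)
    {a : smoothAlg n V} {f : M → ℂ} (h : ∀ y : V, f y = a.1 y) (y : V) :
    (der hV Z hZ a).1 y = dir Z f y := by
  rw [der_apply, dir_eq, dir_eq, dirAt_congr hV (extZero_eqOn fun y => (h y).symm) y.2]

theorem der_star (hV : IsOpen V) {Z W : (x : M) → CT n x} (hZ : SmoothCVF Z V)
    (hW : SmoothCVF W V) (h : ∀ y, W y = cConj (Z y)) (a : smoothAlg n V) :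
    der hV Z hZ (star a) = star (der hV W hW a) := by
  refine smoothAlg_ext fun y => ?_
  rw [der_apply_of_eq hV hZ (f := fun y => star (extZero a.1 y)) (fun y => by simp), dir_eq,
    dirAt_star hV a.2 y.2, ← h]
  rfl

theorem cBracket_apply_extZero (hV : IsOpen V) {Z W : (x : M) → CT n x} (hZ : SmoothCVF Z V)
    (hW : SmoothCVF W V) (a : smoothAlg n V) (y : V) :
    dirAt (extZero a.1) y.1 (cBracket Z W y) =
      (der hV Z hZ (der hV W hW a)).1 y - (der hV W hW (der hV Z hZ a)).1 y := by
  rw [← dir_eq, dir_cBracket hV y.2 a.2 hZ hW]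
  congr 1
  · exact (der_toAlg_apply hV hZ (SmoothFn.dir hV a.2 hW) y).symm
  · exact (der_toAlg_apply hV hW (SmoothFn.dir hV a.2 hZ) y).symm

theorem cBracket_apply_of_eq (hV : IsOpen V) {Z W : (x : M) → CT n x} (hZ : SmoothCVF Z V)
    (hW : SmoothCVF W V) {a : smoothAlg n V} {f : M → ℂ} (h : ∀ y : V, f y = a.1 y) (y : V) :
    dirAt f y.1 (cBracket Z W y) =
      (der hV Z hZ (der hV W hW a)).1 y - (der hV W hW (der hV Z hZ a)).1 y := by
  rw [← cBracket_apply_extZero, dirAt_congr hV (extZero_eqOn fun y => (h y).symm) y.2]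

end Ring

/-! ### The contact form, its differential and the characteristic field -/

section Contact
variable {n : ℕ} {M : Type*} [TopologicalSpace M]
  [ChartedSpace (EuclideanSpace ℝ (Fin (2 * n + 1))) M]
  [IsManifold (𝓡 (2 * n + 1)) ∞ M] {S : PseudoHermitian n M} {V : Set M}

theorem smoothAlg_sum_apply {ι : Type*} (s : Finset ι) (a : ι → smoothAlg n V) (y : V) :
    (∑ i ∈ s, a i).1 y = ∑ i ∈ s, (a i).1 y := by
  have : (∑ i ∈ s, a i).1 = ∑ i ∈ s, (a i).1 := map_sum (smoothAlg n V).subtype _ _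
  rw [this, Finset.sum_apply]

namespace FlatChart
variable (C : FlatChart S V)

/-- The coordinate `z` as an element of the algebra of smooth functions. -/
def zA (α : Fin n) : smoothAlg n V := toAlg (C.z α) (C.smooth_z α)

/-- The coordinate `t` as an element of the algebra of smooth functions. -/
def tA : smoothAlg n V := toAlg C.t C.smooth_t

/-- The contact form on a derivation of the algebra of smooth functions. -/
def formD (D : Derivation ℂ (smoothAlg n V) (smoothAlg n V)) : smoothAlg n V :=
  D C.tA + ∑ α, ((C.ε α : ℂ) / (2 * Complex.I)) •
    (star (C.zA α) * D (C.zA α) - C.zA α * D (star (C.zA α)))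

/-- This is Cartan's formula for dθ = i ∑ ε_α dz^α ∧ dz̄^α. The term dt is exact and cancels, and so
do all second derivatives of z. -/
theorem formD_bracket (D E : Derivation ℂ (smoothAlg n V) (smoothAlg n V)) :
    D (C.formD E) - E (C.formD D) - C.formD ⁅D, E⁆ = ∑ α, ((C.ε α : ℂ) / (2 * Complex.I)) •
      (2 * (D (star (C.zA α)) * E (C.zA α) - E (star (C.zA α)) * D (C.zA α))) := by
  simp only [formD, map_add, map_sub, map_sum, Derivation.map_smul, Derivation.leibniz,
    smul_eq_mul, Derivation.commutator_apply]
  rw [add_sub_add_comm, add_sub_add_comm, sub_self, zero_add, ← Finset.sum_sub_distrib,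
    ← Finset.sum_sub_distrib]
  refine Finset.sum_congr rfl fun α _ => ?_
  simp only [← smul_sub]
  congr 1
  ring

/-- Only agreement at the single point `y` is required, so that the lemma serves for Lie brackets as
well as for smooth fields. -/
theorem cForm_eq_formD {v : (x : M) → CT n x} {D : Derivation ℂ (smoothAlg n V) (smoothAlg n V)}
    (y : V) (h : ∀ (a : smoothAlg n V) (f : M → ℂ), (∀ y : V, f y = a.1 y) →
      dirAt f y.1 (v y) = (D a).1 y) :
    cForm S.θ y.1 (v y) = (C.formD D).1 y := by
  have h1 : ∀ α, dirAt (C.z α) y.1 (v y) = (D (C.zA α)).1 y := fun α => h _ _ fun _ => rfl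
  have h2 : ∀ α, dirAt (fun y => star (C.z α y)) y.1 (v y) = (D (star (C.zA α))).1 y :=
    fun α => h _ _ fun _ => rfl
  have h3 : dirAt C.t y.1 (v y) = (D C.tA).1 y := h _ _ fun _ => rfl
  rw [C.form_eq y y.2, formD, h3]
  simp only [h1, h2]
  have e : ∀ a b : smoothAlg n V, (a + b).1 y = a.1 y + b.1 y := fun _ _ => rfl
  rw [e, smoothAlg_sum_apply]
  rfl

theorem cForm_apply {Z : (x : M) → CT n x} (hZ : SmoothCVF Z V) (y : V) :
    cForm S.θ y.1 (Z y) = (C.formD (der C.isOpen Z hZ)).1 y :=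
  C.cForm_eq_formD y fun _ _ h => (der_apply_of_eq C.isOpen hZ h y).symm

theorem cForm_cBracket {Z W : (x : M) → CT n x} (hZ : SmoothCVF Z V) (hW : SmoothCVF W V) (y : V) :
    cForm S.θ y.1 (cBracket Z W y) =
      (C.formD ⁅der C.isOpen Z hZ, der C.isOpen W hW⁆).1 y :=
  C.cForm_eq_formD y fun _ _ h => by
    rw [cBracket_apply_of_eq C.isOpen hZ hW h, Derivation.commutator_apply]; rfl

theorem bracket_zero_right (X : (x : M) → TS n x) (x : M) :
    bracket X (fun _ => 0) x = 0 := by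
  have : bracket X (0 : (x : M) → TS n x) = 0 := mlieBracket_zero_right
  exact congrFun this x

theorem bracket_zero_left (X : (x : M) → TS n x) (x : M) :
    bracket (fun _ => 0) X x = 0 := by
  have : bracket (0 : (x : M) → TS n x) X = 0 := mlieBracket_zero_left
  exact congrFun this x

theorem cBracket_real (X Y : (x : M) → TS n x) (x : M) :
    cBracket (fun y => cMk (X y) 0) (fun y => cMk (Y y) 0) x = cMk (bracket X Y x) 0 := by
  simp [cBracket, bracket_zero_right, bracket_zero_left]

theorem cForm_real (θ : (x : M) → TS n x →L[ℝ] ℝ) (x : M) (v : TS n x) :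
    cForm θ x (cMk v 0) = (θ x v : ℂ) := by simp [cForm, cEval]

theorem rdir_eq {X Y : (x : M) → TS n x} (hX : SmoothVF X V) (hY : SmoothVF Y V) (y : V) :
    (rdir X (fun y => S.θ y (Y y)) y.1 : ℂ) =
      (der C.isOpen _ hX.toCVF (C.formD (der C.isOpen _ hY.toCVF))).1 y := by
  have hs := S.θ_smooth V C.isOpen Y hY
  have hd : MDifferentiableAt (𝓡 (2 * n + 1)) 𝓘(ℝ, ℝ) (fun y => S.θ y (Y y)) y.1 :=
    (hs.contMDiffAt (C.isOpen.mem_nhds y.2)).mdifferentiableAt (by simp)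
  have h := vderiv_postcomp Complex.ofRealCLM hd (X y)
  rw [der_apply_of_eq C.isOpen hX.toCVF (f := fun y => ((S.θ y (Y y) : ℝ) : ℂ))]
  · rw [dir_eq_vderiv, cRe_cMk, cIm_cMk, map_zero, mul_zero, add_zero]
    exact h.symm
  · intro y
    rw [← cForm_apply, cForm_real]

theorem dForm_eq {X Y : (x : M) → TS n x} (hX : SmoothVF X V) (hY : SmoothVF Y V) (y : V) :
    (dForm S.θ X Y y.1 : ℂ) = ∑ α, ((C.ε α : ℂ) / (2 * Complex.I)) *
      (2 * (star (vderiv (𝓡 (2 * n + 1)) (C.z α) y.1 (X y)) * vderiv (𝓡 (2 * n + 1)) (C.z α) y.1 (Y y)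
        - star (vderiv (𝓡 (2 * n + 1)) (C.z α) y.1 (Y y)) *
          vderiv (𝓡 (2 * n + 1)) (C.z α) y.1 (X y))) := by
  have h := congrArg (fun a => a.1 y)
    (C.formD_bracket (der C.isOpen _ hX.toCVF) (der C.isOpen _ hY.toCVF))
  have e1 : ∀ {X : (x : M) → TS n x} (hX : SmoothVF X V) (α : Fin n),
      (der C.isOpen _ hX.toCVF (C.zA α)).1 y = vderiv (𝓡 (2 * n + 1)) (C.z α) y.1 (X y) := by
    intro X hX α
    rw [zA, der_toAlg_apply, dir_eq_vderiv]; simp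
  have e2 : ∀ {X : (x : M) → TS n x} (hX : SmoothVF X V) (α : Fin n),
      (der C.isOpen _ hX.toCVF (star (C.zA α))).1 y =
        star (vderiv (𝓡 (2 * n + 1)) (C.z α) y.1 (X y)) := by
    intro X hX α
    rw [der_star C.isOpen hX.toCVF hX.toCVF (fun y => complexified_ext (by simp) (by simp)), ← e1 hX]
    rfl
  have hb := C.cForm_cBracket hX.toCVF hY.toCVF y
  rw [cBracket_real, cForm_real] at hb
  rw [dForm]
  push_cast
  rw [C.rdir_eq hX hY, C.rdir_eq hY hX, hb]
  refine Eq.trans h ?_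
  rw [smoothAlg_sum_apply]
  refine Finset.sum_congr rfl fun α _ => ?_
  rw [← e2 hX, ← e2 hY, ← e1 hX, ← e1 hY]
  rfl

/-- The field ∂/∂t satisfies the defining conditions because dθ involves only dz and dz̄.
Conversely, any solution has dz = 0 by nondegeneracy of dθ on these directions, and then θ = 1 fixes
it. -/
theorem reeb_eq {x : M} (hx : x ∈ V) : S.reeb x = C.e₀ x := by
  have ex : IsReebAt S.θ x (C.e₀ x) := by
    refine ⟨C.θ_e₀ x hx, fun U hU hxU X Y hX hY hXx => ?_⟩
    have h := (C.restrict (hU.inter C.isOpen) inter_subset_right).dForm_eq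
      (ContMDiffOn.mono hX inter_subset_left) (ContMDiffOn.mono hY inter_subset_left) ⟨x, hxU, hx⟩
    rw [← Complex.ofReal_eq_zero, h]
    refine Finset.sum_eq_zero fun α _ => ?_
    have e : vderiv (𝓡 (2 * n + 1)) (C.z α) x (X x) = 0 := by rw [hXx, C.z_e₀ x hx]
    change _ * (2 * (star (vderiv (𝓡 (2 * n + 1)) (C.z α) x (X x)) * _
      - _ * vderiv (𝓡 (2 * n + 1)) (C.z α) x (X x))) = 0
    rw [e]
    simp
  obtain ⟨h1, h2⟩ : IsReebAt S.θ x (S.reeb x) := Classical.epsilon_spec ⟨_, ex⟩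
  obtain ⟨X, hX, hXx⟩ := C.exists_extension x hx (S.reeb x)
  -- This test field turns dθ(T, Y) into 2 ∑ |dz^α(T)|²; the factor ε_α compensates the signature,
  -- since ε_α² = 1.
  obtain ⟨Y, hY, hYx⟩ := C.exists_field x hx fun α =>
    Complex.I * C.ε α * vderiv (𝓡 (2 * n + 1)) (C.z α) x (S.reeb x)
  have h3 := C.dForm_eq hX hY ⟨x, hx⟩
  rw [h2 V C.isOpen hx X Y hX hY hXx] at h3
  simp only [hXx, hYx] at h3
  have h4 : ∑ α, 2 * Complex.normSq (vderiv (𝓡 (2 * n + 1)) (C.z α) x (S.reeb x)) = 0 := by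
    rw [← Complex.ofReal_inj, h3]
    push_cast
    refine Finset.sum_congr rfl fun α _ => ?_
    have hI := Complex.I_ne_zero
    have hε : (C.ε α : ℂ) * C.ε α = 1 := by exact_mod_cast C.ε_sq α
    rw [Complex.normSq_eq_conj_mul_self]
    simp only [Complex.star_def, map_mul, Complex.conj_I, Complex.conj_ofReal]
    field_simp
    linear_combination (-2 : ℂ) * (starRingEnd ℂ (vderiv (𝓡 (2 * n + 1)) (C.z α) x (S.reeb x))) *
      vderiv (𝓡 (2 * n + 1)) (C.z α) x (S.reeb x) * hε
  have h5 : ∀ α, vderiv (𝓡 (2 * n + 1)) (C.z α) x (S.reeb x) = 0 := fun α => by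
    have := (Finset.sum_eq_zero_iff_of_nonneg
      (fun α _ => by have := Complex.normSq_nonneg
                        (vderiv (𝓡 (2 * n + 1)) (C.z α) x (S.reeb x)); positivity)).1 h4 α
      (Finset.mem_univ _)
    simpa using this
  have hv : cMk (S.reeb x - C.e₀ x) 0 = 0 := by
    refine C.ext_zero x hx _ ?_ ?_ ?_
    · rw [cForm_real, map_sub, h1, C.θ_e₀ x hx]; simp
    · intro α
      simp [dirAt, cEvalL_apply, h5, C.z_e₀ x hx]
    · intro α
      rw [dirAt_star C.isOpen (C.smooth_z α) hx]
      simp [dirAt, cEvalL_apply, h5, C.z_e₀ x hx]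
  have := congrArg cRe hv
  rwa [cRe_cMk, map_zero, sub_eq_zero] at this

end FlatChart
end Contact

/-! ### Logarithmic derivative of a determinant -/

section Jacobi
variable {R : Type*} [CommRing R] [Algebra ℂ R]

/-- The ring homomorphism `f ↦ f + ε D f` of a derivation `D`. -/
def dualHom (D : Derivation ℂ R R) : R →+* TrivSqZeroExt R R where
  toFun f := TrivSqZeroExt.inl f + TrivSqZeroExt.inr (D f)
  map_one' := by ext <;> simp
  map_mul' a b := by ext <;> simp [mul_comm (D a)]
  map_zero' := by ext <;> simp
  map_add' a b := by ext <;> simp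

/-- Jacobi's formula for a derivation. -/
theorem derivation_det {ι : Type*} [Fintype ι] [DecidableEq ι] (D : Derivation ℂ R R)
    {g gi : Matrix ι ι R} (h : g * gi = 1) :
    D g.det = g.det * ((g.map D) * gi).trace := by
  have h' : gi * g = 1 := mul_eq_one_comm.1 h
  have hr : (TrivSqZeroExt.inr (1 : R) : TrivSqZeroExt R R) ^ 2 = 0 := by
    rw [pow_two]; exact TrivSqZeroExt.inr_mul_inr _ _ _
  set i : R →+* TrivSqZeroExt R R := TrivSqZeroExt.inlHom R R with hi
  -- Over the dual numbers g + ε Dg = (1 + ε (Dg) g⁻¹) g, and ε² = 0 leaves only the trace in the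
  -- determinant of the first factor.
  have e : g.map (dualHom D) =
      (1 + (TrivSqZeroExt.inr (1 : R) : TrivSqZeroExt R R) • ((g.map D) * gi).map i) * g.map i := by
    rw [add_mul, one_mul, Matrix.smul_mul, ← Matrix.map_mul, Matrix.mul_assoc, h', Matrix.mul_one]
    ext a b <;> simp [dualHom, hi]
  have h1 := congrArg Matrix.det e
  rw [Matrix.det_mul, Matrix.det_one_add_smul, hr, mul_zero, add_zero] at h1
  have e1 : (g.map (dualHom D)).det = dualHom D g.det := ((dualHom D).map_det g).symm
  have e2 : (g.map i).det = i g.det := (i.map_det g).symm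
  have e3 : (((g.map D) * gi).map i).trace = i ((g.map D) * gi).trace := by
    rw [Matrix.trace, Matrix.trace, map_sum]; rfl
  rw [e1, e2, e3] at h1
  have h2 := congrArg TrivSqZeroExt.snd h1
  simpa [dualHom, hi, mul_comm] using h2
end Jacobi

/-! ### The frame matrix in flat coordinates -/

section Coframe
variable {n : ℕ} {M : Type*} [TopologicalSpace M]
  [ChartedSpace (EuclideanSpace ℝ (Fin (2 * n + 1))) M]
  [IsManifold (𝓡 (2 * n + 1)) ∞ M] {S : PseudoHermitian n M} {U V : Set M}

theorem SmoothCVF.congr {Z W : (x : M) → CT n x} (hZ : SmoothCVF Z V) (h : ∀ x ∈ V, W x = Z x) :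
    SmoothCVF W V := by
  refine ⟨ContMDiffOn.congr hZ.1 fun x hx => ?_, ContMDiffOn.congr hZ.2 fun x hx => ?_⟩ <;>
    simp only [h x hx]

theorem SmoothCVF.mono {Z : (x : M) → CT n x} (hZ : SmoothCVF Z U) (h : V ⊆ U) : SmoothCVF Z V :=
  ⟨ContMDiffOn.mono hZ.1 h, ContMDiffOn.mono hZ.2 h⟩

/-- A flat chart on an open subset of the domain of an admissible coframe. -/
structure FlatCoframe (S : PseudoHermitian n M) (U V : Set M) where
  C : FlatChart S V
  F : AdmissibleCoframe S U
  sub : V ⊆ U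

namespace FlatCoframe
variable (K : FlatCoframe S U V)

theorem smooth_vec : ∀ a, SmoothCVF (K.F.vec a) V
  | .lo α => (K.F.isFrame.1 α).mono K.sub
  | .bar α => ((K.F.isFrame.1 α).mono K.sub).conj
  | .zero => SmoothCVF.congr K.C.smooth_e₀.toCVF fun x hx => by
      simp only [AdmissibleCoframe.vec, K.C.reeb_eq hx]

/-- The derivations given by the frame of the coframe. -/
def E (a : Dir n) : Derivation ℂ (smoothAlg n V) (smoothAlg n V) :=
  der K.C.isOpen (K.F.vec a) (K.smooth_vec a)

theorem E_apply (a : Dir n) {φ : smoothAlg n V} {f : M → ℂ} (h : ∀ y : V, f y = φ.1 y) (y : V) :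
    dir (K.F.vec a) f y = (K.E a φ).1 y := (der_apply_of_eq _ _ h y).symm

theorem vec_conj (a : Dir n) (y : M) : K.F.vec a.conj y = cConj (K.F.vec a y) := by
  cases a with
  | lo α => rfl
  | bar α => simp [AdmissibleCoframe.vec, Dir.conj]
  | zero =>
    simp only [AdmissibleCoframe.vec, Dir.conj]
    exact complexified_ext (by simp) (by simp)

theorem E_star (a : Dir n) (φ : smoothAlg n V) : K.E a (star φ) = star (K.E a.conj φ) :=
  der_star _ _ _ (fun y => K.vec_conj a y) φ

/-- The frame in the flat coordinates. -/
def g : Matrix (Fin n) (Fin n) (smoothAlg n V) := Matrix.of fun α β => K.E (.lo α) (K.C.zA β)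

theorem cForm_vec (a : Dir n) (y : V) :
    cForm S.θ y.1 (K.F.vec a y) = (K.C.formD (K.E a)).1 y := K.C.cForm_apply _ y

theorem T10_vec (α : Fin n) (y : V) : K.F.Z α y ∈ S.T10 y := by
  rw [← (K.F.isFrame.2 y (K.sub y.2)).2]
  exact Submodule.subset_span ⟨α, rfl⟩

theorem E_lo_star_z (α β : Fin n) : K.E (.lo α) (star (K.C.zA β)) = 0 := smoothAlg_ext fun y => by
  have := ((K.C.mem_T10 y y.2 _).1 (K.T10_vec α y)).2 β
  rw [← K.E_apply (.lo α) (f := fun y => star (K.C.z β y)) fun _ => rfl]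
  exact this

theorem E_lo_z (α β : Fin n) : K.E (.lo α) (K.C.zA β) = K.g α β := rfl

theorem E_bar_z (α β : Fin n) : K.E (.bar α) (K.C.zA β) = 0 := by
  have := K.E_star (.bar α) (star (K.C.zA β))
  rw [star_star] at this
  rw [this]
  exact (congrArg star (K.E_lo_star_z α β)).trans (star_zero _)

theorem E_bar_star_z (α β : Fin n) : K.E (.bar α) (star (K.C.zA β)) = star (K.g α β) :=
  K.E_star _ _

theorem E_zero_z (β : Fin n) : K.E .zero (K.C.zA β) = 0 := smoothAlg_ext fun y => by
  rw [← K.E_apply .zero (f := K.C.z β) fun _ => rfl, dir_eq_vderiv]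
  simp only [AdmissibleCoframe.vec, cRe_cMk, cIm_cMk, K.C.reeb_eq y.2, K.C.z_e₀ y y.2]
  simp

theorem E_zero_star_z (β : Fin n) : K.E .zero (star (K.C.zA β)) = 0 := by
  rw [K.E_star, Dir.conj, E_zero_z, star_zero]

theorem formD_lo (α : Fin n) : K.C.formD (K.E (.lo α)) = 0 := smoothAlg_ext fun y => by
  rw [← cForm_vec]
  exact ((K.C.mem_T10 y y.2 _).1 (K.T10_vec α y)).1

theorem cForm_cConj (θ : (x : M) → TS n x →L[ℝ] ℝ) (x : M) (v : CT n x) :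
    cForm θ x (cConj v) = star (cForm θ x v) := by
  simp [cForm, cEval]

theorem formD_bar (α : Fin n) : K.C.formD (K.E (.bar α)) = 0 := smoothAlg_ext fun y => by
  rw [← cForm_vec]
  have := ((K.C.mem_T10 y y.2 _).1 (K.T10_vec α y)).1
  simp only [AdmissibleCoframe.vec]
  rw [cForm_cConj, this, star_zero]
  rfl

theorem formD_zero : K.C.formD (K.E .zero) = 1 := smoothAlg_ext fun y => by
  rw [← cForm_vec]
  simp only [AdmissibleCoframe.vec]
  rw [FlatChart.cForm_real, K.C.reeb_eq y.2, K.C.θ_e₀ y y.2]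
  simp

/-- Evaluation at a point as a ring homomorphism. -/
def evalHom (y : V) : smoothAlg n V →+* ℂ :=
  (Pi.evalRingHom (fun _ : V => ℂ) y).comp (smoothAlg n V).toSubalgebra.val.toRingHom

@[simp] theorem evalHom_apply (y : V) (a : smoothAlg n V) : evalHom y a = a.1 y := rfl

theorem dirAt_z_vec (α β : Fin n) (y : V) :
    dirAt (K.C.z β) y.1 (K.F.Z α y) = (K.g α β).1 y := K.E_apply (.lo α) (fun _ => rfl) y

theorem dirAt_star_z_vec (α β : Fin n) (y : V) :
    dirAt (fun y => star (K.C.z β y)) y.1 (K.F.Z α y) = 0 :=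
  ((K.C.mem_T10 y y.2 _).1 (K.T10_vec α y)).2 β

/-- A combination of the Z_α killed by all dz^β is also killed by θ and dz̄^β, hence is zero,
against linear independence of the frame. -/
theorem det_g_ne_zero (y : V) : (K.g.det).1 y ≠ 0 := by
  have e : K.g.det.1 y = (K.g.map (evalHom y)).det := (evalHom y).map_det K.g
  rw [e]
  intro h0
  obtain ⟨c, hc, hc0⟩ := Matrix.exists_vecMul_eq_zero_iff.2 h0
  have hv : ∑ α, c α • K.F.Z α y = 0 := by
    refine K.C.ext_zero y y.2 _ ?_ ?_ ?_
    · rw [cForm_eq_cEvalL, map_sum]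
      refine Finset.sum_eq_zero fun α _ => ?_
      rw [map_smul, ← cForm_eq_cEvalL, ((K.C.mem_T10 y y.2 _).1 (K.T10_vec α y)).1, smul_zero]
    · intro β
      have := congrFun hc0 β
      rw [map_sum]
      simp only [map_smul, dirAt_z_vec, smul_eq_mul]
      exact this
    · intro β
      rw [map_sum]
      exact Finset.sum_eq_zero fun α _ => by rw [map_smul, dirAt_star_z_vec, smul_zero]
  exact hc (funext fun α =>
    Fintype.linearIndependent_iff.1 (K.F.isFrame.2 y (K.sub y.2)).1 c hv α)

/-- The inverse of the determinant of `g`. -/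
def detInv : smoothAlg n V :=
  toAlg (fun y => (extZero K.g.det.1 y)⁻¹) (SmoothFn.inv K.g.det.2 fun x hx => by
    have := K.det_g_ne_zero ⟨x, hx⟩
    rwa [← extZero_apply K.g.det.1] at this)

theorem det_mul_detInv : K.g.det * K.detInv = 1 := smoothAlg_ext fun y => by
  have : (K.g.det * K.detInv).1 y = K.g.det.1 y * (extZero K.g.det.1 y)⁻¹ := rfl
  rw [this, extZero_apply, mul_inv_cancel₀ (K.det_g_ne_zero y)]
  rfl

/-- The inverse of `g`. -/
def gi : Matrix (Fin n) (Fin n) (smoothAlg n V) := K.detInv • K.g.adjugate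

theorem g_mul_gi : K.g * K.gi = 1 := by
  rw [gi, Matrix.mul_smul, Matrix.mul_adjugate, smul_smul, mul_comm, det_mul_detInv, one_smul]

theorem gi_mul_g : K.gi * K.g = 1 := mul_eq_one_comm.1 K.g_mul_gi

end FlatCoframe
end Coframe

theorem map_derivation_mul {R : Type*} [CommRing R] [Algebra ℂ R] {ι κ μ : Type*} [Fintype κ]
    (D : Derivation ℂ R R) (X : Matrix ι κ R) (Y : Matrix κ μ R) :
    (X * Y).map D = X * Y.map D + X.map D * Y := by
  ext a b
  simp [Matrix.mul_apply, Finset.sum_add_distrib, mul_comm]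

theorem smul_neg_smul_two_mul {R : Type*} [CommRing R] [Algebra ℂ R] (c d : ℂ) (a b : R) :
    c • -(d • (2 * -(a * b))) = (c * d * 2) • (b * a) := by
  simp only [Algebra.smul_def, map_mul, map_ofNat]
  ring

/-! ### Levi form, connection forms and torsion -/

section Coframe
variable {n : ℕ} {M : Type*} [TopologicalSpace M]
  [ChartedSpace (EuclideanSpace ℝ (Fin (2 * n + 1))) M]
  [IsManifold (𝓡 (2 * n + 1)) ∞ M] {S : PseudoHermitian n M} {U V : Set M}

namespace FlatCoframe
variable (K : FlatCoframe S U V)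

theorem evalHom_star (y : V) (a : smoothAlg n V) : evalHom y (star a) = star (evalHom y a) := rfl

theorem dirAt_z_vec_bar (α β : Fin n) (y : V) :
    dirAt (K.C.z β) y.1 (cConj (K.F.Z α y)) = 0 := by
  have := K.E_apply (.bar α) (f := K.C.z β) (fun _ => rfl) y (φ := K.C.zA β)
  rw [E_bar_z] at this
  exact this

theorem dirAt_star_z_vec_bar (α β : Fin n) (y : V) :
    dirAt (fun y => star (K.C.z β y)) y.1 (cConj (K.F.Z α y)) = star ((K.g α β).1 y) := by
  have := K.E_apply (.bar α) (f := fun y => star (K.C.z β y)) (fun _ => rfl) y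
    (φ := star (K.C.zA β))
  rw [E_bar_star_z] at this
  exact this

theorem dirAt_z_reeb (β : Fin n) (y : V) : dirAt (K.C.z β) y.1 (cMk (S.reeb y) 0) = 0 := by
  have := K.E_apply .zero (f := K.C.z β) (fun _ => rfl) y (φ := K.C.zA β)
  rw [E_zero_z] at this
  exact this

theorem dirAt_star_z_reeb (β : Fin n) (y : V) :
    dirAt (fun y => star (K.C.z β y)) y.1 (cMk (S.reeb y) 0) = 0 := by
  have := K.E_apply .zero (f := fun y => star (K.C.z β y)) (fun _ => rfl) y
    (φ := star (K.C.zA β))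
  rw [E_zero_star_z] at this
  exact this

theorem sum_gi_g (y : V) (β γ : Fin n) :
    ∑ α, (K.gi β α).1 y * (K.g α γ).1 y = if β = γ then 1 else 0 := by
  have := congrArg (evalHom y) (congrFun (congrFun K.gi_mul_g β) γ)
  rw [Matrix.mul_apply, map_sum, Matrix.one_apply] at this
  split_ifs at this ⊢ <;> simpa using this

/-- A vector is determined by its values under θ, dz and dz̄, and both sides agree on these. -/
theorem vec_decomp (y : V) (v : CT n y.1) :
    v = ∑ α, (∑ β, dirAt (K.C.z β) y.1 v * (K.gi β α).1 y) • K.F.Z α y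
      + ∑ α, (∑ β, dirAt (fun y => star (K.C.z β y)) y.1 v * star ((K.gi β α).1 y)) •
        cConj (K.F.Z α y)
      + cForm S.θ y.1 v • cMk (S.reeb y) 0 := by
  rw [← sub_eq_zero]
  refine K.C.ext_zero y y.2 _ ?_ ?_ ?_
  · rw [cForm_eq_cEvalL, map_sub, map_add, map_add, map_sum, map_sum]
    have h1 : ∀ α, cEvalL (Complex.ofRealCLM.toLinearMap ∘ₗ (S.θ y.1 : TS n y.1 →ₗ[ℝ] ℝ))
        (K.F.Z α y) = 0 := fun α => by
      rw [← cForm_eq_cEvalL]; exact ((K.C.mem_T10 y y.2 _).1 (K.T10_vec α y)).1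
    have h2 : ∀ α, cEvalL (Complex.ofRealCLM.toLinearMap ∘ₗ (S.θ y.1 : TS n y.1 →ₗ[ℝ] ℝ))
        (cConj (K.F.Z α y)) = 0 := fun α => by
      rw [← cForm_eq_cEvalL, cForm_cConj, cForm_eq_cEvalL, h1, star_zero]
    have h3 : cEvalL (Complex.ofRealCLM.toLinearMap ∘ₗ (S.θ y.1 : TS n y.1 →ₗ[ℝ] ℝ))
        (cMk (S.reeb y) 0) = 1 := by
      rw [← cForm_eq_cEvalL, FlatChart.cForm_real, K.C.reeb_eq y.2, K.C.θ_e₀ y y.2]; simp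
    simp only [map_smul, h1, h2, h3]
    simp [cForm_eq_cEvalL]
  · intro γ
    simp only [map_sub, map_add, map_sum, map_smul, dirAt_z_vec, dirAt_z_vec_bar, dirAt_z_reeb,
      smul_eq_mul, mul_zero, Finset.sum_const_zero, add_zero, Finset.sum_mul]
    rw [Finset.sum_comm]
    simp only [mul_assoc, ← Finset.mul_sum, sum_gi_g]
    simp
  · intro γ
    simp only [map_sub, map_add, map_sum, map_smul, dirAt_star_z_vec, dirAt_star_z_vec_bar,
      dirAt_star_z_reeb, smul_eq_mul, mul_zero, Finset.sum_const_zero, add_zero, zero_add,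
      Finset.sum_mul]
    rw [Finset.sum_comm]
    simp only [mul_assoc, ← Finset.mul_sum, ← star_mul', ← star_sum, sum_gi_g]
    simp [apply_ite (starRingEnd ℂ)]

theorem th_apply (α : Fin n) (y : V) (v : CT n y.1) :
    K.F.th α y v = ∑ β, dirAt (K.C.z β) y.1 v * (K.gi β α).1 y := by
  conv_lhs => rw [K.vec_decomp y v]
  simp only [map_add, map_sum, map_smul, K.F.th_Z y (K.sub y.2), K.F.th_conj y (K.sub y.2),
    K.F.th_reeb y (K.sub y.2)]
  simp

theorem vec_decomp_covec (y : V) (v : CT n y.1) :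
    v = ∑ α, K.F.covec (.lo α) y v • K.F.vec (.lo α) y
      + ∑ α, K.F.covec (.bar α) y v • K.F.vec (.bar α) y
      + K.F.covec .zero y v • K.F.vec .zero y := by
  conv_lhs => rw [K.vec_decomp y v]
  simp only [AdmissibleCoframe.covec, AdmissibleCoframe.vec, th_apply, star_sum, star_mul']
  congr 3
  refine funext fun α => ?_
  congr 1
  refine Finset.sum_congr rfl fun β _ => ?_
  rw [dirAt_star K.C.isOpen (K.C.smooth_z β) y.2]

/-- The signature matrix. -/
def εM : Matrix (Fin n) (Fin n) (smoothAlg n V) :=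
  Matrix.diagonal fun α => algebraMap ℂ _ (K.C.ε α : ℂ)

theorem εM_mul_εM : K.εM * K.εM = 1 := by
  rw [εM, Matrix.diagonal_mul_diagonal, ← Matrix.diagonal_one]
  congr 1
  funext α
  rw [← map_mul, ← Complex.ofReal_mul, K.C.ε_sq, Complex.ofReal_one, map_one]

theorem gh_mul_gih : K.g.conjTranspose * K.gi.conjTranspose = 1 := by
  rw [← Matrix.conjTranspose_mul, gi_mul_g, Matrix.conjTranspose_one]

/-- The Levi form as a matrix of smooth functions. -/
def hA : Matrix (Fin n) (Fin n) (smoothAlg n V) := K.g * K.εM * K.g.conjTranspose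

/-- The inverse of the Levi form. -/
def hiA : Matrix (Fin n) (Fin n) (smoothAlg n V) :=
  K.gi.conjTranspose * K.εM * K.gi

theorem hA_apply (α β : Fin n) : K.hA α β =
    ∑ μ, (K.C.ε μ : ℂ) • (K.g α μ * star (K.g β μ)) := by
  rw [hA, Matrix.mul_apply]
  refine Finset.sum_congr rfl fun μ _ => ?_
  rw [εM, Matrix.mul_diagonal, Matrix.conjTranspose_apply, Algebra.smul_def]
  ring

theorem hA_mul_hiA : K.hA * K.hiA = 1 := by
  calc K.hA * K.hiA = K.g * (K.εM * (K.g.conjTranspose * K.gi.conjTranspose) * K.εM) * K.gi := by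
        simp only [hA, hiA, Matrix.mul_assoc]
    _ = 1 := by rw [gh_mul_gih, Matrix.mul_one, εM_mul_εM, Matrix.mul_one, g_mul_gi]

/-- Since θ kills Z_α and Z_β̄, Cartan's formula expresses θ([Z_α, Z_β̄]) through the derivatives of
z alone. -/
theorem levi_apply (α β : Fin n) (y : V) : levi S.θ K.F.Z y α β = (K.hA α β).1 y := by
  have h := K.C.formD_bracket (K.E (.lo α)) (K.E (.bar β))
  rw [formD_bar, formD_lo, map_zero, map_zero, sub_zero, zero_sub, neg_eq_iff_eq_neg] at h
  have hc : cForm S.θ y.1 (cBracket (K.F.Z α) (fun y => cConj (K.F.Z β y)) y) = _ :=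
    K.C.cForm_cBracket (K.smooth_vec (.lo α)) (K.smooth_vec (.bar β)) y
  have h' : K.C.formD ⁅der K.C.isOpen _ (K.smooth_vec (.lo α)),
    der K.C.isOpen _ (K.smooth_vec (.bar β))⁆ = _ := h
  rw [levi, Matrix.of_apply, hc, h', hA_apply]
  have e : ∀ a : smoothAlg n V, Complex.I * a.1 y = (Complex.I • a).1 y := fun a => rfl
  rw [e]
  refine congrArg (fun a : smoothAlg n V => a.1 y) ?_
  rw [← Finset.sum_neg_distrib, Finset.smul_sum]
  refine Finset.sum_congr rfl fun μ _ => ?_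
  rw [E_lo_star_z, E_lo_z, E_bar_star_z, zero_mul, zero_sub]
  have e2 : Complex.I * ((K.C.ε μ : ℂ) / (2 * Complex.I)) * 2 = K.C.ε μ := by
    field_simp [Complex.I_ne_zero]
  refine (smul_neg_smul_two_mul _ _ _ _).trans ?_
  rw [e2]

theorem h_apply (α β : Fin n) (y : V) : K.F.h α β y = (K.hA α β).1 y := K.levi_apply α β y

theorem levi_eq (y : V) : levi S.θ K.F.Z y = K.hA.map (evalHom y) :=
  Matrix.ext fun α β => K.levi_apply α β y

theorem hinv_apply (α β : Fin n) (y : V) : K.F.hinv α β y = (K.hiA β α).1 y := by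
  have : (levi S.θ K.F.Z y)⁻¹ = K.hiA.map (evalHom y) := by
    refine Matrix.inv_eq_right_inv ?_
    rw [levi_eq, ← Matrix.map_mul, hA_mul_hiA, Matrix.map_one _ (map_zero _) (map_one _)]
  rw [AdmissibleCoframe.hinv, this]
  rfl

/-- The connection matrices of the pseudohermitian connection as smooth functions. -/
def omA (a : Dir n) : Matrix (Fin n) (Fin n) (smoothAlg n V) := K.g.map (K.E a) * K.gi

theorem th_cBracket (α : Fin n) (a b : Dir n) (y : V) :
    K.F.th α y (cBracket (K.F.vec a) (K.F.vec b) y) =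
      (∑ μ, (K.E a (K.E b (K.C.zA μ)) - K.E b (K.E a (K.C.zA μ))) * K.gi μ α).1 y := by
  rw [th_apply, smoothAlg_sum_apply]
  refine Finset.sum_congr rfl fun μ _ => ?_
  rw [cBracket_apply_of_eq K.C.isOpen (K.smooth_vec a) (K.smooth_vec b) (a := K.C.zA μ)
    (fun _ => rfl)]
  rfl

theorem th_cBracket_bar (α β γ : Fin n) (y : V) :
    K.F.th α y (cBracket (K.F.vec (.bar γ)) (K.F.Z β) y) = (K.omA (.bar γ) β α).1 y := by
  refine (K.th_cBracket α (.bar γ) (.lo β) y).trans ?_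
  simp only [E_bar_z, map_zero, sub_zero, E_lo_z]
  rfl

theorem th_cBracket_zero (α β : Fin n) (y : V) :
    K.F.th α y (cBracket (K.F.vec .zero) (K.F.Z β) y) = (K.omA .zero β α).1 y := by
  refine (K.th_cBracket α .zero (.lo β) y).trans ?_
  simp only [E_zero_z, map_zero, sub_zero, E_lo_z]
  rfl

/-- For h = g ε g*, the Leibniz rule gives Z_γ h = (Z_γ g) ε g* + g ε (Z_γ̄ g)*. The last term is h
times the adjoint of the barred connection matrix, so metric compatibility leaves (Z_γ g) g⁻¹. Thus
the connection has the same form (dg) g⁻¹ in all directions. -/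
theorem omA_lo (γ : Fin n) : K.omA (.lo γ) =
    (K.hA.map (K.E (.lo γ)) - K.hA * (K.omA (.bar γ)).conjTranspose) * K.hiA := by
  have e1 : K.εM.map (K.E (.lo γ)) = 0 := by
    ext α β : 1
    rw [Matrix.map_apply, εM, Matrix.diagonal_apply]
    split_ifs <;> simp
  have e2 : K.g.conjTranspose.map (K.E (.lo γ)) = (K.g.map (K.E (.bar γ))).conjTranspose := by
    ext α β : 1
    exact K.E_star (.lo γ) (K.g β α)
  have e3 : K.hA * (K.omA (.bar γ)).conjTranspose =
      K.g * K.εM * (K.g.map (K.E (.bar γ))).conjTranspose := by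
    rw [hA, omA, Matrix.conjTranspose_mul, Matrix.mul_assoc, ← Matrix.mul_assoc K.g.conjTranspose,
      gh_mul_gih, Matrix.one_mul]
  rw [e3]
  nth_rewrite 1 [hA]
  rw [map_derivation_mul, map_derivation_mul, e1, e2, Matrix.mul_zero, zero_add,
    add_sub_cancel_left, hiA, omA]
  symm
  calc K.g.map (K.E (.lo γ)) * K.εM * K.g.conjTranspose * (K.gi.conjTranspose * K.εM * K.gi)
      = K.g.map (K.E (.lo γ)) * (K.εM * (K.g.conjTranspose * K.gi.conjTranspose) * K.εM)
        * K.gi := by simp only [Matrix.mul_assoc]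
    _ = _ := by rw [gh_mul_gih, Matrix.mul_one, εM_mul_εM, Matrix.mul_one]

theorem om_apply (a : Dir n) (β α : Fin n) (y : V) : K.F.om a β α y = (K.omA a β α).1 y := by
  cases a with
  | bar γ => exact K.th_cBracket_bar α β γ y
  | zero => exact K.th_cBracket_zero α β y
  | lo γ =>
    rw [omA_lo, Matrix.mul_apply, smoothAlg_sum_apply]
    simp only [AdmissibleCoframe.om]
    refine Finset.sum_congr rfl fun μ _ => ?_
    rw [hinv_apply, mul_comm]
    refine congrArg₂ (· * ·) ?_ rfl
    have e1 : dir (K.F.Z γ) (K.F.h β μ) y = (K.E (.lo γ) (K.hA β μ)).1 y :=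
      K.E_apply (.lo γ) (fun y => K.h_apply β μ y) y
    rw [e1]
    simp only [th_cBracket_bar, h_apply]
    rw [Matrix.sub_apply, Matrix.mul_apply]
    have e2 : ∀ a b : smoothAlg n V, (a - b).1 y = a.1 y - b.1 y := fun _ _ => rfl
    rw [e2, smoothAlg_sum_apply]
    rfl

/-- Both T and Z_β̄ annihilate the functions z, hence so does their bracket, and `th` reads off only
derivatives of z. -/
theorem Amix_apply (α β : Fin n) (y : V) : K.F.Amix α β y = 0 := by
  rw [AdmissibleCoframe.Amix, th_cBracket]
  simp only [E_bar_z, E_zero_z, map_zero, sub_self, zero_mul, Finset.sum_const_zero]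
  exact neg_zero

theorem Abar_apply (α β : Fin n) (y : V) : K.F.Abar α β y = 0 := by
  simp [AdmissibleCoframe.Abar, Amix_apply]

theorem A_apply (α β : Fin n) (y : V) : K.F.A α β y = 0 := by
  simp [AdmissibleCoframe.A, Abar_apply]

/-- The trace of (dg) g⁻¹ is the logarithmic derivative of det g. -/
theorem omTr_apply (a : Dir n) (y : V) :
    K.F.omTr a y = (K.E a K.g.det * K.detInv).1 y := by
  have h := derivation_det (K.E a) K.g_mul_gi
  have e : K.E a K.g.det * K.detInv = (K.omA a).trace := by
    rw [h, omA, mul_comm, ← mul_assoc, mul_comm K.detInv, det_mul_detInv, one_mul]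
  rw [e, AdmissibleCoframe.omTr, Matrix.trace, smoothAlg_sum_apply]
  exact Finset.sum_congr rfl fun α _ => K.om_apply a α α y

end FlatCoframe
end Coframe

/-- A commutative algebra with the derivations of the Heisenberg group, and a matrix `g`
with unitary determinant that describes a frame. -/
structure HeisAlg (n : ℕ) (R : Type*) [CommRing R] [Algebra ℂ R] [StarRing R] where
  ε : Fin n → ℝ
  e : Dir n → Derivation ℂ R R
  e_star : ∀ a φ, e a (star φ) = star (e a.conj φ)
  lo_lo : ∀ α β φ, e (.lo α) (e (.lo β) φ) = e (.lo β) (e (.lo α) φ)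
  bar_bar : ∀ α β φ, e (.bar α) (e (.bar β) φ) = e (.bar β) (e (.bar α) φ)
  lo_bar : ∀ α β φ, e (.lo α) (e (.bar β) φ) - e (.bar β) (e (.lo α) φ) =
    if α = β then (-Complex.I * ε α) • e .zero φ else 0
  zero_lo : ∀ β φ, e .zero (e (.lo β) φ) = e (.lo β) (e .zero φ)
  zero_bar : ∀ β φ, e .zero (e (.bar β) φ) = e (.bar β) (e .zero φ)
  g : Matrix (Fin n) (Fin n) R
  gi : Matrix (Fin n) (Fin n) R
  g_mul_gi : g * gi = 1
  det_star : g.det * star g.det = 1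

/-! ### The Heisenberg frame and its commutators -/

section Coframe
variable {n : ℕ} {M : Type*} [TopologicalSpace M]
  [ChartedSpace (EuclideanSpace ℝ (Fin (2 * n + 1))) M]
  [IsManifold (𝓡 (2 * n + 1)) ∞ M] {S : PseudoHermitian n M} {U V : Set M}

namespace FlatCoframe
variable (K : FlatCoframe S U V)

/-- The frame of the Heisenberg group. -/
def eV : Dir n → (x : M) → CT n x
  | .lo β => fun y => ∑ α, extZero (K.gi β α).1 y • K.F.Z α y
  | .bar β => fun y => cConj (∑ α, extZero (K.gi β α).1 y • K.F.Z α y)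
  | .zero => K.F.vec .zero

theorem smooth_eV_lo (β : Fin n) : SmoothCVF (K.eV (.lo β)) V :=
  SmoothCVF.sum _ fun α _ => SmoothCVF.smul (K.gi β α).2 (K.smooth_vec (.lo α))

theorem smooth_eV : ∀ a, SmoothCVF (K.eV a) V
  | .lo β => K.smooth_eV_lo β
  | .bar β => (K.smooth_eV_lo β).conj
  | .zero => K.smooth_vec .zero

/-- The derivations of the frame of the Heisenberg group. -/
def e (a : Dir n) : Derivation ℂ (smoothAlg n V) (smoothAlg n V) :=
  der K.C.isOpen (K.eV a) (K.smooth_eV a)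

theorem eV_conj (a : Dir n) (y : M) : K.eV a.conj y = cConj (K.eV a y) := by
  cases a with
  | lo α => rfl
  | bar α => exact (cConj_cConj _).symm
  | zero => exact K.vec_conj .zero y

theorem e_star (a : Dir n) (φ : smoothAlg n V) : K.e a (star φ) = star (K.e a.conj φ) :=
  der_star _ _ _ (fun y => K.eV_conj a y) φ

theorem e_apply (a : Dir n) (φ : smoothAlg n V) (y : V) :
    (K.e a φ).1 y = dirAt (extZero φ.1) y.1 (K.eV a y) := rfl

theorem e_lo (β : Fin n) (φ : smoothAlg n V) :
    K.e (.lo β) φ = ∑ α, K.gi β α * K.E (.lo α) φ := smoothAlg_ext fun y => by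
  rw [e_apply, smoothAlg_sum_apply]
  simp only [eV, map_sum, map_smul, extZero_apply]
  rfl

theorem E_lo_eq (α : Fin n) (φ : smoothAlg n V) :
    K.E (.lo α) φ = ∑ β, K.g α β * K.e (.lo β) φ := by
  simp only [e_lo, Finset.mul_sum, ← mul_assoc]
  rw [Finset.sum_comm]
  simp only [← Finset.sum_mul, ← Matrix.mul_apply, g_mul_gi, Matrix.one_apply]
  simp

theorem E_bar_eq (α : Fin n) (φ : smoothAlg n V) :
    K.E (.bar α) φ = ∑ β, star (K.g α β) * K.e (.bar β) φ := by
  have h := congrArg star (K.E_lo_eq α (star φ))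
  rw [E_star, star_star, star_sum] at h
  refine h.trans (Finset.sum_congr rfl fun β _ => ?_)
  rw [star_mul', e_star, star_star]
  rfl

theorem E_zero_eq (φ : smoothAlg n V) : K.E .zero φ = K.e .zero φ := rfl

theorem e_lo_z (α β : Fin n) : K.e (.lo α) (K.C.zA β) = if α = β then 1 else 0 := by
  rw [e_lo]
  exact congrFun (congrFun K.gi_mul_g α) β

theorem e_lo_star_z (α β : Fin n) : K.e (.lo α) (star (K.C.zA β)) = 0 := by
  rw [e_lo]
  exact Finset.sum_eq_zero fun μ _ => by rw [E_lo_star_z, mul_zero]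

theorem e_bar_z (α β : Fin n) : K.e (.bar α) (K.C.zA β) = 0 := by
  have := K.e_star (.bar α) (star (K.C.zA β))
  rw [star_star] at this
  rw [this]
  exact (congrArg star (K.e_lo_star_z α β)).trans (star_zero _)

theorem e_bar_star_z (α β : Fin n) :
    K.e (.bar α) (star (K.C.zA β)) = if α = β then 1 else 0 := by
  rw [e_star]
  refine (congrArg star (K.e_lo_z α β)).trans ?_
  split_ifs <;> simp

theorem formD_e_lo (α : Fin n) : K.C.formD (K.e (.lo α)) = 0 := smoothAlg_ext fun y => by
  have h := K.C.cForm_apply (K.smooth_eV (.lo α)) y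
  refine h.symm.trans ?_
  simp only [eV]
  rw [cForm_eq_cEvalL, map_sum]
  refine Finset.sum_eq_zero fun μ _ => ?_
  rw [map_smul, ← cForm_eq_cEvalL, ((K.C.mem_T10 y y.2 _).1 (K.T10_vec μ y)).1, smul_zero]

theorem formD_e_bar (α : Fin n) : K.C.formD (K.e (.bar α)) = 0 := smoothAlg_ext fun y => by
  have h := K.C.cForm_apply (K.smooth_eV (.bar α)) y
  have h' := K.C.cForm_apply (K.smooth_eV (.lo α)) y
  refine h.symm.trans ?_
  have h0 : (K.C.formD (der K.C.isOpen _ (K.smooth_eV (.lo α)))).1 y = 0 :=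
    congrArg (fun a : smoothAlg n V => a.1 y) (K.formD_e_lo α)
  rw [h0] at h'
  have := cForm_cConj S.θ y (K.eV (.lo α) y)
  rw [h', star_zero] at this
  exact this

theorem formD_e_zero : K.C.formD (K.e .zero) = 1 := K.formD_zero

/-- A vector is determined by dz, dz̄ and θ. The first two vanish on the bracket, which is therefore
a multiple of T, and θ gives the factor. -/
theorem commutator_of {a b : Dir n} {c : ℂ}
    (hz : ∀ β, K.e a (K.e b (K.C.zA β)) = K.e b (K.e a (K.C.zA β)))
    (hz' : ∀ β, K.e a (K.e b (star (K.C.zA β))) = K.e b (K.e a (star (K.C.zA β))))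
    (hf : K.C.formD ⁅K.e a, K.e b⁆ = algebraMap ℂ _ c) (φ : smoothAlg n V) :
    K.e a (K.e b φ) - K.e b (K.e a φ) = c • K.e .zero φ := by
  refine smoothAlg_ext fun y => ?_
  have hb := cBracket_apply_extZero K.C.isOpen (K.smooth_eV a) (K.smooth_eV b) φ y
  have hv : cBracket (K.eV a) (K.eV b) y = c • K.F.vec .zero y := by
    rw [← sub_eq_zero]
    refine K.C.ext_zero y y.2 _ ?_ ?_ ?_
    · rw [cForm_eq_cEvalL, map_sub, map_smul, ← cForm_eq_cEvalL, ← cForm_eq_cEvalL, cForm_vec,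
        formD_zero, K.C.cForm_cBracket (K.smooth_eV a) (K.smooth_eV b)]
      have := congrArg (fun a : smoothAlg n V => a.1 y) hf
      refine (congrArg₂ (· - ·) this rfl).trans ?_
      change c - c • (1 : ℂ) = 0
      simp
    · intro β
      rw [map_sub, map_smul]
      have h1 := cBracket_apply_of_eq K.C.isOpen (K.smooth_eV a) (K.smooth_eV b)
        (a := K.C.zA β) (f := K.C.z β) (fun _ => rfl) y
      rw [h1]
      have h2 := congrArg (fun a : smoothAlg n V => a.1 y) (hz β)
      refine (congrArg₂ (· - ·) (sub_eq_zero.2 h2) (congrArg (c • ·) (K.dirAt_z_reeb β y))).trans ?_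
      simp
    · intro β
      rw [map_sub, map_smul]
      have h1 := cBracket_apply_of_eq K.C.isOpen (K.smooth_eV a) (K.smooth_eV b)
        (a := star (K.C.zA β)) (f := fun y => star (K.C.z β y)) (fun _ => rfl) y
      rw [h1]
      have h2 := congrArg (fun a : smoothAlg n V => a.1 y) (hz' β)
      refine (congrArg₂ (· - ·) (sub_eq_zero.2 h2)
        (congrArg (c • ·) (K.dirAt_star_z_reeb β y))).trans ?_
      simp
  rw [hv, map_smul] at hb
  exact hb.symm

theorem e_ite (a : Dir n) (P : Prop) [Decidable P] :
    K.e a (if P then 1 else 0 : smoothAlg n V) = 0 := by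
  split_ifs
  · exact Derivation.map_one_eq_zero _
  · exact map_zero _

/-- On this frame θ is constant, so the two derivative terms of Cartan's formula drop out. -/
theorem formD_e_lie (a b : Dir n) (ha : K.C.formD (K.e b) = 0 ∨ K.C.formD (K.e b) = 1)
    (hb : K.C.formD (K.e a) = 0 ∨ K.C.formD (K.e a) = 1) :
    K.C.formD ⁅K.e a, K.e b⁆ = -∑ α, ((K.C.ε α : ℂ) / (2 * Complex.I)) •
      (2 * (K.e a (star (K.C.zA α)) * K.e b (K.C.zA α)
        - K.e b (star (K.C.zA α)) * K.e a (K.C.zA α))) := by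
  have h := K.C.formD_bracket (K.e a) (K.e b)
  have h1 : ∀ (a b : Dir n), (K.C.formD (K.e b) = 0 ∨ K.C.formD (K.e b) = 1) →
      K.e a (K.C.formD (K.e b)) = 0 := by
    rintro a b (h | h) <;> rw [h]
    · exact map_zero _
    · exact Derivation.map_one_eq_zero _
  rw [h1 a b ha, h1 b a hb, sub_zero, zero_sub] at h
  rw [← h, neg_neg]

theorem e_zero_z (β : Fin n) : K.e .zero (K.C.zA β) = 0 := K.E_zero_z β

theorem e_zero_star_z (β : Fin n) : K.e .zero (star (K.C.zA β)) = 0 := K.E_zero_star_z β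

/-- From h = g ε g* one gets |det h| = |det g|² |det ε|. The left side is 1 by the normalization of
the coframe, and |det ε| = 1 because ε² = 1. -/
theorem det_g_star : K.g.det * star K.g.det = 1 := smoothAlg_ext fun y => by
  have h := K.F.normalized y (K.sub y.2)
  rw [levi_eq] at h
  have e1 : (K.hA.map (evalHom y)).det = evalHom y K.hA.det := ((evalHom y).map_det _).symm
  rw [e1, hA, Matrix.det_mul, Matrix.det_mul, Matrix.det_conjTranspose, map_mul, map_mul,
    evalHom_star, norm_mul, norm_mul, norm_star] at h
  have e2 : ‖evalHom y K.εM.det‖ = 1 := by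
    have := congrArg (fun a => ‖evalHom y a‖) (congrArg Matrix.det K.εM_mul_εM)
    simp only [Matrix.det_mul, map_mul, Matrix.det_one, map_one, norm_mul, norm_one] at this
    nlinarith [norm_nonneg (evalHom y K.εM.det)]
  rw [e2, mul_one] at h
  change evalHom y K.g.det * star (evalHom y K.g.det) = 1
  rw [Complex.star_def, Complex.mul_conj, Complex.normSq_eq_norm_sq, pow_two, h, Complex.ofReal_one]

/-- The algebra of smooth functions with the Heisenberg frame. -/
def heis : HeisAlg n (smoothAlg n V) where
  ε := K.C.ε
  e := K.e
  e_star := K.e_star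
  lo_lo α β φ := by
    have := K.commutator_of (a := .lo α) (b := .lo β) (c := 0)
      (fun γ => by rw [e_lo_z, e_lo_z, e_ite, e_ite])
      (fun γ => by rw [e_lo_star_z, e_lo_star_z, map_zero, map_zero])
      (by
        rw [K.formD_e_lie _ _ (.inl (K.formD_e_lo β)) (.inl (K.formD_e_lo α)), map_zero, neg_eq_zero]
        refine Finset.sum_eq_zero fun γ _ => ?_
        rw [e_lo_star_z, e_lo_star_z, zero_mul, zero_mul, sub_zero, mul_zero, smul_zero]) φ
    rwa [zero_smul, sub_eq_zero] at this
  bar_bar α β φ := by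
    have := K.commutator_of (a := .bar α) (b := .bar β) (c := 0)
      (fun γ => by rw [e_bar_z, e_bar_z, map_zero, map_zero])
      (fun γ => by rw [e_bar_star_z, e_bar_star_z, e_ite, e_ite])
      (by
        rw [K.formD_e_lie _ _ (.inl (K.formD_e_bar β)) (.inl (K.formD_e_bar α)), map_zero,
          neg_eq_zero]
        refine Finset.sum_eq_zero fun γ _ => ?_
        rw [e_bar_z, e_bar_z, mul_zero, mul_zero, sub_zero, mul_zero, smul_zero]) φ
    rwa [zero_smul, sub_eq_zero] at this
  lo_bar α β φ := by
    have := K.commutator_of (a := .lo α) (b := .bar β)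
      (c := if α = β then (-Complex.I * K.C.ε α) else 0)
      (fun γ => by rw [e_bar_z, e_lo_z, map_zero, e_ite])
      (fun γ => by rw [e_bar_star_z, e_lo_star_z, map_zero, e_ite])
      (by
        rw [K.formD_e_lie _ _ (.inl (K.formD_e_bar β)) (.inl (K.formD_e_lo α))]
        simp only [e_lo_star_z, e_bar_star_z, e_lo_z, e_bar_z]
        simp only [mul_zero, zero_sub]
        rw [Finset.sum_eq_single α (fun γ _ h => by simp [h.symm]) (by simp)]
        by_cases h : α = β
        · subst h
          simp only [if_true, mul_one]
          rw [Algebra.smul_def, ← map_ofNat (algebraMap ℂ (smoothAlg n V)) 2,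
            ← map_one (algebraMap ℂ (smoothAlg n V)), ← map_neg, ← map_mul, ← map_mul, ← map_neg]
          congr 1
          field_simp
          rw [Complex.I_sq]
          ring
        · simp [h, Ne.symm h]) φ
    rw [this]
    split_ifs <;> simp
  zero_lo β φ := by
    have := K.commutator_of (a := .zero) (b := .lo β) (c := 0)
      (fun γ => by rw [e_zero_z, e_lo_z, map_zero, e_ite])
      (fun γ => by rw [e_zero_star_z, e_lo_star_z, map_zero, map_zero])
      (by
        rw [K.formD_e_lie _ _ (.inl (K.formD_e_lo β)) (.inr K.formD_e_zero), map_zero, neg_eq_zero]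
        refine Finset.sum_eq_zero fun γ _ => ?_
        rw [e_zero_star_z, e_zero_z, zero_mul, mul_zero, sub_zero, mul_zero, smul_zero]) φ
    rwa [zero_smul, sub_eq_zero] at this
  zero_bar β φ := by
    have := K.commutator_of (a := .zero) (b := .bar β) (c := 0)
      (fun γ => by rw [e_zero_z, e_bar_z, map_zero, map_zero])
      (fun γ => by rw [e_zero_star_z, e_bar_star_z, map_zero, e_ite])
      (by
        rw [K.formD_e_lie _ _ (.inl (K.formD_e_bar β)) (.inr K.formD_e_zero), map_zero, neg_eq_zero]
        refine Finset.sum_eq_zero fun γ _ => ?_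
        rw [e_zero_star_z, e_zero_z, zero_mul, mul_zero, sub_zero, mul_zero, smul_zero]) φ
    rwa [zero_smul, sub_eq_zero] at this
  g := K.g
  gi := K.gi
  g_mul_gi := K.g_mul_gi
  det_star := K.det_g_star

end FlatCoframe
end Coframe

/-! ### Vanishing of the curvature tensors -/

section Coframe
variable {n : ℕ} {M : Type*} [TopologicalSpace M]
  [ChartedSpace (EuclideanSpace ℝ (Fin (2 * n + 1))) M]
  [IsManifold (𝓡 (2 * n + 1)) ∞ M] {S : PseudoHermitian n M} {U V : Set M}

namespace FlatCoframe
variable (K : FlatCoframe S U V)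

/-- The trace of the connection forms. -/
def omTrA (a : Dir n) : smoothAlg n V := K.E a K.g.det * star K.g.det

theorem detInv_eq : K.detInv = star K.g.det :=
  (left_inv_eq_right_inv (by rw [mul_comm]; exact K.det_mul_detInv) K.det_g_star)

theorem omTr_eq (a : Dir n) (y : V) : K.F.omTr a y = (K.omTrA a).1 y := by
  rw [omTr_apply, detInv_eq]; rfl

theorem E_star_det (a : Dir n) :
    K.E a (star K.g.det) * K.g.det = -K.omTrA a := by
  have h := congrArg (K.E a) K.det_g_star
  rw [Derivation.leibniz, Derivation.map_one_eq_zero, smul_eq_mul, smul_eq_mul] at h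
  rw [omTrA]
  linear_combination h

theorem star_omTrA (a : Dir n) : star (K.omTrA a.conj) = -K.omTrA a := by
  rw [omTrA, star_mul', star_star, ← E_star, E_star_det, omTrA]

/-- As det g is unimodular, its logarithmic derivative is purely imaginary as a form; the
contributions of w and w' therefore enter with opposite signs. In particular, weight (−1,−1) has no
connection term. -/
theorem wt_eq (w w' : ℂ) (a : Dir n) (y : V) :
    K.F.wt w w' a y = (w - w') / (n + 2) * (K.omTrA a).1 y := by
  have h : star ((K.omTrA a.conj).1 y) = -(K.omTrA a).1 y :=
    congrArg (fun a : smoothAlg n V => a.1 y) (K.star_omTrA a)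
  rw [AdmissibleCoframe.wt, omTr_eq, omTr_eq, h]
  ring

theorem omTrForm_eq (y : V) (v : CT n y.1) :
    K.F.omTrForm y v = dirAt (extZero K.g.det.1) y.1 v * (star K.g.det).1 y := by
  have h : ∀ a, K.F.omTr a y =
      dirAt (extZero K.g.det.1) y.1 (K.F.vec a y) * (star K.g.det).1 y := fun a => K.omTr_eq a y
  conv_rhs => rw [K.vec_decomp_covec y v]
  simp only [AdmissibleCoframe.omTrForm, h, map_add, map_sum, map_smul, smul_eq_mul, add_mul,
    Finset.sum_mul, mul_assoc]

/-- The form ω_γ{}^γ is the logarithmic differential of det g, hence closed. Every other curvature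
quantity is built from Ric and the torsion. -/
theorem Ric_eq (α β : Fin n) (y : V) : K.F.Ric α β y = 0 := by
  rw [AdmissibleCoframe.Ric, K.E_apply (.lo α) (fun y => K.omTr_eq (.bar β) y),
    K.E_apply (.bar β) (fun y => K.omTr_eq (.lo α) y), omTrForm_eq]
  have h := cBracket_apply_extZero K.C.isOpen (K.smooth_vec (.lo α)) (K.smooth_vec (.bar β))
    K.g.det y
  rw [h]
  have key : K.E (.lo α) (K.omTrA (.bar β)) - K.E (.bar β) (K.omTrA (.lo α)) -
      (K.E (.lo α) (K.E (.bar β) K.g.det) - K.E (.bar β) (K.E (.lo α) K.g.det)) * star K.g.det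
      = 0 := by
    have h1 : ∀ a, K.E a (star K.g.det) = -K.omTrA a * star K.g.det := fun a => by
      rw [← E_star_det, mul_assoc, K.det_g_star, mul_one]
    simp only [omTrA, Derivation.leibniz, smul_eq_mul, h1]
    ring
  exact congrArg (fun a : smoothAlg n V => a.1 y) key

theorem dir_zero {a : Dir n} {f : M → ℂ} (h : ∀ y : V, f y = 0) (y : V) :
    dir (K.F.vec a) f y = 0 := by
  rw [K.E_apply a (φ := 0) h, map_zero]
  rfl

theorem Scal_eq (y : V) : K.F.Scal y = 0 := by simp [AdmissibleCoframe.Scal, Ric_eq]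

theorem P_eq (α β : Fin n) (y : V) : K.F.P α β y = 0 := by
  simp [AdmissibleCoframe.P, Ric_eq, Scal_eq]

theorem trP_eq (y : V) : K.F.trP y = 0 := by simp [AdmissibleCoframe.trP, P_eq]

theorem Pmix_eq (α β : Fin n) (y : V) : K.F.Pmix α β y = 0 := by
  simp [AdmissibleCoframe.Pmix, P_eq]

theorem AbarUp_eq (α β : Fin n) (y : V) : K.F.AbarUp α β y = 0 := by
  simp [AdmissibleCoframe.AbarUp, Abar_apply]

theorem dA_eq (γ α β : Fin n) (y : V) : K.F.dA γ α β y = 0 := by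
  simp [AdmissibleCoframe.dA, A_apply, K.dir_zero (K.A_apply α β)]

theorem Tlo_eq (α : Fin n) (y : V) : K.F.Tlo α y = 0 := by
  simp [AdmissibleCoframe.Tlo, dA_eq, trP_eq, K.dir_zero K.trP_eq]

theorem Tbar_eq (α : Fin n) (y : V) : K.F.Tbar α y = 0 := by
  simp [AdmissibleCoframe.Tbar, Tlo_eq]

theorem Tup_eq (α : Fin n) (y : V) : K.F.Tup α y = 0 := by
  simp [AdmissibleCoframe.Tup, Tbar_eq]

theorem divT_eq (y : V) : K.F.divT y = 0 := by
  simp [AdmissibleCoframe.divT, Tlo_eq, K.dir_zero (K.Tlo_eq _)]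

theorem Sc_eq (y : V) : K.F.Sc y = 0 := by
  simp [AdmissibleCoframe.Sc, divT_eq, P_eq, A_apply]

end FlatCoframe
end Coframe

/-- Tractor indices as an iterated option type. -/
def tIdxEquiv (n : ℕ) : TIdx n ≃ Option (Option (Fin n)) where
  toFun
    | .top => none
    | .bot => some none
    | .mid α => some (some α)
  invFun
    | none => .top
    | some none => .bot
    | some (some α) => .mid α
  left_inv a := by cases a <;> rfl
  right_inv a := by rcases a with _ | _ | _ <;> rfl

instance (n : ℕ) : Fintype (TIdx n) := Fintype.ofEquiv _ (tIdxEquiv n).symm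

instance (n : ℕ) : DecidableEq (TIdx n) := (tIdxEquiv n).decidableEq

theorem sum_tIdx {n : ℕ} {A : Type*} [AddCommMonoid A] (F : TIdx n → A) :
    ∑ B, F B = F .top + ∑ α, F (.mid α) + F .bot := by
  rw [← (tIdxEquiv n).symm.sum_comp, Fintype.sum_option, Fintype.sum_option, add_assoc]
  congr 1
  exact add_comm _ _

theorem tSum_eq {n : ℕ} (F : TIdx n → ℂ) : tSum F = ∑ B, F B := (sum_tIdx F).symm

/-- Structure constants of the Heisenberg algebra: `[e_a, e_b] = heisConst ε a b • e_0`. -/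
def heisConst {n : ℕ} (ε : Fin n → ℝ) : Dir n → Dir n → ℂ
  | .lo α, .bar β => if α = β then -Complex.I * ε α else 0
  | .bar α, .lo β => if α = β then Complex.I * ε α else 0
  | _, _ => 0

theorem star_heisConst {n : ℕ} (ε : Fin n → ℝ) (a b : Dir n) :
    star (heisConst ε a.conj b.conj) = heisConst ε a b := by
  cases a <;> cases b <;> simp only [heisConst, Dir.conj, star_zero] <;> split_ifs <;> simp

theorem heisConst_conj {n : ℕ} (ε : Fin n → ℝ) (a b : Dir n) :
    heisConst ε a.conj b.conj = -heisConst ε a b := by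
  cases a <;> cases b <;> simp only [heisConst, Dir.conj, neg_zero] <;> split_ifs <;> simp

/-- A representation of the Heisenberg algebra. -/
def IsHeis {n : ℕ} (ε : Fin n → ℝ) {W : Type*} [AddCommGroup W] [Module ℂ W]
    (X : Dir n → Module.End ℂ W) : Prop :=
  ∀ a b v, X a (X b v) - X b (X a v) = heisConst ε a b • X .zero v

instance (n : ℕ) : DecidableEq (Dir n) := Classical.decEq _

/-- The conjugate representation. -/
def swapRep {n : ℕ} {W : Type*} [AddCommGroup W] [Module ℂ W]
    (X : Dir n → Module.End ℂ W) : Dir n → Module.End ℂ W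
  | .lo α => X (.bar α)
  | .bar α => X (.lo α)
  | .zero => -X .zero

/-! ### Algebra in representations of the Heisenberg algebra -/

section Model

variable {n : ℕ} {ε : Fin n → ℝ} {W : Type*} [AddCommGroup W] [Module ℂ W]
  {X : Dir n → Module.End ℂ W}

theorem swapRep_swapRep : swapRep (swapRep X) = X := by
  funext a
  cases a <;> simp [swapRep]

/-- Exchanging X_α with X_ᾱ reverses the sign of their bracket, and the sign of X_0 in `swapRep`
restores it. Statements about the conjugate operators thereby become instances of those about □ with
the same ε. -/
theorem IsHeis.swap (h : IsHeis ε X) : IsHeis ε (swapRep X) := by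
  intro a b v
  have e : ∀ a, swapRep X a = (if a = .zero then -1 else 1 : ℂ) • X a.conj := by
    rintro (_ | _ | _) <;> simp [swapRep, Dir.conj]
  have e0 : swapRep X .zero v = -X .zero v := rfl
  rw [e0, e, e]
  simp only [LinearMap.smul_apply, map_smul]
  rw [smul_comm, ← smul_sub, ← smul_sub, h, heisConst_conj]
  cases a <;> cases b <;> simp [heisConst]

/-- `∇^α ∇_α`. -/
def lapOp (ε : Fin n → ℝ) (X : Dir n → Module.End ℂ W) (v : W) : W :=
  ∑ α, (ε α : ℂ) • X (.bar α) (X (.lo α) v)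

/-- The operator `□` of weight `w` in a representation of the Heisenberg algebra. -/
def boxOp (ε : Fin n → ℝ) (X : Dir n → Module.End ℂ W) (w : ℂ) (v : W) : W :=
  lapOp ε X v + (Complex.I * w) • X .zero v

/-- Powers of `□`. -/
def boxOpPow (ε : Fin n → ℝ) (X : Dir n → Module.End ℂ W) : ℕ → ℂ → W → W
  | 0, _, v => v
  | k + 1, w, v => boxOpPow ε X k (w - 1) (boxOp ε X w v)

theorem IsHeis.zero_comm (h : IsHeis ε X) (a : Dir n) (v : W) :
    X .zero (X a v) = X a (X .zero v) := by
  rw [← sub_eq_zero, h]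
  cases a <;> simp [heisConst]

theorem IsHeis.lo_comm (h : IsHeis ε X) (α β : Fin n) (v : W) :
    X (.lo α) (X (.lo β) v) = X (.lo β) (X (.lo α) v) := by
  rw [← sub_eq_zero, h]
  simp [heisConst]

theorem IsHeis.bar_lo (h : IsHeis ε X) (β α : Fin n) (v : W) :
    X (.bar β) (X (.lo α) v) = X (.lo α) (X (.bar β) v)
      + (if β = α then Complex.I * ε β else 0 : ℂ) • X .zero v := by
  rw [← sub_eq_iff_eq_add', h]
  rfl

/-- Moving X_α past Δ produces i X_α X_0, which is exactly the effect of raising the weight by one.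
-/
theorem boxOp_lo (hε : ∀ α, ε α * ε α = 1) (h : IsHeis ε X) (w : ℂ) (α : Fin n) (v : W) :
    boxOp ε X (w - 1) (X (.lo α) v) = X (.lo α) (boxOp ε X w v) := by
  have hε' : (ε α : ℂ) * ε α = 1 := by rw [← Complex.ofReal_mul, hε, Complex.ofReal_one]
  have h1 : lapOp ε X (X (.lo α) v) = X (.lo α) (lapOp ε X v)
      + Complex.I • X (.lo α) (X .zero v) := by
    simp only [lapOp, map_sum, map_smul]
    have : ∀ β, (ε β : ℂ) • X (.bar β) (X (.lo β) (X (.lo α) v)) =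
        (ε β : ℂ) • X (.lo α) (X (.bar β) (X (.lo β) v)) +
          (if β = α then Complex.I • X (.lo α) (X .zero v) else 0) := by
      intro β
      rw [h.lo_comm β α, h.bar_lo, smul_add, h.zero_comm]
      congr 1
      split_ifs with hβ
      · subst hβ
        rw [smul_smul, mul_left_comm, hε', mul_one]
      · simp
    rw [Finset.sum_congr rfl fun β _ => this β, Finset.sum_add_distrib]
    simp
  rw [boxOp, boxOp, h1, map_add, map_smul, h.zero_comm]
  module

theorem lapOp_zero (h : IsHeis ε X) (v : W) :
    lapOp ε X (X .zero v) = X .zero (lapOp ε X v) := by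
  simp only [lapOp, map_sum, map_smul, h.zero_comm]

theorem boxOp_add_smul (w : ℂ) (u v : W) (c : ℂ) :
    boxOp ε X w (u + c • v) = boxOp ε X w u + c • boxOp ε X w v := by
  have : ∀ α, (ε α : ℂ) • (X (.bar α) (X (.lo α) u) + c • X (.bar α) (X (.lo α) v)) =
      (ε α : ℂ) • X (.bar α) (X (.lo α) u) + c • (ε α : ℂ) • X (.bar α) (X (.lo α) v) :=
    fun α => by module
  simp only [boxOp, lapOp, map_add, map_smul, this, Finset.sum_add_distrib, ← Finset.smul_sum]
  module

/-- Operators of different weights differ by a multiple of X_0, which is central. -/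
theorem boxOp_comm (h : IsHeis ε X) (c d : ℂ) (v : W) :
    boxOp ε X c (boxOp ε X d v) = boxOp ε X d (boxOp ε X c v) := by
  have e : ∀ c v, boxOp ε X c v = boxOp ε X 0 v + (Complex.I * c) • X .zero v := fun c v => by
    simp [boxOp]
  have h0 : boxOp ε X 0 (X .zero v) = X .zero (boxOp ε X 0 v) := by
    simp [boxOp, lapOp_zero h]
  rw [e d v, e c v, boxOp_add_smul, boxOp_add_smul, e c (boxOp ε X 0 v), e d (boxOp ε X 0 v),
    e c (X .zero v), e d (X .zero v), h0]
  module

/-- Each of the n pairs contributes i X_0 when X_ᾱ X_α is reordered, the signs cancelling by ε_α² =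
1. -/
theorem boxOp_swap (hε : ∀ α, ε α * ε α = 1) (h : IsHeis ε X) (w' : ℂ) (v : W) :
    boxOp ε (swapRep X) w' v = boxOp ε X (-(n + w')) v := by
  have h1 : lapOp ε (swapRep X) v = lapOp ε X v - (n * Complex.I : ℂ) • X .zero v := by
    have h2 : ∀ α, (ε α : ℂ) • X (.bar α) (X (.lo α) v) =
        (ε α : ℂ) • X (.lo α) (X (.bar α) v) + Complex.I • X .zero v := fun α => by
      have hε' : (ε α : ℂ) * ε α = 1 := by rw [← Complex.ofReal_mul, hε, Complex.ofReal_one]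
      rw [h.bar_lo, smul_add, if_pos rfl, smul_smul, mul_left_comm, hε', mul_one]
    simp only [lapOp, swapRep, h2, Finset.sum_add_distrib]
    simp only [Finset.sum_const, Finset.card_univ, Fintype.card_fin]
    rw [← Nat.cast_smul_eq_nsmul ℂ]
    module
  rw [boxOp, boxOp, h1]
  simp only [swapRep, LinearMap.neg_apply]
  module

/-- The definition splits off the factor applied first; here the factor applied last is split off.
-/
theorem boxOpPow_succ (k : ℕ) : ∀ (w : ℂ) (v : W),
    boxOpPow ε X (k + 1) w v = boxOp ε X (w - k) (boxOpPow ε X k w v) := by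
  induction k with
  | zero => intro w v; simp [boxOpPow]
  | succ k ih =>
    intro w v
    rw [boxOpPow, ih]
    push_cast
    rw [boxOpPow]
    congr 1
    ring

theorem boxOpPow_boxOp (h : IsHeis ε X) (k : ℕ) : ∀ (w c : ℂ) (v : W),
    boxOpPow ε X k w (boxOp ε X c v) = boxOp ε X c (boxOpPow ε X k w v) := by
  induction k with
  | zero => intro w c v; rfl
  | succ k ih => intro w c v; rw [boxOpPow, boxOp_comm h, ih]; rfl

/-- The factors on the left have weights w, w−1, …, w−k+1. Those on the right become −(n+w'),
−(n+w')+1, …, which under the weight condition is the same list reversed. -/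
theorem boxOpPow_swap (hε : ∀ α, ε α * ε α = 1) (h : IsHeis ε X) (k : ℕ) :
    ∀ (w w' : ℂ) (_ : (n : ℂ) + w + w' + 1 = k) (v : W),
      boxOpPow ε X k w v = boxOpPow ε (swapRep X) k w' v := by
  induction k with
  | zero => intro w w' _ v; rfl
  | succ k ih =>
    intro w w' hk v
    -- The factor applied first on the conjugate side is the one applied last on the other side.
    have e : -((n : ℂ) + w') = w - k := by push_cast at hk; linear_combination -hk
    rw [boxOpPow_succ, boxOpPow, boxOp_swap hε h, e, ← boxOpPow_boxOp h,
      ih w (w' - 1) (by push_cast at hk; linear_combination hk)]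

/-- The tensor product of a representation with constant matrices acting on a tractor index. -/
def tensRep (X : Dir n → Module.End ℂ W) (G : Dir n → Matrix (TIdx n) (TIdx n) ℂ) (a : Dir n) :
    Module.End ℂ (TIdx n → W) where
  toFun v A := X a (v A) + ∑ B, G a A B • v B
  map_add' u v := by
    funext A
    simp only [Pi.add_apply, map_add, smul_add, Finset.sum_add_distrib]
    abel
  map_smul' c v := by
    funext A
    simp only [Pi.smul_apply, map_smul, RingHom.id_apply, smul_add, Finset.smul_sum]
    congr 1
    exact Finset.sum_congr rfl fun B _ => smul_comm _ _ _

theorem tensRep_apply (X : Dir n → Module.End ℂ W) (G : Dir n → Matrix (TIdx n) (TIdx n) ℂ)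
    (a : Dir n) (v : TIdx n → W) (A : TIdx n) :
    tensRep X G a v A = X a (v A) + ∑ B, G a A B • v B := rfl

/-- Constant matrices that represent the Heisenberg algebra. -/
def IsHeisMat (ε : Fin n → ℝ) (G : Dir n → Matrix (TIdx n) (TIdx n) ℂ) : Prop :=
  ∀ a b, G a * G b - G b * G a = heisConst ε a b • G .zero

/-- For X ⊗ 1 + 1 ⊗ G the mixed terms cancel in a commutator, since the matrices are constant. -/
theorem IsHeis.tens (h : IsHeis ε X) {G : Dir n → Matrix (TIdx n) (TIdx n) ℂ}
    (hG : IsHeisMat ε G) : IsHeis ε (tensRep X G) := by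
  intro a b v
  funext A
  have e : ∀ a b, ∑ B, G a A B • ∑ C, G b B C • v C = ∑ C, (G a * G b) A C • v C := by
    intro a b
    simp only [Finset.smul_sum, smul_smul]
    rw [Finset.sum_comm]
    simp only [← Finset.sum_smul, Matrix.mul_apply]
  have hG' : ∀ C, (G a * G b) A C - (G b * G a) A C = heisConst ε a b * G .zero A C := fun C =>
    congrFun (congrFun (hG a b) A) C
  simp only [Pi.sub_apply, Pi.smul_apply, tensRep_apply, map_add, map_sum, map_smul, smul_add,
    Finset.sum_add_distrib, e]
  rw [← h]
  simp only [Finset.smul_sum, smul_smul, ← hG', sub_smul, Finset.sum_sub_distrib]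
  abel

/-- The matrices of the flat tractor connection. -/
def trMat (ε : Fin n → ℝ) : Dir n → Matrix (TIdx n) (TIdx n) ℂ
  | .lo β => Matrix.of fun
    | .top, .mid α => if α = β then -1 else 0
    | _, _ => 0
  | .bar β => Matrix.of fun
    | .mid α, .bot => if α = β then (ε β : ℂ) else 0
    | _, _ => 0
  | .zero => Matrix.of fun
    | .top, .bot => -Complex.I
    | _, _ => 0

/-- This is the flatness of the tractor connection. The only nonzero products are those carrying the
bottom slot through the middle to the top, with coefficient −ε_α = (−i ε_α)(−i). -/
theorem isHeisMat_trMat (ε : Fin n → ℝ) : IsHeisMat ε (trMat ε) := by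
  intro a b
  ext A C
  simp only [Matrix.sub_apply, Matrix.mul_apply, Matrix.smul_apply, sum_tIdx]
  cases a <;> cases b <;> cases A <;> cases C <;> simp [trMat, heisConst] <;>
    (split_ifs <;> simp_all [mul_right_comm])

/-- The tractor `D` operator on a representation of the Heisenberg algebra. -/
def dOp (ε : Fin n → ℝ) (X : Dir n → Module.End ℂ W) (m w : ℂ) (v : W) : TIdx n → W
  | .top => (m * w) • v
  | .mid α => m • X (.lo α) v
  | .bot => -boxOp ε X w v

/-- Multiplication by `Z`. -/
def zOp (n : ℕ) (v : W) : TIdx n → W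
  | .bot => v
  | _ => 0

theorem tensRep_lo_top (β : Fin n) (v : TIdx n → W) :
    tensRep X (trMat ε) (.lo β) v .top = X (.lo β) (v .top) - v (.mid β) := by
  simp [tensRep_apply, sum_tIdx, trMat, sub_eq_add_neg]

theorem tensRep_lo_mid (β α : Fin n) (v : TIdx n → W) :
    tensRep X (trMat ε) (.lo β) v (.mid α) = X (.lo β) (v (.mid α)) := by
  simp [tensRep_apply, sum_tIdx, trMat]

theorem tensRep_lo_bot (β : Fin n) (v : TIdx n → W) :
    tensRep X (trMat ε) (.lo β) v .bot = X (.lo β) (v .bot) := by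
  simp [tensRep_apply, sum_tIdx, trMat]

theorem tensRep_bar_top (β : Fin n) (v : TIdx n → W) :
    tensRep X (trMat ε) (.bar β) v .top = X (.bar β) (v .top) := by
  simp [tensRep_apply, sum_tIdx, trMat]

theorem tensRep_bar_mid (β α : Fin n) (v : TIdx n → W) :
    tensRep X (trMat ε) (.bar β) v (.mid α) =
      X (.bar β) (v (.mid α)) + (if α = β then (ε β : ℂ) else 0) • v .bot := by
  simp [tensRep_apply, sum_tIdx, trMat]

theorem tensRep_bar_bot (β : Fin n) (v : TIdx n → W) :
    tensRep X (trMat ε) (.bar β) v .bot = X (.bar β) (v .bot) := by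
  simp [tensRep_apply, sum_tIdx, trMat]

theorem tensRep_zero_top (v : TIdx n → W) :
    tensRep X (trMat ε) .zero v .top = X .zero (v .top) - Complex.I • v .bot := by
  simp [tensRep_apply, sum_tIdx, trMat, sub_eq_add_neg]

theorem tensRep_zero_mid (α : Fin n) (v : TIdx n → W) :
    tensRep X (trMat ε) .zero v (.mid α) = X .zero (v (.mid α)) := by
  simp [tensRep_apply, sum_tIdx, trMat]

theorem tensRep_zero_bot (v : TIdx n → W) :
    tensRep X (trMat ε) .zero v .bot = X .zero (v .bot) := by
  simp [tensRep_apply, sum_tIdx, trMat]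

/-- The term `w • v .bot` comes from the entry −i of the matrix of X_0, multiplied by i w. -/
theorem boxOp_tens_top (w : ℂ) (v : TIdx n → W) : boxOp ε (tensRep X (trMat ε)) w v .top =
    boxOp ε X w (v .top) - ∑ α, (ε α : ℂ) • X (.bar α) (v (.mid α)) + w • v .bot := by
  have hI : (Complex.I * w) * Complex.I = -w := by
    rw [mul_right_comm, Complex.I_mul_I, neg_one_mul]
  simp only [boxOp, lapOp, Pi.add_apply, Finset.sum_apply, Pi.smul_apply, tensRep_bar_top,
    tensRep_lo_top, tensRep_zero_top, map_sub, smul_sub, Finset.sum_sub_distrib, smul_smul, hI]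
  module

theorem boxOp_tens_mid (hε : ∀ α, ε α * ε α = 1) (w : ℂ) (v : TIdx n → W) (α : Fin n) :
    boxOp ε (tensRep X (trMat ε)) w v (.mid α) =
      boxOp ε X w (v (.mid α)) + X (.lo α) (v .bot) := by
  have hε' : (ε α : ℂ) * ε α = 1 := by rw [← Complex.ofReal_mul, hε, Complex.ofReal_one]
  simp only [boxOp, lapOp, Pi.add_apply, Finset.sum_apply, Pi.smul_apply, tensRep_bar_mid,
    tensRep_lo_mid, tensRep_lo_bot, tensRep_zero_mid, smul_add, Finset.sum_add_distrib, smul_smul,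
    smul_ite, smul_zero, ite_smul, zero_smul, Finset.sum_ite_eq, Finset.mem_univ, if_true, hε',
    one_smul]
  abel

theorem boxOp_tens_bot (w : ℂ) (v : TIdx n → W) :
    boxOp ε (tensRep X (trMat ε)) w v .bot = boxOp ε X w (v .bot) := by
  simp only [boxOp, lapOp, Pi.add_apply, Finset.sum_apply, Pi.smul_apply, tensRep_bar_bot,
    tensRep_lo_bot, tensRep_zero_bot]

theorem boxOp_smul (w c : ℂ) (v : W) : boxOp ε X w (c • v) = c • boxOp ε X w v := by
  have := boxOp_add_smul (ε := ε) (X := X) w 0 v c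
  simpa [boxOp, lapOp] using this

/-- The parameter `m` is kept independent of `w`, because it drops by one at each step and the
argument ends at m = 0. The top slot rests on w □_{w−1} − Δ = (w−1) □_w. In the middle slot, □_{w−1}
X_α = X_α □_w gives m copies of X_α □_w, and the bottom slot of D removes one. -/
theorem boxOp_dOp (hε : ∀ α, ε α * ε α = 1) (h : IsHeis ε X) (m w : ℂ) (v : W) :
    boxOp ε (tensRep X (trMat ε)) (w - 1) (dOp ε X m w v) =
      dOp ε X (m - 1) (w - 1) (boxOp ε X w v) := by
  funext A
  cases A with
  | top =>
    rw [boxOp_tens_top]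
    simp only [dOp, boxOp_smul, map_smul]
    have : ∑ α, (ε α : ℂ) • m • X (.bar α) (X (.lo α) v) = m • lapOp ε X v := by
      simp only [lapOp, Finset.smul_sum]
      exact Finset.sum_congr rfl fun α _ => smul_comm _ _ _
    rw [this, boxOp, boxOp]
    module
  | mid α =>
    rw [boxOp_tens_mid hε]
    simp only [dOp, boxOp_smul, map_neg, boxOp_lo hε h]
    module
  | bot =>
    rw [boxOp_tens_bot]
    simp only [dOp]
    rw [← neg_one_smul ℂ (boxOp ε X w v), boxOp_smul, neg_one_smul]

theorem boxOpPow_dOp (hε : ∀ α, ε α * ε α = 1) (h : IsHeis ε X) (j : ℕ) : ∀ (m w : ℂ) (v : W),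
    boxOpPow ε (tensRep X (trMat ε)) j (w - 1) (dOp ε X m w v) =
      dOp ε X (m - j) (w - j) (boxOpPow ε X j w v) := by
  induction j with
  | zero => intro m w v; simp [boxOpPow]
  | succ j ih =>
    intro m w v
    rw [boxOpPow, boxOp_dOp hε h, ih, boxOpPow]
    push_cast
    congr 1 <;> ring

/-- The top and middle slots carry the factor m, so only the bottom slot survives. -/
theorem dOp_zero (w : ℂ) (v : W) : dOp ε X 0 w v = -zOp n (boxOp ε X w v) := by
  funext A
  cases A <;> simp [dOp, zOp]

theorem boxOpPow_dOp_self (hε : ∀ α, ε α * ε α = 1) (h : IsHeis ε X) (m : ℕ) (w : ℂ) (v : W) :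
    boxOpPow ε (tensRep X (trMat ε)) m (w - 1) (dOp ε X m w v) =
      -zOp n (boxOpPow ε X (m + 1) w v) := by
  rw [boxOpPow_dOp hε h, sub_self, dOp_zero, ← boxOpPow_succ]

/-- Each pair X_α X_ᾱ moves the bottom slot to the top and contributes −1, which gives −n; the term
with X_0 contributes −w'. -/
theorem boxOp_swap_zOp (hε : ∀ α, ε α * ε α = 1) (w' : ℂ) (v : W) :
    boxOp ε (swapRep (tensRep X (trMat ε))) w' (zOp n v) .top = (-(n + w')) • v := by
  have hε' : ∀ α, (ε α : ℂ) * ε α = 1 := fun α => by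
    rw [← Complex.ofReal_mul, hε, Complex.ofReal_one]
  have hI : (Complex.I * w') * Complex.I = -w' := by
    rw [mul_right_comm, Complex.I_mul_I, neg_one_mul]
  simp only [boxOp, lapOp, Pi.add_apply, Finset.sum_apply, Pi.smul_apply, swapRep,
    LinearMap.neg_apply, Pi.neg_apply, tensRep_lo_top, tensRep_bar_top, tensRep_bar_mid,
    tensRep_zero_top, zOp, map_zero, zero_sub, zero_add, if_true, smul_neg, smul_smul, hε',
    one_smul, neg_neg, hI, Finset.sum_neg_distrib, Finset.sum_const, Finset.card_univ,
    Fintype.card_fin]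
  rw [← Nat.cast_smul_eq_nsmul ℂ]
  module

end Model

/-! ### Trivializing the tractor connection by a gauge -/

namespace HeisAlg
variable {n : ℕ} {R : Type*} [CommRing R] [Algebra ℂ R] [StarRing R] [StarModule ℂ R]
  (H : HeisAlg n R)

theorem e_comm (a b : Dir n) (φ : R) :
    H.e a (H.e b φ) - H.e b (H.e a φ) = heisConst H.ε a b • H.e .zero φ := by
  cases a <;> cases b <;> simp only [heisConst, zero_smul, sub_eq_zero]
  · exact H.lo_lo _ _ _
  · rw [H.lo_bar]; split_ifs <;> simp
  · exact (H.zero_lo _ _).symm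
  · rw [← neg_sub, H.lo_bar]
    split_ifs <;> simp_all
  · exact H.bar_bar _ _ _
  · exact (H.zero_bar _ _).symm
  · exact H.zero_lo _ _
  · exact H.zero_bar _ _

theorem gi_mul_g : H.gi * H.g = 1 := mul_eq_one_comm.1 H.g_mul_gi

/-- The connection coefficient of the densities of weight one. -/
def c (a : Dir n) : R := (1 / (n + 2) : ℂ) • (H.e a H.g.det * star H.g.det)

theorem e_star_det (a : Dir n) :
    H.e a (star H.g.det) = -(H.e a H.g.det * star H.g.det) * star H.g.det := by
  have h := congrArg (H.e a) H.det_star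
  rw [Derivation.leibniz, Derivation.map_one_eq_zero, smul_eq_mul, smul_eq_mul] at h
  linear_combination star H.g.det * h - H.e a (star H.g.det) * H.det_star

theorem star_c (a : Dir n) : star (H.c a.conj) = -H.c a := by
  rw [c, c, star_smul, star_mul', star_star, ← H.e_star, e_star_det]
  have : star (1 / (n + 2) : ℂ) = 1 / (n + 2) := by simp
  rw [this, ← smul_neg]
  congr 1
  linear_combination (-(H.e a H.g.det) * star H.g.det) * H.det_star

/-- The coefficients `c` are a multiple of the logarithmic derivative of det g, which is closed;
only the bracket term remains. -/
theorem e_c (a b : Dir n) :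
    H.e a (H.c b) - H.e b (H.c a) = heisConst H.ε a b • H.c .zero := by
  simp only [c, Derivation.map_smul, Derivation.leibniz, smul_eq_mul, e_star_det]
  rw [← smul_sub, smul_comm]
  congr 1
  rw [← smul_mul_assoc, ← e_comm]
  ring

/-- The action of a matrix on the middle slot of a tractor. -/
def trDiag (m : Matrix (Fin n) (Fin n) R) : Matrix (TIdx n) (TIdx n) R
  | .top, .top => 1
  | .mid α, .mid β => m α β
  | .bot, .bot => 1
  | _, _ => 0

theorem trDiag_mul (m m' : Matrix (Fin n) (Fin n) R) :
    trDiag m * trDiag m' = trDiag (m * m') := by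
  ext A B
  rw [Matrix.mul_apply, sum_tIdx]
  cases A <;> cases B <;> simp [trDiag, Matrix.mul_apply]

theorem trDiag_one : trDiag (1 : Matrix (Fin n) (Fin n) R) = 1 := by
  ext A B
  rw [Matrix.one_apply]
  cases A <;> cases B <;> simp [trDiag, Matrix.one_apply]

/-- The connection matrices on `E_A`. -/
def connLo : Dir n → Matrix (TIdx n) (TIdx n) R
  | a, .top, .top => H.c a
  | a, .bot, .bot => H.c a
  | a, .mid α, .mid β => (if α = β then H.c a else 0) - (H.g.map (H.e a) * H.gi) α β
  | .lo b, .top, .mid α => -H.gi b α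
  | .bar b, .mid α, .bot => (H.ε b : ℂ) • H.g α b
  | .zero, .top, .bot => -algebraMap ℂ R Complex.I
  | _, _, _ => 0

/-- This is the gauge transformation by g on the middle slot: the connection forms (dg) g⁻¹ are
absorbed by the derivative of the gauge, leaving constant matrices and the scalar `c`. All three
slots of E_A have weight difference one, so a single scalar suffices. -/
theorem connLo_mul (a : Dir n) : H.connLo a * trDiag H.g =
    trDiag H.g * (trMat H.ε a).map (algebraMap ℂ R) - (trDiag H.g).map (H.e a)
      + H.c a • trDiag H.g := by
  have h1 : ∀ (b α : Fin n), ∑ x, H.gi b x * H.g x α = if α = b then 1 else 0 := fun b α => by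
    rw [← Matrix.mul_apply, gi_mul_g, Matrix.one_apply]
    simp only [eq_comm]
  have h2 : ∀ (α β : Fin n), ∑ x, (H.g.map (H.e a) * H.gi) α x * H.g x β = H.e a (H.g α β) := by
    intro α β
    rw [← Matrix.mul_apply, Matrix.mul_assoc, gi_mul_g, Matrix.mul_one, Matrix.map_apply]
  ext A B
  simp only [Matrix.mul_apply, Matrix.add_apply, Matrix.sub_apply, Matrix.smul_apply,
    Matrix.map_apply, sum_tIdx]
  cases A <;> cases B <;> cases a <;>
    simp [trDiag, connLo, trMat, h1, h2, sub_mul, Finset.sum_sub_distrib, apply_ite,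
      Algebra.smul_def, ite_mul, Finset.sum_neg_distrib] <;>
      first
      | ring1
      | (split_ifs <;> simp_all)

/-- Signs of the shifts of weight. -/
def slotSign : Slot → ℂ
  | .lo => 1
  | .loBar => -1
  | .up => -1
  | .upBar => 1

/-- Matrices that trivialize the tractor bundles. -/
def gauge : Slot → Matrix (TIdx n) (TIdx n) R
  | .lo => trDiag H.g
  | .loBar => (trDiag H.g).map (starRingEnd R)
  | .up => (trDiag H.gi).transpose
  | .upBar => ((trDiag H.gi).map (starRingEnd R)).transpose

/-- Inverses of the matrices `gauge`. -/
def gaugeInv : Slot → Matrix (TIdx n) (TIdx n) R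
  | .lo => trDiag H.gi
  | .loBar => (trDiag H.gi).map (starRingEnd R)
  | .up => (trDiag H.g).transpose
  | .upBar => ((trDiag H.g).map (starRingEnd R)).transpose

theorem gauge_mul_gaugeInv (κ : Slot) : H.gauge κ * H.gaugeInv κ = 1 := by
  have h1 : trDiag H.g * trDiag H.gi = 1 := by rw [trDiag_mul, g_mul_gi, trDiag_one]
  have h2 : (trDiag H.g).map (starRingEnd R) * (trDiag H.gi).map (starRingEnd R) = 1 := by
    rw [← Matrix.map_mul, h1, Matrix.map_one _ (map_zero _) (map_one _)]
  cases κ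
  · exact h1
  · exact h2
  · rw [gauge, gaugeInv, ← Matrix.transpose_mul, h1, Matrix.transpose_one]
  · rw [gauge, gaugeInv, ← Matrix.transpose_mul, h2, Matrix.transpose_one]

/-- Connection matrices for all kinds of tractor indices. -/
def conn (a : Dir n) : Slot → Matrix (TIdx n) (TIdx n) R
  | .lo => H.connLo a
  | .loBar => (H.connLo a.conj).map (starRingEnd R)
  | .up => -(H.connLo a).transpose
  | .upBar => -((H.connLo a.conj).map (starRingEnd R)).transpose

/-- Matrices of the flat connection for all kinds of tractor indices. -/
def flatMat (ε : Fin n → ℝ) : Slot → Dir n → Matrix (TIdx n) (TIdx n) ℂ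
  | .lo, a => trMat ε a
  | .loBar, a => (trMat ε a.conj).map (starRingEnd ℂ)
  | .up, a => -(trMat ε a).transpose
  | .upBar, a => -((trMat ε a.conj).map (starRingEnd ℂ)).transpose

theorem isHeisMat_star {ε : Fin n → ℝ} {G : Dir n → Matrix (TIdx n) (TIdx n) ℂ}
    (h : IsHeisMat ε G) : IsHeisMat ε fun a => (G a.conj).map (starRingEnd ℂ) := by
  intro a b
  have := congrArg (fun m => m.map (starRingEnd ℂ)) (h a.conj b.conj)
  simp only [← Matrix.map_mul]
  rw [← Matrix.map_sub _ (map_sub _), this]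
  ext A B
  rw [Matrix.map_apply, Matrix.smul_apply, Matrix.smul_apply, Matrix.map_apply, smul_eq_mul,
    smul_eq_mul, map_mul, ← star_heisConst ε a b]
  rfl

theorem isHeisMat_dual {ε : Fin n → ℝ} {G : Dir n → Matrix (TIdx n) (TIdx n) ℂ}
    (h : IsHeisMat ε G) : IsHeisMat ε fun a => -(G a).transpose := by
  intro a b
  have := congrArg Matrix.transpose (h a b)
  simp only [neg_mul_neg, ← Matrix.transpose_mul, smul_neg]
  rw [← Matrix.transpose_smul, ← h a b, Matrix.transpose_sub, neg_sub]

theorem isHeisMat_flatMat (ε : Fin n → ℝ) : ∀ κ, IsHeisMat ε (flatMat ε κ)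
  | .lo => isHeisMat_trMat ε
  | .loBar => isHeisMat_star (isHeisMat_trMat ε)
  | .up => isHeisMat_dual (isHeisMat_trMat ε)
  | .upBar => isHeisMat_dual (isHeisMat_star (isHeisMat_trMat ε))

/-- The identity that relates the connection matrices with the flat ones in a gauge `t`. -/
def IsGauge (s : R) (a : Dir n) (Γ t : Matrix (TIdx n) (TIdx n) R)
    (G : Matrix (TIdx n) (TIdx n) ℂ) : Prop :=
  Γ * t = t * G.map (algebraMap ℂ R) - t.map (H.e a) + (s * H.c a) • t

/-- Conjugation reverses the scalar part because `c` is imaginary (`star_c`). -/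
theorem IsGauge.star {s : R} {a : Dir n} {Γ t : Matrix (TIdx n) (TIdx n) R}
    {G : Matrix (TIdx n) (TIdx n) ℂ} (h : H.IsGauge s a.conj Γ t G) :
    H.IsGauge (-star s) a (Γ.map (starRingEnd R)) (t.map (starRingEnd R))
      (G.map (starRingEnd ℂ)) := by
  have h' := congrArg (fun m => m.map (starRingEnd R)) h
  rw [IsGauge, ← Matrix.map_mul]
  refine h'.trans ?_
  ext A B
  have := H.star_c a
  have he := fun φ => H.e_star a φ
  simp only [Matrix.map_apply, Matrix.add_apply, Matrix.sub_apply, Matrix.smul_apply, smul_eq_mul,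
    map_add, map_sub, map_mul, map_sum, Matrix.mul_apply, starRingEnd_apply, this, he,
    algebraMap_star_comm]
  ring

/-- Differentiating t t⁻¹ = 1 turns the identity for t into one for t⁻¹; transposing with a minus
sign gives the dual connection and reverses the scalar. -/
theorem IsGauge.dual {s : R} {a : Dir n} {Γ t ti : Matrix (TIdx n) (TIdx n) R}
    {G : Matrix (TIdx n) (TIdx n) ℂ} (h : H.IsGauge s a Γ t G) (ht : t * ti = 1) :
    H.IsGauge (-s) a (-Γ.transpose) ti.transpose (-G.transpose) := by
  have ht' : ti * t = 1 := mul_eq_one_comm.1 ht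
  have e1 : t.map (H.e a) * ti = -(t * ti.map (H.e a)) := by
    have := congrArg (fun m => m.map (H.e a)) ht
    simp only [map_derivation_mul] at this
    rw [eq_neg_iff_add_eq_zero, add_comm, this]
    ext A B
    rw [Matrix.map_apply, Matrix.one_apply]
    split_ifs <;> simp
  have e2 : ti * Γ = G.map (algebraMap ℂ R) * ti + ti.map (H.e a) + (s * H.c a) • ti := by
    calc ti * Γ = ti * (Γ * t) * ti := by
          rw [Matrix.mul_assoc, Matrix.mul_assoc, ht, Matrix.mul_one]
      _ = ti * t * G.map (algebraMap ℂ R) * ti - ti * (t.map (H.e a) * ti)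
          + (s * H.c a) • (ti * t * ti) := by
          rw [h]
          simp only [Matrix.mul_add, Matrix.mul_sub, Matrix.add_mul, Matrix.sub_mul,
            Matrix.mul_assoc, Matrix.mul_smul, Matrix.smul_mul]
      _ = _ := by
          rw [e1, Matrix.mul_neg, ← Matrix.mul_assoc, ht', Matrix.one_mul, Matrix.one_mul,
            Matrix.one_mul, sub_neg_eq_add]
  have e3 := congrArg (fun m => -m.transpose) e2
  simp only [Matrix.transpose_mul, Matrix.transpose_add, Matrix.transpose_smul] at e3
  rw [IsGauge, Matrix.neg_mul, e3]
  have e4 : (-G.transpose).map (algebraMap ℂ R) = -(G.map (algebraMap ℂ R)).transpose := by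
    ext; simp
  rw [e4, Matrix.mul_neg, neg_mul, neg_smul]
  have e5 : (ti.map (H.e a)).transpose = ti.transpose.map (H.e a) := rfl
  rw [e5]
  abel

theorem isGauge (κ : Slot) (a : Dir n) :
    H.IsGauge (algebraMap ℂ R (slotSign κ)) a (H.conn a κ) (H.gauge κ) (flatMat H.ε κ a) := by
  have h1 : ∀ a, H.IsGauge 1 a (H.connLo a) (trDiag H.g) (trMat H.ε a) := fun a => by
    rw [IsGauge, one_mul]
    exact H.connLo_mul a
  have h2 := IsGauge.star H (h1 a.conj)
  cases κ
  · rw [slotSign, map_one]; exact h1 a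
  · rw [slotSign, map_neg, map_one]; rwa [star_one] at h2
  · rw [slotSign, map_neg, map_one]; exact IsGauge.dual H (h1 a) (H.gauge_mul_gaugeInv .lo)
  · have := IsGauge.dual H h2 (H.gauge_mul_gaugeInv .loBar)
    rw [star_one, neg_neg] at this
    rw [slotSign, map_one]
    exact this

/-- The covariant derivative on tractors of weight difference `δ`. -/
def cov : (L : List Slot) → ℂ → Dir n → Module.End ℂ (MI n L → R)
  | [], δ, a => LinearMap.pi fun I =>
      ((H.e a).toLinearMap + δ • LinearMap.mulLeft ℂ (H.c a)) ∘ₗ LinearMap.proj I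
  | κ :: L, δ, a => LinearMap.pi fun I =>
      LinearMap.proj I.2 ∘ₗ cov L δ a ∘ₗ LinearMap.funLeft ℂ R (Prod.mk I.1)
        + ∑ B, LinearMap.mulLeft ℂ (H.conn a κ I.1 B) ∘ₗ LinearMap.proj (B, I.2)

theorem cov_nil (δ : ℂ) (a : Dir n) (f : MI n [] → R) (I : MI n []) :
    H.cov [] δ a f I = H.e a (f I) + δ • (H.c a * f I) := rfl

theorem cov_cons (κ : Slot) (L : List Slot) (δ : ℂ) (a : Dir n) (f : MI n (κ :: L) → R)
    (A : TIdx n) (I : MI n L) : H.cov (κ :: L) δ a f (A, I) =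
      H.cov L δ a (fun J => f (A, J)) I + ∑ B, H.conn a κ A B * f (B, I) := by
  simp only [cov, LinearMap.pi_apply, LinearMap.add_apply, LinearMap.sum_apply,
    LinearMap.comp_apply, LinearMap.mulLeft_apply, LinearMap.proj_apply]
  rfl

theorem cov_smul (δ : ℂ) (a : Dir n) (r : R) : ∀ (L : List Slot) (f : MI n L → R) (I : MI n L),
    H.cov L δ a (fun J => r * f J) I = r * H.cov L δ a f I + H.e a r * f I
  | [], f, I => by
    rw [cov_nil, cov_nil]
    simp only [Derivation.leibniz, smul_eq_mul, Algebra.smul_def]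
    ring
  | κ :: L, f, (A, I) => by
    rw [cov_cons, cov_cons, cov_smul δ a r L (fun J => f (A, J))]
    simp only [mul_add, Finset.mul_sum, mul_left_comm r]
    ring

theorem cov_add_weight (δ s : ℂ) (a : Dir n) : ∀ (L : List Slot) (f : MI n L → R) (I : MI n L),
    H.cov L (δ + s) a f I = H.cov L δ a f I + algebraMap ℂ R s * H.c a * f I
  | [], f, I => by
    rw [cov_nil, cov_nil]
    simp only [Algebra.smul_def, map_add]
    ring
  | κ :: L, f, (A, I) => by
    rw [cov_cons, cov_cons, cov_add_weight δ s a L (fun J => f (A, J))]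
    ring

/-- The passage from the trivialized to the original components of a tractor index. -/
def glue (κ : Slot) (L : List Slot) (v : TIdx n → MI n L → R) : MI n (κ :: L) → R :=
  fun I => ∑ B, H.gauge κ I.1 B * v B I.2

theorem glue_apply (κ : Slot) (L : List Slot) (v : TIdx n → MI n L → R) (A : TIdx n)
    (I : MI n L) : H.glue κ L v (A, I) = ∑ B, H.gauge κ A B * v B I := rfl

theorem glue_surjective (κ : Slot) (L : List Slot) (f : MI n (κ :: L) → R) :
    ∃ v, H.glue κ L v = f := by
  refine ⟨fun A I => ∑ B, H.gaugeInv κ A B * f (B, I), ?_⟩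
  funext ⟨A, I⟩
  rw [glue_apply]
  simp only [Finset.mul_sum, ← mul_assoc]
  rw [Finset.sum_comm]
  simp only [← Finset.sum_mul, ← Matrix.mul_apply, gauge_mul_gaugeInv, Matrix.one_apply]
  simp

/-- By the gauge identity, the connection term for the index and the derivative of the gauge combine
to a constant matrix and a multiple of `c`. The latter is absorbed as a shift of the weight
difference by `slotSign κ`. -/
theorem cov_glue (κ : Slot) (L : List Slot) (δ : ℂ) (a : Dir n) (v : TIdx n → MI n L → R) :
    H.cov (κ :: L) δ a (H.glue κ L v) =
      H.glue κ L (tensRep (H.cov L (δ + slotSign κ)) (flatMat H.ε κ) a v) := by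
  funext ⟨A, I⟩
  have h1 : (fun J => H.glue κ L v (A, J)) = ∑ B, fun J => H.gauge κ A B * v B J := by
    funext J
    rw [glue_apply, Finset.sum_apply]
  have h2 : ∀ B, (H.conn a κ * H.gauge κ) A B = _ := fun B =>
    congrFun (congrFun (H.isGauge κ a) A) B
  have h3 : ∑ B, H.conn a κ A B * H.glue κ L v (B, I) =
      ∑ C, (H.conn a κ * H.gauge κ) A C * v C I := by
    simp only [glue_apply, Finset.mul_sum, Matrix.mul_apply, Finset.sum_mul, mul_assoc]
    exact Finset.sum_comm
  have h4 : ∑ C, (H.gauge κ * (flatMat H.ε κ a).map (algebraMap ℂ R)) A C * v C I =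
      ∑ B, H.gauge κ A B * ∑ C, flatMat H.ε κ a B C • v C I := by
    simp only [Matrix.mul_apply, Finset.mul_sum, Finset.sum_mul, Algebra.smul_def, mul_assoc,
      Matrix.map_apply]
    exact Finset.sum_comm
  rw [cov_cons, h1, h3, map_sum, glue_apply, Finset.sum_apply]
  simp only [cov_smul, tensRep_apply, cov_add_weight, h2, Pi.add_apply, Finset.sum_apply,
    Pi.smul_apply, smul_eq_mul, mul_add, Finset.sum_add_distrib, Matrix.add_apply,
    Matrix.sub_apply, add_mul, sub_mul, Finset.sum_sub_distrib, h4, Matrix.smul_apply,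
    Matrix.map_apply]
  have h5 : ∀ B, H.gauge κ A B * (algebraMap ℂ R (slotSign κ) * H.c a * v B I) =
      algebraMap ℂ R (slotSign κ) * H.c a * H.gauge κ A B * v B I := fun B => by ring
  simp only [h5]
  ring

theorem glue_sub (κ : Slot) (L : List Slot) (v v' : TIdx n → MI n L → R) :
    H.glue κ L (v - v') = H.glue κ L v - H.glue κ L v' := by
  funext ⟨A, I⟩
  simp [glue_apply, mul_sub, Finset.sum_sub_distrib]

theorem glue_add (κ : Slot) (L : List Slot) (v v' : TIdx n → MI n L → R) :
    H.glue κ L (v + v') = H.glue κ L v + H.glue κ L v' := by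
  funext ⟨A, I⟩
  simp [glue_apply, mul_add, Finset.sum_add_distrib]

theorem glue_smul (κ : Slot) (L : List Slot) (r : ℂ) (v : TIdx n → MI n L → R) :
    H.glue κ L (r • v) = r • H.glue κ L v := by
  funext ⟨A, I⟩
  simp [glue_apply, Finset.smul_sum]

/-- Induction on the tractor indices: densities are handled by the closedness of `c`, and each
further index tensors with a constant representation after a change of gauge. -/
theorem isHeis_cov : ∀ (L : List Slot) (δ : ℂ), IsHeis H.ε (H.cov L δ)
  | [], δ => by
    intro a b f
    funext I
    have h1 := H.e_comm a b (f I)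
    have h2 := H.e_c a b
    rw [Algebra.smul_def] at h1 h2
    change H.cov [] δ a (H.cov [] δ b f) I - H.cov [] δ b (H.cov [] δ a f) I =
      heisConst H.ε a b • H.cov [] δ .zero f I
    rw [cov_nil, cov_nil, cov_nil, cov_nil, cov_nil]
    simp only [map_add, Derivation.map_algebraMap, Derivation.leibniz, smul_eq_mul,
      Algebra.smul_def, mul_add, mul_zero, add_zero]
    linear_combination h1 + algebraMap ℂ R δ * f I * h2
  | κ :: L, δ => by
    intro a b f
    obtain ⟨v, rfl⟩ := H.glue_surjective κ L f
    rw [cov_glue, cov_glue, cov_glue, cov_glue, cov_glue, ← glue_sub, ← glue_smul]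
    congr 1
    exact (isHeis_cov L (δ + slotSign κ)).tens (isHeisMat_flatMat H.ε κ) a b v

end HeisAlg

/-! ### Change of frame for second derivatives -/

namespace HeisAlg
variable {n : ℕ} {R : Type*} [CommRing R] [Algebra ℂ R] [StarRing R] [StarModule ℂ R]
  (H : HeisAlg n R)

/-- The passage from components in the Heisenberg frame to components in the frame described
by `g`. -/
def comb (a : Dir n) (x : Dir n → R) : R :=
  match a with
  | .lo α => ∑ β, H.g α β * x (.lo β)
  | .bar α => ∑ β, star (H.g α β) * x (.bar β)
  | .zero => x .zero

theorem comb_add (a : Dir n) (x y : Dir n → R) :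
    H.comb a (fun b => x b + y b) = H.comb a x + H.comb a y := by
  cases a <;> simp [comb, mul_add, Finset.sum_add_distrib]

theorem comb_neg (a : Dir n) (x : Dir n → R) :
    H.comb a (fun b => -x b) = -H.comb a x := by
  cases a <;> simp [comb]

theorem comb_mul (a : Dir n) (x : Dir n → R) (r : R) :
    H.comb a (fun b => x b * r) = H.comb a x * r := by
  cases a <;> simp [comb, Finset.sum_mul, mul_assoc]

theorem comb_smul (a : Dir n) (x : Dir n → R) (r : ℂ) :
    H.comb a (fun b => r • x b) = r • H.comb a x := by
  cases a <;> simp [comb, Finset.smul_sum]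

theorem comb_sum {ι : Type*} (s : Finset ι) (a : Dir n) (x : ι → Dir n → R) :
    H.comb a (fun b => ∑ i ∈ s, x i b) = ∑ i ∈ s, H.comb a (x i) := by
  cases a <;> simp only [comb, Finset.mul_sum] <;> exact Finset.sum_comm

theorem comb_zero (a : Dir n) : H.comb a (fun _ => 0) = 0 := by
  cases a <;> simp [comb]

theorem star_comb (a : Dir n) (x : Dir n → R) :
    star (H.comb a.conj x) = H.comb a fun b => star (x b.conj) := by
  cases a <;> simp [comb, Dir.conj, star_sum, mul_comm]

/-- With connection forms (dq) q⁻¹, the correction term cancels the derivative of the frame change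
`q`. The second covariant derivative therefore transforms as a tensor. -/
theorem lap_aux {L : List Slot} {p q qi : Matrix (Fin n) (Fin n) R} (hq : qi * q = 1)
    (d : Fin n → Derivation ℂ R R) (N : Fin n → Module.End ℂ (MI n L → R))
    (hN : ∀ ν r f I, N ν (fun J => r * f J) I = r * N ν f I + d ν r * f I)
    (u : Fin n → MI n L → R) (α β : Fin n) (I : MI n L) :
    ∑ ν, p β ν * N ν (fun J => ∑ μ, q α μ * u μ J) I
      - ∑ μ, (∑ l, (∑ ν, p β ν * d ν (q α l)) * qi l μ) * ∑ l, q μ l * u l I =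
    ∑ ν, ∑ μ, p β ν * q α μ * N ν (u μ) I := by
  have h1 : ∀ ν, N ν (fun J => ∑ μ, q α μ * u μ J) I =
      ∑ μ, (q α μ * N ν (u μ) I + d ν (q α μ) * u μ I) := fun ν => by
    have : (fun J => ∑ μ, q α μ * u μ J) = ∑ μ, fun J => q α μ * u μ J := by
      funext J
      rw [Finset.sum_apply]
    rw [this, map_sum, Finset.sum_apply]
    exact Finset.sum_congr rfl fun μ _ => hN _ _ _ _
  have h2 : ∑ μ, (∑ l, (∑ ν, p β ν * d ν (q α l)) * qi l μ) * ∑ l, q μ l * u l I =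
      ∑ l, (∑ ν, p β ν * d ν (q α l)) * u l I := by
    have e : ∀ (x y : Fin n → R), ∑ μ, (∑ l, x l * qi l μ) * ∑ l, q μ l * y l = ∑ l, x l * y l := by
      intro x y
      have e1 : ∑ μ, (∑ l, x l * qi l μ) * ∑ l, q μ l * y l =
          dotProduct (Matrix.vecMul x qi) (Matrix.mulVec q y) := rfl
      rw [e1, Matrix.dotProduct_mulVec, Matrix.vecMul_vecMul, hq, Matrix.vecMul_one]
      rfl
    exact e _ _
  rw [h2]
  simp only [h1, mul_add, Finset.mul_sum, Finset.sum_mul, Finset.sum_add_distrib, mul_assoc]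
  rw [add_sub_assoc, Finset.sum_comm (f := fun i j => p β i * ((d i) (q α j) * u j I)), sub_self,
    add_zero]

/-- Once second derivatives are tensorial, contraction with h⁻¹ in the given frame is contraction
with `e`, which will be the signature matrix. -/
theorem sum_hinv_aux {p k q e : Matrix (Fin n) (Fin n) R} (h : p.transpose * k * q = e)
    (x : Fin n → Fin n → R) :
    ∑ α, ∑ β, k β α * ∑ ν, ∑ μ, p β ν * q α μ * x ν μ = ∑ ν, ∑ μ, e ν μ * x ν μ := by
  subst h
  simp only [Matrix.mul_apply, Matrix.transpose_apply, Finset.mul_sum, Finset.sum_mul]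
  rw [Finset.sum_comm]
  calc _ = ∑ β, ∑ ν, ∑ α, ∑ μ, k β α * (p β ν * q α μ * x ν μ) :=
        Finset.sum_congr rfl fun β _ => Finset.sum_comm
    _ = ∑ ν, ∑ β, ∑ α, ∑ μ, k β α * (p β ν * q α μ * x ν μ) := Finset.sum_comm
    _ = ∑ ν, ∑ β, ∑ μ, ∑ α, k β α * (p β ν * q α μ * x ν μ) :=
        Finset.sum_congr rfl fun ν _ => Finset.sum_congr rfl fun β _ => Finset.sum_comm
    _ = ∑ ν, ∑ μ, ∑ β, ∑ α, k β α * (p β ν * q α μ * x ν μ) :=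
        Finset.sum_congr rfl fun ν _ => Finset.sum_comm
    _ = ∑ ν, ∑ μ, ∑ α, ∑ β, k β α * (p β ν * q α μ * x ν μ) :=
        Finset.sum_congr rfl fun ν _ => Finset.sum_congr rfl fun μ _ => Finset.sum_comm
    _ = _ := by
        refine Finset.sum_congr rfl fun ν _ => Finset.sum_congr rfl fun μ _ =>
          Finset.sum_congr rfl fun α _ => Finset.sum_congr rfl fun β _ => ?_
        ring

end HeisAlg

/-! ### Geometric operators in the Heisenberg frame -/

section Coframe
variable {n : ℕ} {M : Type*} [TopologicalSpace M]
  [ChartedSpace (EuclideanSpace ℝ (Fin (2 * n + 1))) M]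
  [IsManifold (𝓡 (2 * n + 1)) ∞ M] {S : PseudoHermitian n M} {U V : Set M}

namespace FlatCoframe
variable (K : FlatCoframe S U V)

theorem E_eq_comb (a : Dir n) (φ : smoothAlg n V) : K.E a φ = K.heis.comb a fun b => K.e b φ := by
  cases a with
  | lo α => exact K.E_lo_eq α φ
  | bar α => exact K.E_bar_eq α φ
  | zero => exact K.E_zero_eq φ

theorem comb_c (a : Dir n) :
    K.heis.comb a K.heis.c = (1 / (n + 2) : ℂ) • K.omTrA a := by
  rw [omTrA, E_eq_comb, ← HeisAlg.comb_mul, ← HeisAlg.comb_smul]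
  rfl

theorem comb_om (a : Dir n) (α β : Fin n) :
    K.heis.comb a (fun b => (K.g.map (K.e b) * K.gi) α β) = K.omA a α β := by
  simp only [omA, Matrix.mul_apply, HeisAlg.comb_sum, HeisAlg.comb_mul, Matrix.map_apply, E_eq_comb]

theorem evalHom_smul (y : V) (r : ℂ) (φ : smoothAlg n V) : evalHom y (r • φ) = r * evalHom y φ :=
  rfl

/-- All curvature entries of the connection matrix are zero. What remains is the pseudohermitian
part, the Kronecker delta written as g g⁻¹, the Levi form written as g ε g*, and the constant −i. -/
theorem trConn_apply (a : Dir n) (A B : TIdx n) (y : V) :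
    K.F.trConn a A B y = evalHom y (K.heis.comb a fun b => K.heis.connLo b A B) := by
  have hw1 : K.F.wt 1 0 a y = evalHom y (K.heis.comb a K.heis.c) := by
    rw [comb_c, evalHom_smul, wt_eq, sub_zero]; rfl
  have hw2 : K.F.wt 0 (-1) a y = evalHom y (K.heis.comb a K.heis.c) := by
    rw [comb_c, evalHom_smul, wt_eq, sub_neg_eq_add, zero_add]; rfl
  have hlo : ∀ α μ : Fin n, ∑ β, K.g α β * -K.gi β μ = -if α = μ then 1 else 0 := fun α μ => by
    have := congrFun (congrFun K.g_mul_gi α) μ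
    rw [Matrix.mul_apply, Matrix.one_apply] at this
    rw [← this, ← Finset.sum_neg_distrib]
    exact Finset.sum_congr rfl fun β _ => by ring
  have hbar : ∀ α β : Fin n, ∑ ν, star (K.g β ν) * ((K.C.ε ν : ℂ) • K.g α ν) = K.hA α β :=
    fun α β => by
      rw [hA_apply]
      exact Finset.sum_congr rfl fun ν _ => by rw [mul_smul_comm, mul_comm]
  have hmid : ∀ α β : Fin n, K.heis.comb a (fun b => (if α = β then K.heis.c b else 0)
      - (K.g.map (K.e b) * K.gi) α β) =
      (if α = β then K.heis.comb a K.heis.c else 0) - K.omA a α β := fun α β => by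
    simp only [sub_eq_add_neg]
    rw [HeisAlg.comb_add, HeisAlg.comb_neg, comb_om]
    congr 1
    split_ifs
    · rfl
    · exact K.heis.comb_zero a
  rw [AdmissibleCoframe.trConn]
  cases A with
  | top =>
    cases B with
    | top =>
      have : K.F.trAlg a .top .top y = 0 := by
        cases a <;> simp [AdmissibleCoframe.trAlg, trP_eq]
      rw [this, zero_add]
      simp only [AdmissibleCoframe.trPsh, HeisAlg.connLo, hw1]
    | mid μ =>
      cases a with
      | lo α =>
        have := congrArg (evalHom y) (hlo α μ)
        refine Eq.trans ?_ this.symm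
        simp only [AdmissibleCoframe.trAlg, AdmissibleCoframe.trPsh, eq_comm (a := μ)]
        split_ifs <;> simp
      | bar α => simp [AdmissibleCoframe.trAlg, AdmissibleCoframe.trPsh, HeisAlg.connLo,
          HeisAlg.comb]
      | zero => simp [AdmissibleCoframe.trAlg, AdmissibleCoframe.trPsh, HeisAlg.connLo,
          HeisAlg.comb]
    | bot =>
      cases a with
      | lo α => simp [AdmissibleCoframe.trAlg, AdmissibleCoframe.trPsh, HeisAlg.connLo,
          HeisAlg.comb]
      | bar α => simp [AdmissibleCoframe.trAlg, AdmissibleCoframe.trPsh, HeisAlg.connLo,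
          HeisAlg.comb]
      | zero =>
        simp only [AdmissibleCoframe.trAlg, AdmissibleCoframe.trPsh, HeisAlg.connLo,
          HeisAlg.comb, add_zero, map_neg]
        rfl
  | mid α =>
    cases B with
    | top =>
      cases a <;> simp [AdmissibleCoframe.trAlg, AdmissibleCoframe.trPsh, HeisAlg.connLo,
          HeisAlg.comb, A_apply, P_eq, Tlo_eq]
    | mid β =>
      have : K.F.trAlg a (.mid α) (.mid β) y = 0 := by
        cases a <;> simp [AdmissibleCoframe.trAlg, trP_eq, Pmix_eq]
      rw [this, zero_add]
      refine Eq.trans ?_ (congrArg (evalHom y) (hmid α β)).symm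
      simp only [AdmissibleCoframe.trPsh, hw1, om_apply, map_sub]
      split_ifs <;> simp
    | bot =>
      cases a with
      | bar β =>
        refine Eq.trans ?_ (congrArg (evalHom y) (hbar α β)).symm
        simp only [AdmissibleCoframe.trAlg, AdmissibleCoframe.trPsh, h_apply, add_zero]
        rfl
      | lo β => simp [AdmissibleCoframe.trAlg, AdmissibleCoframe.trPsh, HeisAlg.connLo,
          HeisAlg.comb]
      | zero => simp [AdmissibleCoframe.trAlg, AdmissibleCoframe.trPsh, HeisAlg.connLo,
          HeisAlg.comb]
  | bot =>
    cases B with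
    | top =>
      cases a <;> simp [AdmissibleCoframe.trAlg, AdmissibleCoframe.trPsh, HeisAlg.connLo,
          HeisAlg.comb, Tlo_eq, Tbar_eq, Sc_eq]
    | mid β =>
      cases a <;> simp [AdmissibleCoframe.trAlg, AdmissibleCoframe.trPsh, HeisAlg.connLo,
          HeisAlg.comb, Pmix_eq, AbarUp_eq, Tup_eq]
    | bot =>
      have : K.F.trAlg a .bot .bot y = 0 := by
        cases a <;> simp [AdmissibleCoframe.trAlg, trP_eq]
      rw [this, zero_add]
      simp only [AdmissibleCoframe.trPsh, HeisAlg.connLo, hw2]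

theorem conn_apply (a : Dir n) (κ : Slot) (A B : TIdx n) (y : V) :
    K.F.conn a y κ A B = evalHom y (K.heis.comb a fun b => K.heis.conn b κ A B) := by
  have h : ∀ A B, star (K.F.trConn a.conj A B y) =
      evalHom y (K.heis.comb a fun b => star (K.heis.connLo b.conj A B)) := fun A B => by
    rw [trConn_apply, ← evalHom_star, HeisAlg.star_comb]
  cases κ with
  | lo => exact K.trConn_apply a A B y
  | loBar => exact h A B
  | up =>
    rw [AdmissibleCoframe.conn, trConn_apply, ← map_neg, ← HeisAlg.comb_neg]
    rfl
  | upBar =>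
    rw [AdmissibleCoframe.conn, h, ← map_neg, ← HeisAlg.comb_neg]
    rfl

/-- The components `f` restrict to the smooth functions `φ` on `V`. -/
def Rep {L : List Slot} (f : MI n L → M → ℂ) (φ : MI n L → smoothAlg n V) : Prop :=
  ∀ I (y : V), f I y = evalHom y (φ I)

variable {K} {L : List Slot} {f : MI n L → M → ℂ} {φ : MI n L → smoothAlg n V}

theorem rep_cov (w w' : ℂ) (a : Dir n) : ∀ {L : List Slot} {f : MI n L → M → ℂ}
    {φ : MI n L → smoothAlg n V}, Rep f φ → Rep (K.F.cov L w w' a f)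
      fun I => K.heis.comb a fun b => K.heis.cov L (w - w') b φ I
  | [], f, φ, h, I, y => by
    change _ = evalHom y (K.heis.comb a fun b =>
      K.heis.e b (φ I) + (w - w') • (K.heis.c b * φ I))
    simp only [HeisAlg.comb_add, HeisAlg.comb_smul, HeisAlg.comb_mul, comb_c,
      AdmissibleCoframe.cov, derAct, wt_eq]
    have e : (K.heis.comb a fun b => K.heis.e b (φ I)) = K.E a (φ I) := (K.E_eq_comb a _).symm
    rw [e, map_add, evalHom_smul, map_mul, evalHom_smul, K.E_apply a (h I), h I, evalHom_apply,
      evalHom_apply, evalHom_apply]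
    ring
  | κ :: L, f, φ, h, (A, I), y => by
    have ih := rep_cov w w' a (L := L) (f := fun J => f (A, J)) (φ := fun J => φ (A, J))
      (fun J => h (A, J)) I y
    have e : (fun b => K.heis.cov (κ :: L) (w - w') b φ (A, I)) = fun b =>
        K.heis.cov L (w - w') b (fun J => φ (A, J)) I + ∑ B, K.heis.conn b κ A B * φ (B, I) :=
      funext fun b => K.heis.cov_cons κ L _ b φ A I
    refine Eq.trans ?_ (congrArg (fun x => evalHom y (K.heis.comb a x)) e).symm
    simp only [HeisAlg.comb_add, HeisAlg.comb_sum, HeisAlg.comb_mul, map_add,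
      map_sum, map_mul, ← conn_apply, ← ih, ← h (_, I) y]
    simp only [AdmissibleCoframe.cov, derAct, tSum_eq]
    ring

theorem rep_subLap (w w' : ℂ) (h : Rep f φ) :
    Rep (K.F.subLap L w w' f) (lapOp K.C.ε (K.heis.cov L (w - w')) φ) := by
  intro I y
  have h1 := fun α => rep_cov (K := K) w w' (.lo α) h
  have h2 := fun α β => rep_cov (K := K) w w' (.bar β) (h1 α)
  have e1 : ∀ α β, (K.omA (.bar β)) α = fun μ => ∑ l,
      (∑ ν, star (K.g β ν) * K.heis.e (.bar ν) (K.g α l)) * K.gi l μ := fun α β => by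
    funext μ
    rw [omA, Matrix.mul_apply]
    exact Finset.sum_congr rfl fun l _ => by rw [Matrix.map_apply, E_bar_eq]; rfl
  have key : ∀ α β, K.F.cov L w w' (.bar β) (K.F.cov L w w' (.lo α) f) I y
      - ∑ μ, K.F.om (.bar β) α μ y * K.F.cov L w w' (.lo μ) f I y =
      evalHom y (∑ ν, ∑ μ, star (K.g β ν) * K.g α μ *
        K.heis.cov L (w - w') (.bar ν) (K.heis.cov L (w - w') (.lo μ) φ) I) := by
    intro α β
    have := HeisAlg.lap_aux (L := L) (p := K.g.map star) (q := K.g) K.gi_mul_g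
      (fun ν => K.heis.e (.bar ν)) (fun ν => K.heis.cov L (w - w') (.bar ν))
      (fun ν r f I => K.heis.cov_smul _ _ r L f I)
      (fun μ => K.heis.cov L (w - w') (.lo μ) φ) α β I
    simp only [Matrix.map_apply] at this
    rw [← this, map_sub, h2]
    congr 1
    rw [map_sum]
    refine Finset.sum_congr rfl fun μ _ => ?_
    rw [map_mul, om_apply, h1, e1]
    rfl
  simp only [AdmissibleCoframe.subLap, key, hinv_apply]
  -- The frame change takes h⁻¹ to the inverse signature matrix, which equals ε.
  have hm : (K.g.map star).transpose * K.hiA * K.g = K.εM := by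
    change K.g.conjTranspose * K.hiA * K.g = K.εM
    rw [hiA, Matrix.mul_assoc, Matrix.mul_assoc, gi_mul_g, Matrix.mul_one, ← Matrix.mul_assoc,
      gh_mul_gih, Matrix.one_mul]
  have := congrArg (evalHom y) (HeisAlg.sum_hinv_aux hm fun ν μ =>
    K.heis.cov L (w - w') (.bar ν) (K.heis.cov L (w - w') (.lo μ) φ) I)
  simp only [map_sum (evalHom y), map_mul, Matrix.map_apply, evalHom_apply] at this ⊢
  rw [this]
  simp only [lapOp, Finset.sum_apply, Pi.smul_apply, smoothAlg_sum_apply]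
  refine Finset.sum_congr rfl fun α _ => ?_
  rw [Finset.sum_eq_single α]
  · simp only [εM, Matrix.diagonal_apply_eq]; rfl
  · intro β _ hβ
    simp [εM, Matrix.diagonal_apply_ne _ hβ.symm]
  · simp

theorem rep_subLapBar (w w' : ℂ) (h : Rep f φ) :
    Rep (K.F.subLapBar L w w' f) (lapOp K.C.ε (swapRep (K.heis.cov L (w - w'))) φ) := by
  intro I y
  have h1 := fun α => rep_cov (K := K) w w' (.bar α) h
  have h2 := fun α β => rep_cov (K := K) w w' (.lo α) (h1 β)
  have e1 : ∀ α β μ, star (K.omA (.bar α) β μ) = ∑ l,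
      (∑ ν, K.g α ν * K.heis.e (.lo ν) (star (K.g β l))) * star (K.gi l μ) := fun α β μ => by
    rw [omA, Matrix.mul_apply, star_sum]
    refine Finset.sum_congr rfl fun l _ => ?_
    rw [star_mul', Matrix.map_apply]
    congr 1
    have := K.E_star (.lo α) (star (K.g β l))
    rw [star_star] at this
    refine Eq.trans ?_ (K.E_lo_eq α (star (K.g β l)))
    rw [K.E_star]
    rfl
  have key : ∀ α β, K.F.cov L w w' (.lo α) (K.F.cov L w w' (.bar β) f) I y
      - ∑ μ, star (K.F.om (.bar α) β μ y) * K.F.cov L w w' (.bar μ) f I y =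
      evalHom y (∑ ν, ∑ μ, K.g α ν * star (K.g β μ) *
        K.heis.cov L (w - w') (.lo ν) (K.heis.cov L (w - w') (.bar μ) φ) I) := by
    intro α β
    have hq : K.gi.map star * K.g.map star = 1 := by
      have := congrArg Matrix.transpose K.gh_mul_gih
      rwa [Matrix.transpose_mul, Matrix.transpose_one] at this
    have := HeisAlg.lap_aux (L := L) (p := K.g) (q := K.g.map star) hq
      (fun ν => K.heis.e (.lo ν)) (fun ν => K.heis.cov L (w - w') (.lo ν))
      (fun ν r f I => K.heis.cov_smul _ _ r L f I)
      (fun μ => K.heis.cov L (w - w') (.bar μ) φ) β α I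
    simp only [Matrix.map_apply] at this
    rw [← this, map_sub, h2]
    congr 1
    rw [map_sum]
    refine Finset.sum_congr rfl fun μ _ => ?_
    rw [map_mul, om_apply, h1, ← e1]
    rfl
  simp only [AdmissibleCoframe.subLapBar, key, hinv_apply]
  have hm : K.g.transpose * K.hiA.transpose * K.g.map star = K.εM := by
    have e : K.g.transpose * K.hiA.transpose * K.g.map star =
        (K.g.conjTranspose * K.hiA * K.g).transpose := by
      rw [Matrix.transpose_mul, Matrix.transpose_mul, Matrix.mul_assoc]
      rfl
    rw [e, hiA, Matrix.mul_assoc, Matrix.mul_assoc, gi_mul_g, Matrix.mul_one, ← Matrix.mul_assoc,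
      gh_mul_gih, Matrix.one_mul, εM, Matrix.diagonal_transpose]
  have := congrArg (evalHom y) (HeisAlg.sum_hinv_aux hm fun ν μ =>
    K.heis.cov L (w - w') (.lo ν) (K.heis.cov L (w - w') (.bar μ) φ) I)
  rw [Finset.sum_comm] at this
  simp only [map_sum (evalHom y), map_mul, Matrix.map_apply, evalHom_apply,
    Matrix.transpose_apply] at this ⊢
  rw [this]
  simp only [lapOp, Finset.sum_apply, Pi.smul_apply, smoothAlg_sum_apply]
  refine Finset.sum_congr rfl fun α _ => ?_
  rw [Finset.sum_eq_single α]
  · simp only [εM, Matrix.diagonal_apply_eq]; rfl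
  · intro β _ hβ
    simp [εM, Matrix.diagonal_apply_ne _ hβ.symm]
  · simp

theorem rep_box (w w' : ℂ) (h : Rep f φ) :
    Rep (K.F.box L w w' f) (boxOp K.C.ε (K.heis.cov L (w - w')) w φ) := by
  intro I y
  rw [AdmissibleCoframe.box, rep_subLap w w' h, rep_cov w w' .zero h, trP_eq]
  simp only [boxOp, Pi.add_apply, Pi.smul_apply, map_add, evalHom_smul, mul_zero, zero_mul,
    add_zero]
  rfl

theorem rep_boxBar (w w' : ℂ) (h : Rep f φ) :
    Rep (K.F.boxBar L w w' f) (boxOp K.C.ε (swapRep (K.heis.cov L (w - w'))) w' φ) := by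
  intro I y
  rw [AdmissibleCoframe.boxBar, rep_subLapBar w w' h, rep_cov w w' .zero h, trP_eq]
  simp only [boxOp, Pi.add_apply, Pi.smul_apply, map_add, evalHom_smul, mul_zero, zero_mul,
    add_zero, swapRep, LinearMap.neg_apply, Pi.neg_apply, map_neg, mul_neg, sub_eq_add_neg]
  rfl

theorem rep_D (w w' : ℂ) (h : Rep f φ) : Rep (K.F.D L w w' f)
    (K.heis.glue .lo L (dOp K.C.ε (K.heis.cov L (w - w')) (n + w + w') w φ)) := by
  rintro ⟨A, I⟩ y
  rw [HeisAlg.glue_apply, sum_tIdx]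
  cases A with
  | top =>
    simp only [AdmissibleCoframe.D, HeisAlg.gauge, HeisAlg.trDiag, dOp, zero_mul,
      Finset.sum_const_zero, add_zero, one_mul, Pi.smul_apply, evalHom_smul, ← h I y]
    ring
  | mid α =>
    simp only [AdmissibleCoframe.D, HeisAlg.gauge, HeisAlg.trDiag, dOp, zero_mul, zero_add,
      add_zero, Pi.smul_apply, mul_smul_comm, smul_zero, ← Finset.smul_sum, evalHom_smul,
      rep_cov w w' (.lo α) h I y]
    rfl
  | bot =>
    simp only [AdmissibleCoframe.D, HeisAlg.gauge, HeisAlg.trDiag, dOp, zero_mul,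
      Finset.sum_const_zero, zero_add, one_mul, Pi.neg_apply, map_neg, rep_box w w' h I y]

theorem rep_DBar (w w' : ℂ) (h : Rep f φ) : Rep (K.F.DBar L w w' f)
    (K.heis.glue .loBar L
      (dOp K.C.ε (swapRep (K.heis.cov L (w - w'))) (n + w + w') w' φ)) := by
  rintro ⟨A, I⟩ y
  rw [HeisAlg.glue_apply, sum_tIdx]
  cases A with
  | top =>
    simp only [AdmissibleCoframe.DBar, HeisAlg.gauge, Matrix.map_apply, HeisAlg.trDiag, dOp,
      map_zero, map_one, zero_mul,
      Finset.sum_const_zero, add_zero, one_mul, Pi.smul_apply, evalHom_smul, ← h I y]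
    ring
  | mid α =>
    simp only [AdmissibleCoframe.DBar, HeisAlg.gauge, Matrix.map_apply, HeisAlg.trDiag, dOp,
      map_zero, map_one, zero_mul, zero_add,
      add_zero, Pi.smul_apply, mul_smul_comm, smul_zero, ← Finset.smul_sum, evalHom_smul,
      rep_cov w w' (.bar α) h I y]
    rfl
  | bot =>
    simp only [AdmissibleCoframe.DBar, HeisAlg.gauge, Matrix.map_apply, HeisAlg.trDiag, dOp,
      map_zero, map_one, zero_mul,
      Finset.sum_const_zero, zero_add, one_mul, Pi.neg_apply, map_neg, rep_boxBar w w' h I y]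

end FlatCoframe
end Coframe

/-! ### Intertwining maps and conjugate tractor indices -/

section Intertwine
variable {n : ℕ} {ε : Fin n → ℝ} {W W' : Type*} [AddCommGroup W] [Module ℂ W]
  [AddCommGroup W'] [Module ℂ W'] {X : Dir n → Module.End ℂ W} {Y : Dir n → Module.End ℂ W'}
  {p : W →ₗ[ℂ] W'}

theorem swapRep_intertwine (h : ∀ a v, Y a (p v) = p (X a v)) (a : Dir n) (v : W) :
    swapRep Y a (p v) = p (swapRep X a v) := by
  cases a <;> simp [swapRep, h]

theorem boxOp_intertwine (h : ∀ a v, Y a (p v) = p (X a v)) (w : ℂ) (v : W) :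
    boxOp ε Y w (p v) = p (boxOp ε X w v) := by
  simp [boxOp, lapOp, h]

theorem boxOpPow_intertwine (h : ∀ a v, Y a (p v) = p (X a v)) (k : ℕ) : ∀ (w : ℂ) (v : W),
    boxOpPow ε Y k w (p v) = p (boxOpPow ε X k w v) := by
  induction k with
  | zero => intro w v; rfl
  | succ k ih => intro w v; rw [boxOpPow, boxOp_intertwine h, ih]; rfl

/-- For the conjugate representation, a barred index behaves as an unbarred one does for the
original. This lets the computations for D also serve for its conjugate. -/
theorem swapRep_tensRep (X : Dir n → Module.End ℂ W) :
    swapRep (tensRep X (HeisAlg.flatMat ε .loBar)) = tensRep (swapRep X) (trMat ε) := by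
  funext a
  refine LinearMap.ext fun v => ?_
  funext A
  cases a <;> cases A <;>
    simp [swapRep, tensRep_apply, sum_tIdx, HeisAlg.flatMat, trMat, Dir.conj, apply_ite] <;>
    first
    | (split_ifs <;> simp_all)
    | abel

theorem tensRep_zOp_mid (X : Dir n → Module.End ℂ W) (α β : Fin n) (v : W) :
    tensRep X (trMat ε) (.bar β) (zOp n v) (.mid α) = (if α = β then (ε β : ℂ) else 0) • v := by
  simp [tensRep_bar_mid, zOp]

end Intertwine

namespace HeisAlg
variable {n : ℕ} {R : Type*} [CommRing R] [Algebra ℂ R] [StarRing R] [StarModule ℂ R]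
  (H : HeisAlg n R)

/-- The map `glue` as a linear map. -/
def glueHom (κ : Slot) (L : List Slot) : (TIdx n → MI n L → R) →ₗ[ℂ] (MI n (κ :: L) → R) where
  toFun := H.glue κ L
  map_add' := H.glue_add κ L
  map_smul' := H.glue_smul κ L

theorem glueHom_apply (κ : Slot) (L : List Slot) (v : TIdx n → MI n L → R) :
    H.glueHom κ L v = H.glue κ L v := rfl

theorem cov_glueHom (κ : Slot) (L : List Slot) (δ δ' : ℂ) (h : δ' = δ + slotSign κ) (a : Dir n)
    (v : TIdx n → MI n L → R) : H.cov (κ :: L) δ a (H.glueHom κ L v) =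
      H.glueHom κ L (tensRep (H.cov L δ') (flatMat H.ε κ) a v) := by
  subst h
  exact H.cov_glue κ L δ a v

theorem swap_cov_glueHom (L : List Slot) (δ δ' : ℂ) (h : δ' = δ - 1) (a : Dir n)
    (v : TIdx n → MI n L → R) : swapRep (H.cov (.loBar :: L) δ) a (H.glueHom .loBar L v) =
      H.glueHom .loBar L (tensRep (swapRep (H.cov L δ')) (trMat H.ε) a v) := by
  rw [swapRep_intertwine (X := tensRep (H.cov L δ') (flatMat H.ε .loBar))
    (fun a v => H.cov_glueHom .loBar L δ δ' h a v), swapRep_tensRep]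

end HeisAlg

/-! ### Powers of □ applied to D -/

section Coframe
variable {n : ℕ} {M : Type*} [TopologicalSpace M]
  [ChartedSpace (EuclideanSpace ℝ (Fin (2 * n + 1))) M]
  [IsManifold (𝓡 (2 * n + 1)) ∞ M] {S : PseudoHermitian n M} {U V : Set M}

namespace FlatCoframe
variable {K : FlatCoframe S U V} {L : List Slot} {f g : MI n L → M → ℂ}
  {φ : MI n L → smoothAlg n V}

theorem rep_mulZ_lo (h : Rep f φ) : Rep (mulZ .lo L f) (K.heis.glueHom .lo L (zOp n φ)) := by
  rintro ⟨A, I⟩ y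
  rw [HeisAlg.glueHom_apply, HeisAlg.glue_apply, sum_tIdx]
  cases A <;> simp [mulZ, HeisAlg.gauge, HeisAlg.trDiag, zOp, h I y]

theorem rep_mulZ_loBar (h : Rep f φ) :
    Rep (mulZ .loBar L f) (K.heis.glueHom .loBar L (zOp n φ)) := by
  rintro ⟨A, I⟩ y
  rw [HeisAlg.glueHom_apply, HeisAlg.glue_apply, sum_tIdx]
  cases A <;> simp [mulZ, HeisAlg.gauge, HeisAlg.trDiag, zOp, h I y]

theorem rep_boxPow (k : ℕ) : ∀ (w w' : ℂ) {f : MI n L → M → ℂ} {φ : MI n L → smoothAlg n V},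
    Rep f φ → Rep (K.F.boxPow L k w w' f) (boxOpPow K.C.ε (K.heis.cov L (w - w')) k w φ) := by
  induction k with
  | zero => intro w w' f φ h; exact h
  | succ k ih =>
    intro w w' f φ h
    have := ih (w - 1) (w' - 1) (rep_box (K := K) w w' h)
    rwa [sub_sub_sub_cancel_right] at this

theorem rep_boxBarPow (k : ℕ) : ∀ (w w' : ℂ) {f : MI n L → M → ℂ} {φ : MI n L → smoothAlg n V},
    Rep f φ → Rep (K.F.boxBarPow L k w w' f)
      (boxOpPow K.C.ε (swapRep (K.heis.cov L (w - w'))) k w' φ) := by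
  induction k with
  | zero => intro w w' f φ h; exact h
  | succ k ih =>
    intro w w' f φ h
    have := ih (w - 1) (w' - 1) (rep_boxBar (K := K) w w' h)
    rwa [sub_sub_sub_cancel_right] at this

theorem boxPow_eq_boxBarPow (k : ℕ) (w w' : ℂ) (hk : (n : ℂ) + w + w' + 1 = k) (h : Rep f φ)
    (I : MI n L) (y : V) : K.F.boxPow L k w w' f I y = K.F.boxBarPow L k w w' f I y := by
  rw [rep_boxPow k w w' h, rep_boxBarPow k w w' h,
    boxOpPow_swap K.C.ε_sq (K.heis.isHeis_cov L (w - w')) k w w' hk]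

theorem boxPow_D (m : ℕ) (w w' : ℂ) (hm : (n : ℂ) + w + w' = m) (h : Rep f φ)
    (I : MI n (.lo :: L)) (y : V) : K.F.boxPow (.lo :: L) m (w - 1) w' (K.F.D L w w' f) I y =
      -mulZ .lo L (K.F.boxPow L (m + 1) w w' f) I y := by
  have h1 := rep_boxPow (K := K) m (w - 1) w' (rep_D (K := K) w w' h)
  have h2 := rep_mulZ_lo (K := K) (rep_boxPow (K := K) (m + 1) w w' h)
  -- D lowers the weight difference by one, and the tractor index restores it in the gauge; the same
  -- representation thus occurs before and after.
  have e := boxOpPow_intertwine (ε := K.C.ε)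
    (K.heis.cov_glueHom .lo L (w - 1 - w') (w - w') (by rw [HeisAlg.slotSign]; ring)) m (w - 1)
    (dOp K.C.ε (K.heis.cov L (w - w')) m w φ)
  have e2 := boxOpPow_dOp_self K.C.ε_sq (K.heis.isHeis_cov L (w - w')) m w φ
  rw [h1, h2, hm, ← map_neg, ← HeisAlg.glueHom_apply, e]
  refine congrArg (fun v => evalHom y (K.heis.glueHom .lo L v I)) e2 |>.trans ?_
  rw [map_neg]
  rfl

theorem boxBarPow_DBar (m : ℕ) (w w' : ℂ) (hm : (n : ℂ) + w + w' = m) (h : Rep f φ)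
    (I : MI n (.loBar :: L)) (y : V) :
    K.F.boxBarPow (.loBar :: L) m w (w' - 1) (K.F.DBar L w w' f) I y =
      -mulZ .loBar L (K.F.boxBarPow L (m + 1) w w' f) I y := by
  have h1 := rep_boxBarPow (K := K) m w (w' - 1) (rep_DBar (K := K) w w' h)
  have h2 := rep_mulZ_loBar (K := K) (rep_boxBarPow (K := K) (m + 1) w w' h)
  have e := boxOpPow_intertwine (ε := K.C.ε)
    (K.heis.swap_cov_glueHom L (w - (w' - 1)) (w - w') (by ring)) m (w' - 1)
    (dOp K.C.ε (swapRep (K.heis.cov L (w - w'))) m w' φ)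
  have e2 := boxOpPow_dOp_self K.C.ε_sq (K.heis.isHeis_cov L (w - w')).swap m w' φ
  rw [h1, h2, hm, ← map_neg, ← HeisAlg.glueHom_apply, e]
  refine congrArg (fun v => evalHom y (K.heis.glueHom .loBar L v I)) e2 |>.trans ?_
  rw [map_neg]
  rfl

/-! ### Divergence of a multiple of Z -/

theorem glue_lo_top (v : TIdx n → MI n L → smoothAlg n V) (I : MI n L) :
    K.heis.glueHom .lo L v (.top, I) = v .top I := by
  rw [HeisAlg.glueHom_apply, HeisAlg.glue_apply, sum_tIdx]
  simp [HeisAlg.gauge, HeisAlg.trDiag]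

theorem glue_lo_mid (v : TIdx n → MI n L → smoothAlg n V) (α : Fin n) (I : MI n L) :
    K.heis.glueHom .lo L v (.mid α, I) = ∑ μ, K.g α μ * v (.mid μ) I := by
  rw [HeisAlg.glueHom_apply, HeisAlg.glue_apply, sum_tIdx]
  simp [HeisAlg.gauge, HeisAlg.trDiag]
  rfl

theorem glue_loBar_top (v : TIdx n → MI n L → smoothAlg n V) (I : MI n L) :
    K.heis.glueHom .loBar L v (.top, I) = v .top I := by
  rw [HeisAlg.glueHom_apply, HeisAlg.glue_apply, sum_tIdx]
  simp [HeisAlg.gauge, HeisAlg.trDiag]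

theorem glue_loBar_mid (v : TIdx n → MI n L → smoothAlg n V) (α : Fin n) (I : MI n L) :
    K.heis.glueHom .loBar L v (.mid α, I) = ∑ μ, star (K.g α μ) * v (.mid μ) I := by
  rw [HeisAlg.glueHom_apply, HeisAlg.glue_apply, sum_tIdx]
  simp [HeisAlg.gauge, HeisAlg.trDiag]
  rfl

theorem sum_hinv_h (y : V) :
    ∑ α, ∑ β, K.F.hinv α β y * evalHom y (K.hA α β) = n := by
  have h : ∀ α, ∑ β, K.F.hinv α β y * evalHom y (K.hA α β) = 1 := fun α => by
    have := congrArg (evalHom y) (congrFun (congrFun K.hA_mul_hiA α) α)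
    rw [Matrix.mul_apply, Matrix.one_apply_eq, map_one, map_sum] at this
    rw [← this]
    refine Finset.sum_congr rfl fun β _ => ?_
    rw [hinv_apply, map_mul, mul_comm]
    rfl
  rw [Finset.sum_congr rfl fun α _ => h α]
  simp

/-- The middle slot of Z g is zero, so only the connection entry h_{αβ̄} from the bottom slot to the
middle contributes. -/
theorem cov_bar_mulZ (w w' : ℂ) (h : Rep g φ) {f : MI n (.lo :: L) → M → ℂ}
    (hf : Rep f (K.heis.glueHom .lo L (zOp n φ))) (α β : Fin n) (I : MI n L) (y : V) :
    K.F.cov (.lo :: L) w w' (.bar β) f (.mid α, I) y = evalHom y (K.hA α β) * g I y := by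
  rw [rep_cov w w' (.bar β) hf, h I y, ← map_mul]
  congr 1
  rw [hA_apply, Finset.sum_mul]
  refine Finset.sum_congr rfl fun ν _ => ?_
  have e0 := K.heis.cov_glueHom .lo L (w - w') _ rfl (.bar ν) (zOp n φ)
  have e : K.heis.glueHom .lo L (tensRep (K.heis.cov L (w - w' + HeisAlg.slotSign .lo))
      (trMat K.C.ε) (.bar ν) (zOp n φ)) (.mid α, I) = K.g α ν * ((K.C.ε ν : ℂ) • φ I) := by
    rw [glue_lo_mid]
    simp only [tensRep_zOp_mid]
    rw [Finset.sum_eq_single ν (fun μ _ hμ => by rw [if_neg hμ, zero_smul]; exact mul_zero _)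
      (fun h => absurd (Finset.mem_univ _) h), if_pos rfl]
    rfl
  refine (congrArg (star (K.g β ν) * ·) ((congrFun e0 _).trans e)).trans ?_
  simp only [Algebra.smul_def]
  ring

theorem cov_lo_mulZ (w w' : ℂ) (h : Rep g φ) {f : MI n (.loBar :: L) → M → ℂ}
    (hf : Rep f (K.heis.glueHom .loBar L (zOp n φ))) (α β : Fin n) (I : MI n L) (y : V) :
    K.F.cov (.loBar :: L) w w' (.lo α) f (.mid β, I) y = evalHom y (K.hA α β) * g I y := by
  rw [rep_cov w w' (.lo α) hf, h I y, ← map_mul]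
  congr 1
  rw [hA_apply, Finset.sum_mul]
  refine Finset.sum_congr rfl fun ν _ => ?_
  have e0 := K.heis.swap_cov_glueHom L (w - w') _ rfl (.bar ν) (zOp n φ)
  have e : K.heis.glueHom .loBar L (tensRep (swapRep (K.heis.cov L (w - w' - 1)))
      (trMat K.C.ε) (.bar ν) (zOp n φ)) (.mid β, I) = star (K.g β ν) * ((K.C.ε ν : ℂ) • φ I) := by
    rw [glue_loBar_mid]
    simp only [tensRep_zOp_mid]
    rw [Finset.sum_eq_single ν (fun μ _ hμ => by rw [if_neg hμ, zero_smul]; exact mul_zero _)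
      (fun h => absurd (Finset.mem_univ _) h), if_pos rfl]
    rfl
  refine (congrArg (K.g α ν * ·) ((congrFun e0 _).trans e)).trans ?_
  simp only [Algebra.smul_def]
  ring

/-- With m = n + w + w', the components of D_Ā in the top, middle and bottom slots contribute w' m,
n m (the trace of h) and n + w' (the top component of the conjugate □ on Z g, negated). The sum is
(n+w')(m+1). -/
theorem divD_mulZ (w w' : ℂ) (h : Rep g φ) {f : MI n (.lo :: L) → M → ℂ}
    (hf : ∀ I (y : V), f I y = mulZ .lo L g I y) (I : MI n L) (y : V) :
    K.F.divD L w w' f I y = (n + w') * (n + w + w' + 1) * g I y := by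
  have hf' : Rep f (K.heis.glueHom .lo L (zOp n φ)) := fun I y =>
    (hf I y).trans (rep_mulZ_lo (K := K) h I y)
  have hb : K.F.boxBar (.lo :: L) w w' f (.top, I) y = -(n + w') * g I y := by
    rw [rep_boxBar w w' hf', boxOp_intertwine (swapRep_intertwine
      (K.heis.cov_glueHom .lo L (w - w') _ rfl)), glue_lo_top, h I y]
    refine (congrArg (fun v : MI n L → smoothAlg n V => evalHom y (v I))
      (boxOp_swap_zOp K.C.ε_sq w' φ)).trans ?_
    rw [Pi.smul_apply, evalHom_smul]
  have hbot : f (.bot, I) y = g I y := hf _ y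
  simp only [AdmissibleCoframe.divD, tSum_eq, sum_tIdx, AdmissibleCoframe.trInv,
    AdmissibleCoframe.DBar, hb, hbot, cov_bar_mulZ w w' h hf', zero_mul, one_mul, add_zero,
    zero_add, Finset.sum_const_zero]
  have e : ∀ α β, K.F.hinv α β y * ((n + w + w') * (evalHom y (K.hA α β) * g I y)) =
      (K.F.hinv α β y * evalHom y (K.hA α β)) * ((n + w + w') * g I y) := fun α β => by ring
  simp only [e, ← Finset.sum_mul, sum_hinv_h]
  ring

theorem divDBar_mulZ (w w' : ℂ) (h : Rep g φ) {f : MI n (.loBar :: L) → M → ℂ}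
    (hf : ∀ I (y : V), f I y = mulZ .loBar L g I y) (I : MI n L) (y : V) :
    K.F.divDBar L w w' f I y = (n + w) * (n + w + w' + 1) * g I y := by
  have hf' : Rep f (K.heis.glueHom .loBar L (zOp n φ)) := fun I y =>
    (hf I y).trans (rep_mulZ_loBar (K := K) h I y)
  have hb : K.F.box (.loBar :: L) w w' f (.top, I) y = -(n + w) * g I y := by
    -- For a barred index, □ itself is the conjugate operator of the swapped representation, so
    -- swapping twice brings in `boxOp_swap_zOp`.
    have e := boxOp_intertwine (ε := K.C.ε) (swapRep_intertwine
      (K.heis.swap_cov_glueHom L (w - w') _ rfl)) w (zOp n φ)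
    rw [swapRep_swapRep] at e
    rw [rep_box w w' hf', e, glue_loBar_top, h I y]
    refine (congrArg (fun v : MI n L → smoothAlg n V => evalHom y (v I))
      (boxOp_swap_zOp K.C.ε_sq w φ)).trans ?_
    rw [Pi.smul_apply, evalHom_smul]
  have hbot : f (.bot, I) y = g I y := hf _ y
  simp only [AdmissibleCoframe.divDBar, tSum_eq, sum_tIdx, AdmissibleCoframe.trInv,
    AdmissibleCoframe.D, hb, hbot, cov_lo_mulZ w w' h hf', zero_mul, one_mul, add_zero,
    zero_add, Finset.sum_const_zero]
  have e : ∀ α β, K.F.hinv α β y * ((n + w + w') * (evalHom y (K.hA α β) * g I y)) =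
      (K.F.hinv α β y * evalHom y (K.hA α β)) * ((n + w + w') * g I y) := fun α β => by ring
  simp only [e, ← Finset.sum_mul, sum_hinv_h]
  ring

/-! ### Iterated tractor operators and the constants -/

theorem mulZ_const (κ : Slot) {x : M} {c : ℂ} (h : ∀ I, f I x = c * g I x) (I : MI n (κ :: L)) :
    mulZ κ L f I x = c * mulZ κ L g I x := by
  obtain ⟨A, I⟩ := I
  cases A <;> simp [mulZ, h]

theorem mulZPow_const (κ : Slot) {x : M} {c : ℂ} (h : ∀ I, f I x = c * g I x) (k : ℕ) :
    ∀ I, mulZPow κ L k f I x = c * mulZPow κ L k g I x := by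
  induction k with
  | zero => exact h
  | succ k ih => exact mulZ_const κ ih

variable (K) in
theorem exists_rep_DPow (w w' : ℂ) (h : Rep f φ) (k : ℕ) :
    ∃ ψ : MI n (rep .lo k L) → smoothAlg n V, Rep (K.F.DPow L w w' k f) ψ := by
  induction k with
  | zero => exact ⟨φ, h⟩
  | succ k ih =>
    obtain ⟨ψ, hψ⟩ := ih
    exact ⟨_, rep_D (K := K) (w - k) w' hψ⟩

variable (K) in
theorem exists_rep_DBarPow (w w' : ℂ) (h : Rep f φ) (k : ℕ) :
    ∃ ψ : MI n (rep .loBar k L) → smoothAlg n V, Rep (K.F.DBarPow L w w' k f) ψ := by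
  induction k with
  | zero => exact ⟨φ, h⟩
  | succ k ih =>
    obtain ⟨ψ, hψ⟩ := ih
    exact ⟨_, rep_DBar (K := K) w (w' - k) hψ⟩

theorem exists_rep_mulZPow_lo (K : FlatCoframe S U V) (h : Rep f φ) (k : ℕ) :
    ∃ ψ : MI n (rep .lo k L) → smoothAlg n V, Rep (mulZPow .lo L k f) ψ := by
  induction k with
  | zero => exact ⟨φ, h⟩
  | succ k ih =>
    obtain ⟨ψ, hψ⟩ := ih
    exact ⟨_, rep_mulZ_lo (K := K) hψ⟩

theorem exists_rep_mulZPow_loBar (K : FlatCoframe S U V) (h : Rep f φ) (k : ℕ) :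
    ∃ ψ : MI n (rep .loBar k L) → smoothAlg n V, Rep (mulZPow .loBar L k f) ψ := by
  induction k with
  | zero => exact ⟨φ, h⟩
  | succ k ih =>
    obtain ⟨ψ, hψ⟩ := ih
    exact ⟨_, rep_mulZ_loBar (K := K) hψ⟩

/-- Each D outside the others trades one factor of □ for −Z. The weight condition says that □^{m+1}
is the power that exactly exhausts the outermost D. -/
theorem boxPow_DPow (w w' : ℂ) (h : Rep f φ) (j : ℕ) : ∀ m : ℕ, (n : ℂ) + w + w' = j + m →
    ∀ I (y : V), K.F.boxPow (rep .lo j L) (m + 1) (w - j) w' (K.F.DPow L w w' j f) I y =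
      (-1) ^ j * mulZPow .lo L j (K.F.boxPow L (j + m + 1) w w' f) I y := by
  induction j with
  | zero =>
    intro m _ I y
    rw [Nat.cast_zero, sub_zero, pow_zero, one_mul, zero_add]
    rfl
  | succ j ih =>
    intro m hm I y
    obtain ⟨ψ, hψ⟩ := exists_rep_DPow K w w' h j
    have h1 := boxPow_D (K := K) (m + 1) (w - j) w'
      (by push_cast at hm ⊢; linear_combination hm) hψ I y
    have h2 := ih (m + 1) (by push_cast at hm ⊢; linear_combination hm)
    have e : w - ((j + 1 : ℕ) : ℂ) = w - j - 1 := by push_cast; ring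
    have e' : j + (m + 1) + 1 = j + 1 + m + 1 := by omega
    rw [e'] at h2
    rw [e]
    refine h1.trans ?_
    rw [mulZ_const .lo (fun I => h2 I y) I, pow_succ]
    simp only [mulZPow]
    ring

/-- The exchange rule for the barred D is known for powers of the conjugate of □. At the weights
that occur, these equal the powers of □, both before and after the exchange. -/
theorem boxPow_DBarPow (w w' : ℂ) (h : Rep f φ) (j : ℕ) : ∀ m : ℕ, (n : ℂ) + w + w' = j + m →
    ∀ I (y : V), K.F.boxPow (rep .loBar j L) (m + 1) w (w' - j) (K.F.DBarPow L w w' j f) I y =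
      (-1) ^ j * mulZPow .loBar L j (K.F.boxPow L (j + m + 1) w w' f) I y := by
  induction j with
  | zero =>
    intro m _ I y
    rw [Nat.cast_zero, sub_zero, pow_zero, one_mul, zero_add]
    rfl
  | succ j ih =>
    intro m hm I y
    obtain ⟨ψ, hψ⟩ := exists_rep_DBarPow K w w' h j
    have h1 := boxBarPow_DBar (K := K) (m + 1) w (w' - j)
      (by push_cast at hm ⊢; linear_combination hm) hψ I y
    have h2 := ih (m + 1) (by push_cast at hm ⊢; linear_combination hm)
    have e : w' - ((j + 1 : ℕ) : ℂ) = w' - j - 1 := by push_cast; ring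
    have e' : j + (m + 1) + 1 = j + 1 + m + 1 := by omega
    rw [e'] at h2
    have h3 : ∀ I, K.F.boxBarPow (rep .loBar j L) (m + 1 + 1) w (w' - j)
        (K.F.DBarPow L w w' j f) I y =
        (-1) ^ j * mulZPow .loBar L j (K.F.boxPow L (j + 1 + m + 1) w w' f) I y := fun I => by
      rw [← h2 I y]
      exact (boxPow_eq_boxBarPow _ _ _ (by push_cast at hm ⊢; linear_combination hm) hψ I y).symm
    rw [e]
    refine (boxPow_eq_boxBarPow _ _ _ (by push_cast at hm ⊢; linear_combination hm)
      (rep_DBar (K := K) w (w' - j) hψ) I y).trans (h1.trans ?_)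
    rw [mulZ_const .loBar h3 I, pow_succ]
    simp only [mulZPow]
    ring

theorem boxDD_eq (w w' : ℂ) (k₁ k₂ : ℕ) (hk : (n : ℂ) + w + w' = k₁ + k₂) (h : Rep f φ)
    (I : MI n (rep .lo k₁ (rep .loBar k₂ L))) (y : V) : K.F.boxDD L w w' k₁ k₂ f I y =
      (-1) ^ (k₁ + k₂) * mulZPow .lo (rep .loBar k₂ L) k₁ (mulZPow .loBar L k₂
        (K.F.boxPow L (k₁ + k₂ + 1) w w' f)) I y := by
  obtain ⟨ψ, hψ⟩ := exists_rep_DBarPow K w w' h k₂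
  -- The single □ first absorbs the unbarred operators and thereby becomes □^{k₁+1}; this is the
  -- power needed to absorb the barred ones.
  have h1 := boxPow_DPow (K := K) w (w' - k₂) hψ k₁ 0
    (by push_cast; linear_combination hk) I y
  have h2 := fun I => boxPow_DBarPow (K := K) w w' h k₂ k₁ (by linear_combination hk) I y
  refine h1.trans ?_
  rw [Nat.add_zero, mulZPow_const .lo h2 k₁ I, add_comm k₂ k₁, pow_add]
  ring

/-- Each divergence removes one Z and lowers w' by one, so that the factors of `divD_mulZ` are
multiplied along w', w'−1, …; `c` accumulates them in the induction. -/
theorem divDPow_mulZPow (w : ℂ) (h : Rep g φ) (k : ℕ) :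
    ∀ (w' c : ℂ) {f : MI n (rep .lo k L) → M → ℂ}
    (_ : ∀ I (y : V), f I y = c * mulZPow .lo L k g I y) (I : MI n L) (y : V),
    K.F.divDPow L k w w' f I y =
      c * (∏ i ∈ Finset.range k, ((n + (w' - i)) * (n + w + (w' - i) + 1))) * g I y := by
  induction k with
  | zero => intro w' c f hf I y; rw [Finset.prod_range_zero, mul_one]; exact hf I y
  | succ k ih =>
    intro w' c f hf I y
    obtain ⟨ψ, hψ⟩ := exists_rep_mulZPow_lo K h k
    have hc : Rep (fun I x => c * mulZPow .lo L k g I x) (c • ψ) := fun I y =>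
      congrArg (c * ·) (hψ I y)
    have hd := divD_mulZ (K := K) w w' hc (f := f) fun I y =>
      (hf I y).trans (mulZ_const .lo (fun _ => rfl) I).symm
    rw [AdmissibleCoframe.divDPow, ih (w' - 1) ((n + w') * (n + w + w' + 1) * c)
      (fun I y => by rw [hd I y]; ring), Finset.prod_range_succ']
    have e : ∀ i : ℕ, w' - 1 - i = w' - ((i + 1 : ℕ) : ℂ) := fun i => by push_cast; ring
    simp only [e, Nat.cast_zero, sub_zero]
    ring

theorem divDBarPow_mulZPow (h : Rep g φ) (k : ℕ) :
    ∀ (w w' c : ℂ) {f : MI n (rep .loBar k L) → M → ℂ}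
    (_ : ∀ I (y : V), f I y = c * mulZPow .loBar L k g I y) (I : MI n L) (y : V),
    K.F.divDBarPow L k w w' f I y =
      c * (∏ i ∈ Finset.range k, ((n + (w - i)) * (n + (w - i) + w' + 1))) * g I y := by
  induction k with
  | zero => intro w w' c f hf I y; rw [Finset.prod_range_zero, mul_one]; exact hf I y
  | succ k ih =>
    intro w w' c f hf I y
    obtain ⟨ψ, hψ⟩ := exists_rep_mulZPow_loBar K h k
    have hc : Rep (fun I x => c * mulZPow .loBar L k g I x) (c • ψ) := fun I y =>
      congrArg (c * ·) (hψ I y)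
    have hd := divDBar_mulZ (K := K) w w' hc (f := f) fun I y =>
      (hf I y).trans (mulZ_const .loBar (fun _ => rfl) I).symm
    rw [AdmissibleCoframe.divDBarPow, ih (w - 1) w' ((n + w) * (n + w + w' + 1) * c)
      (fun I y => by rw [hd I y]; ring), Finset.prod_range_succ']
    have e : ∀ i : ℕ, w - 1 - i = w - ((i + 1 : ℕ) : ℂ) := fun i => by push_cast; ring
    simp only [e, Nat.cast_zero, sub_zero]
    ring

/-- The k signs from the weights cancel the k signs from −(a+i+1). Reversing the order turns the
weights into v, v−1, …, and the remaining factors extend a! to (a+k)!. -/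
theorem prod_weights (v : ℂ) (a k : ℕ) :
    (a.factorial : ℂ) * ∏ i ∈ Finset.range k, ((k - 1 - i - v) * -((a : ℂ) + i + 1)) =
      ((a + k).factorial : ℂ) * ∏ i ∈ Finset.range k, (v - i) := by
  have h1 : ∏ i ∈ Finset.range k, (v - i) = ∏ i ∈ Finset.range k, (v - (k - 1 - i)) := by
    rw [← Finset.prod_range_reflect]
    refine Finset.prod_congr rfl fun i hi => ?_
    have hi := Finset.mem_range.1 hi
    rw [Nat.sub_sub, Nat.cast_sub (by omega)]
    push_cast
    ring
  have h2 : ∀ k : ℕ, (a.factorial : ℂ) * ∏ i ∈ Finset.range k, ((a : ℂ) + i + 1) =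
      ((a + k).factorial : ℂ) := fun k => by
    induction k with
    | zero => simp
    | succ k ih =>
      rw [Finset.prod_range_succ, ← mul_assoc, ih, ← Nat.add_assoc, Nat.factorial_succ]
      push_cast
      ring
  rw [h1, ← h2, mul_assoc, ← Finset.prod_mul_distrib]
  congr 1
  refine Finset.prod_congr rfl fun i _ => ?_
  ring

theorem fullOp_eq (w w' : ℂ) (k₁ k₂ : ℕ) (hk : (n : ℂ) + w + w' = k₁ + k₂) (h : Rep f φ)
    (I : MI n L) (y : V) : K.F.fullOp L w w' k₁ k₂ f I y =
      (-1) ^ (k₁ + k₂) * ((k₁ + k₂).factorial : ℂ) * (∏ a ∈ Finset.range k₁, (w - a)) *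
        (∏ b ∈ Finset.range k₂, (w' - b)) * K.F.boxPow L (k₁ + k₂ + 1) w w' f I y := by
  have hB := rep_boxPow (K := K) (k₁ + k₂ + 1) w w' h
  obtain ⟨ψ, hψ⟩ := exists_rep_mulZPow_loBar K hB k₂
  have h1 := divDPow_mulZPow (K := K) (w - k₁ - 1) hψ k₁ (w' - k₂ - 1) _ (boxDD_eq w w' k₁ k₂ hk h)
  have h2 := divDBarPow_mulZPow (K := K) hB k₂ (w - k₁ - 1) (w' - k₂ - 1 - k₁) _ h1 I y
  refine h2.trans ?_
  -- The unbarred divergences produce k₁!, and the barred ones continue it to (k₁+k₂)!. By the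
  -- weight condition, n plus a shifted w' gives the factors containing w, and conversely.
  have e1 := prod_weights w 0 k₁
  have e2 := prod_weights w' k₁ k₂
  have e3 : ∏ i ∈ Finset.range k₁, (((n : ℂ) + (w' - k₂ - 1 - i)) *
      (n + (w - k₁ - 1) + (w' - k₂ - 1 - i) + 1)) =
      ∏ i ∈ Finset.range k₁, ((k₁ - 1 - i - w) * -(((0 : ℕ) : ℂ) + i + 1)) :=
    Finset.prod_congr rfl fun i _ => by
      have a1 : (n : ℂ) + (w' - k₂ - 1 - i) = k₁ - 1 - i - w := by linear_combination hk
      have a2 : (n : ℂ) + (w - k₁ - 1) + (w' - k₂ - 1 - i) + 1 = -(((0 : ℕ) : ℂ) + i + 1) := by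
        push_cast
        linear_combination hk
      rw [a1, a2]
  have e4 : ∏ i ∈ Finset.range k₂, (((n : ℂ) + (w - k₁ - 1 - i)) *
      (n + (w - k₁ - 1 - i) + (w' - k₂ - 1 - k₁) + 1)) =
      ∏ i ∈ Finset.range k₂, ((k₂ - 1 - i - w') * -((k₁ : ℂ) + i + 1)) :=
    Finset.prod_congr rfl fun i _ => by
      have a1 : (n : ℂ) + (w - k₁ - 1 - i) = k₂ - 1 - i - w' := by linear_combination hk
      have a2 : (n : ℂ) + (w - k₁ - 1 - i) + (w' - k₂ - 1 - k₁) + 1 = -((k₁ : ℂ) + i + 1) := by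
        linear_combination hk
      rw [a2, a1]
  rw [Nat.factorial_zero, Nat.cast_one, one_mul, zero_add] at e1
  rw [e3, e4, e1]
  linear_combination ((-1) ^ (k₁ + k₂) * (∏ a ∈ Finset.range k₁, (w - a)) *
    K.F.boxPow L (k₁ + k₂ + 1) w w' f I y) * e2

end FlatCoframe

theorem exists_flatCoframe (S : PseudoHermitian n M) (hS : S.IsFlat) {U : Set M} (hU : IsOpen U)
    (F : AdmissibleCoframe S U) {x : M} (hx : x ∈ U) :
    ∃ (V : Set M) (K : FlatCoframe S U V), x ∈ V ∧ K.F = F := by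
  obtain ⟨V, hxV, ⟨C⟩⟩ := hS.exists_flatChart x
  exact ⟨V ∩ U, ⟨C.restrict (C.isOpen.inter hU) inter_subset_left, F, inter_subset_right⟩,
    ⟨hxV, hx⟩, rfl⟩

end Coframe

end CRTractor

end

theorem proposition4p2 (n : ℕ) (hn : 1 ≤ n) {M : Type*} [TopologicalSpace M]
    [ChartedSpace (EuclideanSpace ℝ (Fin (2 * n + 1))) M]
    [IsManifold (𝓡 (2 * n + 1)) ∞ M]
    (S : CRTractor.PseudoHermitian n M) (hS : S.IsFlat)
    {ι : Type*} (E : CRTractor.DensityBundle S ι)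
    (w w' : ℂ) (hww' : ∃ m : ℤ, w - w' = m)
    (k k₁ k₂ : ℕ) (hk : 1 ≤ k) (hwk : (n : ℂ) + w + w' + 1 = k) (hk₁₂ : k₁ + k₂ = k - 1)
    (L : List CRTractor.Slot) (f : CRTractor.TractorSection E L w w') (i : ι) :
    (∀ I, ∀ x ∈ E.U i,
      (E.frame i).boxDD L w w' k₁ k₂ (f.comp i) I x =
        (-1) ^ (k - 1) *
          CRTractor.mulZPow .lo (CRTractor.rep .loBar k₂ L) k₁
            (CRTractor.mulZPow .loBar L k₂
              ((E.frame i).boxPow L k w w' (f.comp i))) I x) ∧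
    (∀ I, ∀ x ∈ E.U i,
      (E.frame i).fullOp L w w' k₁ k₂ (f.comp i) I x =
        (-1) ^ (k - 1) * ((k - 1).factorial : ℂ) *
          (∏ a ∈ Finset.range k₁, (w - a)) * (∏ b ∈ Finset.range k₂, (w' - b)) *
          (E.frame i).boxPow L k w w' (f.comp i) I x) ∧
    (∀ I, ∀ x ∈ E.U i,
      (E.frame i).boxPow L k w w' (f.comp i) I x =
        (E.frame i).boxBarPow L k w w' (f.comp i) I x) := by
  obtain rfl : k = k₁ + k₂ + 1 := by omega
  rw [Nat.add_sub_cancel]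
  have hk' : (n : ℂ) + w + w' = k₁ + k₂ := by
    push_cast at hwk
    linear_combination hwk
  -- Each identity is checked at one point, on a flat chart inside the trivializing set where the
  -- components of `f` are smooth functions.
  have loc : ∀ x ∈ E.U i, ∃ (V : Set M) (K : CRTractor.FlatCoframe S (E.U i) V)
      (φ : CRTractor.MI n L → CRTractor.smoothAlg n V), x ∈ V ∧ K.F = E.frame i ∧
        CRTractor.FlatCoframe.Rep (f.comp i) φ := by
    intro x hx
    obtain ⟨V, K, hxV, hK⟩ := CRTractor.exists_flatCoframe S hS (E.isOpen i) (E.frame i) hx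
    exact ⟨V, K, fun I => CRTractor.toAlg (f.comp i I) ((f.smooth i I).mono K.sub), hxV, hK,
      fun I y => rfl⟩
  refine ⟨fun I x hx => ?_, fun I x hx => ?_, fun I x hx => ?_⟩ <;>
    obtain ⟨V, K, φ, hxV, hK, hφ⟩ := loc x hx <;> rw [← hK]
  · exact CRTractor.FlatCoframe.boxDD_eq w w' k₁ k₂ hk' hφ I ⟨x, hxV⟩
  · exact CRTractor.FlatCoframe.fullOp_eq w w' k₁ k₂ hk' hφ I ⟨x, hxV⟩
  · exact CRTractor.FlatCoframe.boxPow_eq_boxBarPow _ w w' hwk hφ I ⟨x, hxV⟩
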